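/- Let $U$ be a compact Lie group with Lie algebra $\mathcal U$ and an Ad-invariant inner product $\langle\,,\rangle$; write $gxg^{-1}$ for $\mathrm{Ad}(g)x$. Let $a\in\mathcal U$ be such that the Adjoint orbit $M_a=\{gag^{-1}: g\in U\}$ is a principal orbit (the isotropy group of $a$ is conjugate to a subgroup of the isotropy group of every $y\in\mathcal U$). Let $b$ be normal to $M_a$ at $a$, $\mathcal U_a=\{x:[x,a]=0\}$, and let $\pi_0,\pi_1$ be the orthogonal projections onto $\mathcal U_a$, $\mathcal U_a^\perp$. Let $C_a(\mathbb R,M_a)$ be the space of smooth curves $\gamma:\mathbb R\to M_a$ with $\gamma(x)\to a$ as $x\to-\infty$ and $\gamma_x$ rapidly decreasing; its tangent vectors at $\gamma$ are the smooth fields $\xi$ along $\gamma$ tangent to $M_a$ with $\xi\to0$ at $-\infty$ and $\xi_x$ rapidly decreasing. The development map $\Phi:C_a(\mathbb R,M_a)\to\mathcal S(\mathbb R,\mathcal U_a^\perp)$ is $\Phi(\gamma)=g^{-1}g_x$, where $g:\mathbb R\to U$ is the smooth map with $\gamma=gag^{-1}$, $g(x)\to e$ as $x\to-\infty$, and $g^{-1}g_x\in\mathcal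 S(\mathbb R,\mathcal U_a^\perp)$. Put $J_a(v)=[v,a]$, $$P_u(v)=v_x+\pi_1([u,v])+[u,h],\qquad h(x)=-\int_{-\infty}^x\pi_0([u,v])\,ds,\qquad (J_3)_u=(P_uJ_a^{-1})^3J_a .$$ Let $\Lambda=\Phi^*(J_3)$ be the induced operator on $C_a(\mathbb R,M_a)$, $\Lambda_\gamma=d\Phi_\gamma^{-1}\circ (J_3)_{\Phi(\gamma)}\circ (d\Phi_\gamma^*)^{-1}$, where $d\Phi_\gamma^*$ is the formal $L^2$ adjoint of $d\Phi_\gamma$ (with the convention $\partial^{-1}=\int_{-\infty}^x$, $(\partial^{-1})^*=-\partial^{-1}$, so that $P_u$ and $J_a$ are skew-adjoint); the covectors, that is the arguments of $d\Phi_\gamma^*$ and $(J_3)_{\Phi(\gamma)}$, are the smooth maps $w:\mathbb R\to\mathcal U_a^\perp$ that decay rapidly with all derivatives as $x\to-\infty$. Let $$H_b(\gamma)=\int_{-\infty}^\infty\langle\gamma(x),b\rangle\,dx,$$ where the (in general divergent) integral is understood through its changes along compactly supported variations $\gamma_s$ of $\gamma$: the gradient $\nabla H_b(\gamma)$ is the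 tangent vector at $\gamma$ with $\frac{d}{ds}\big|_{s=0}\int\langle\gamma_s-\gamma,b\rangle dx=\int\langle\nabla H_b(\gamma),\partial_s\gamma_s|_{s=0}\rangle dx$ for all of them. The Hamiltonian flow of a functional $H$ with respect to $\Lambda$ is $\gamma_t=\Lambda_\gamma(\nabla H(\gamma))$. Then $\hat b(gag^{-1})=gbg^{-1}$ is a well-defined field on $M_a$. For each $\gamma\in C_a(\mathbb R,M_a)$ the curve $\hat b(\gamma)$ is smooth, and the Hamiltonian vector of $H_b$ at $\gamma$ with respect to $\Lambda$ exists, is unique and is $$\Lambda_\gamma(\nabla H_b(\gamma))=-(\hat b(\gamma))_x .$$ Consequently the Hamiltonian flow of $-H_b$ with respect to $\Lambda$ is the Ferapontov flow $$\gamma_t=(\hat b(\gamma))_x:$$ a family $\gamma(\cdot,t)\in C_a(\mathbb R,M_a)$, $t$ in an open set of times, solves the one if and only if it solves the other. -/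

import Mathlib

open scoped Manifold ContDiff RealInnerProductSpace SchwartzMap Topology
open Filter MeasureTheory Set

noncomputable section

namespace AdjointCurves

/-! ### The Lie algebra, the Adjoint action and Adjoint orbits

`U` is a Lie group modelled on the Euclidean space `E`.  Its Lie algebra, the tangent space at the
identity, is by definition a copy of the vector space `E`; the Ad-invariant inner product on the Lie
algebra is the inner product of `E`.  Elements of the Lie algebra are written as elements of `E`. -/

section Algebra

variable {E : Type*} [NormedAddCommGroup E] [InnerProductSpace ℝ E] [FiniteDimensional ℝ E]

/-- The bracket of the Lie algebra of `U` (Mathlib's bracket of `GroupLieAlgebra`). -/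
def br (U : Type*) [TopologicalSpace U] [ChartedSpace E U] [Group U] (x y : E) : E :=
  (⁅(show GroupLieAlgebra 𝓘(ℝ, E) U from x), (show GroupLieAlgebra 𝓘(ℝ, E) U from y)⁆ :
    GroupLieAlgebra 𝓘(ℝ, E) U)

/-- The Adjoint action: `Ad g` is the differential at `1` of the conjugation `h ↦ g h g⁻¹`
(for a matrix group, `Ad g x = g x g⁻¹`). -/
def Ad {U : Type*} [TopologicalSpace U] [ChartedSpace E U] [Group U] (g : U) (x : E) : E :=
  (mfderiv 𝓘(ℝ, E) 𝓘(ℝ, E) (fun h : U => g * h * g⁻¹) 1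
    (show TangentSpace 𝓘(ℝ, E) (1 : U) from x) : E)

/-- `g⁻¹ g_x`, the derivative at `s = x` of `s ↦ g(x)⁻¹ g(s)`, an element of the Lie algebra. -/
def leftLogDeriv {U : Type*} [TopologicalSpace U] [ChartedSpace E U] [Group U]
    (g : ℝ → U) (x : ℝ) : E :=
  (mfderiv 𝓘(ℝ, ℝ) 𝓘(ℝ, E) (fun s : ℝ => (g x)⁻¹ * g s) x
    (show TangentSpace 𝓘(ℝ, ℝ) x from (1 : ℝ)) : E)

/-- The inner product of `E` is an Ad-invariant inner product on the Lie algebra of `U`. -/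
def AdInvariant (E U : Type*) [NormedAddCommGroup E] [InnerProductSpace ℝ E]
    [FiniteDimensional ℝ E] [TopologicalSpace U] [ChartedSpace E U] [Group U] : Prop :=
  ∀ (g : U) (x y : E), ⟪Ad g x, Ad g y⟫ = ⟪x, y⟫

variable (U : Type*) [TopologicalSpace U] [ChartedSpace E U] [Group U]

/-- The Adjoint orbit `M_a`. -/
def orbit (a : E) : Set E := {y | ∃ g : U, Ad g a = y}

/-- `M_a` is a principal orbit: its isotropy group is minimal, i.e. for every `y` the isotropy group
of `a` is conjugate to a subgroup of the isotropy group of `y`. -/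
def IsPrincipal (a : E) : Prop :=
  ∀ y : E, ∃ k : U, ∀ h : U, Ad h a = a → Ad (k * h * k⁻¹) y = y

variable [LieGroup 𝓘(ℝ, E) ∞ U]

/-- The linear map `J_y(x) = [x, y]`. -/
def J (y : E) : E →ₗ[ℝ] E where
  toFun x := br U x y
  map_add' x x' := by
    have : LieGroup 𝓘(ℝ, E) (minSmoothness ℝ 3) U := by
      rw [minSmoothness_of_isRCLikeNormedField]; infer_instance
    exact add_lie (L := GroupLieAlgebra 𝓘(ℝ, E) U) (M := GroupLieAlgebra 𝓘(ℝ, E) U) x x' y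
  map_smul' c x := by
    have : LieGroup 𝓘(ℝ, E) (minSmoothness ℝ 3) U := by
      rw [minSmoothness_of_isRCLikeNormedField]; infer_instance
    have : CompleteSpace E := FiniteDimensional.complete ℝ E
    exact smul_lie (R := ℝ) (L := GroupLieAlgebra 𝓘(ℝ, E) U)
      (M := GroupLieAlgebra 𝓘(ℝ, E) U) c x y

/-- The isotropy subalgebra `𝒰_y = {x | [x, y] = 0}`. -/
def isotropy (y : E) : Submodule ℝ E := LinearMap.ker (J U y)

/-- The tangent space at `y` of the Adjoint orbit through `y`: the vectors `[x, y]`. -/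
def orbitTangent (y : E) : Submodule ℝ E := LinearMap.range (J U y)

/-- The normal space at `y` of the Adjoint orbit through `y`. -/
def orbitNormal (y : E) : Submodule ℝ E := (orbitTangent U y)ᗮ

/-- Orthogonal projection onto `𝒰_a`. -/
def proj₀ (a x : E) : E := (isotropy U a).starProjection x

/-- Orthogonal projection onto `𝒰_a^⊥`. -/
def proj₁ (a x : E) : E := (isotropy U a)ᗮ.starProjection x

/-- The inverse of the restriction of `J_a` to `𝒰_a^⊥` (with value `0` outside the image). -/
def JInv (a y : E) : E :=
  open Classical in
  if h : ∃ z ∈ (isotropy U a)ᗮ, J U a z = y then h.choose else 0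

/-- The normal field `b̂` on `M_a`, `b̂(g a g⁻¹) = g b g⁻¹` (with value `0` outside `M_a`). -/
def hat (a b : E) (y : E) : E :=
  open Classical in
  if h : ∃ g : U, Ad g a = y then Ad h.choose b else 0

/-! ### The operators on curves in `𝒰_a^⊥` -/

/-- `P_u(v) = v_x + π₁([u, v]) + [u, h]`, `h(x) = - ∫_{-∞}^x π₀([u(s), v(s)]) ds`. -/
def P (a : E) (u v : ℝ → E) (x : ℝ) : E :=
  deriv v x + proj₁ U a (br U (u x) (v x))
    + br U (u x) (-∫ s in Iic x, proj₀ U a (br U (u s) (v s)))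

/-- The operator `P_u J_a⁻¹`. -/
def PJInv (a : E) (u v : ℝ → E) : ℝ → E := P U a u (fun x => JInv U a (v x))

/-- The third Poisson operator `(J₃)_u = (P_u J_a⁻¹)³ J_a`. -/
def J₃ (a : E) (u v : ℝ → E) : ℝ → E :=
  PJInv U a u (PJInv U a u (PJInv U a u (fun x => J U a (v x))))

/-! ### The space of curves and the development map -/

/-- `γ ∈ C_a(ℝ, M_a)`: `γ` is a smooth curve in `M_a`, `γ(x) → a` as `x → -∞` and `γ_x` is rapidly
decreasing. -/
structure IsCurve (a : E) (γ : ℝ → E) : Prop where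
  smooth : ContDiff ℝ ∞ γ
  mem : ∀ x, γ x ∈ orbit U a
  deriv_mem : ∀ x, deriv γ x ∈ orbitTangent U (γ x)
  lim : Tendsto γ atBot (𝓝 a)
  schwartz : ∃ φ : 𝓢(ℝ, E), ∀ x, φ x = deriv γ x

/-- `ξ ∈ T(C_a(ℝ, M_a))_γ`: a smooth field along `γ` tangent to `M_a`, with `ξ(x) → 0` as
`x → -∞` and `ξ_x` rapidly decreasing. -/
structure IsTangentField (γ ξ : ℝ → E) : Prop where
  smooth : ContDiff ℝ ∞ ξ
  mem : ∀ x, ξ x ∈ orbitTangent U (γ x)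
  lim : Tendsto ξ atBot (𝓝 0)
  schwartz : ∃ φ : 𝓢(ℝ, E), ∀ x, φ x = deriv ξ x

variable {U} in
/-- `g` is the normalized frame of `γ`, and `u = g⁻¹ g_x` is the development of `γ`. -/
structure IsDevelopment (a : E) (γ : ℝ → E) (g : ℝ → U) (u : 𝓢(ℝ, E)) : Prop where
  smooth : ContMDiff 𝓘(ℝ, ℝ) 𝓘(ℝ, E) ∞ g
  lim : Tendsto g atBot (𝓝 1)
  curve : ∀ x, γ x = Ad (g x) a
  logDeriv : ∀ x, u x = leftLogDeriv g x
  mem : ∀ x, u x ∈ (isotropy U a)ᗮ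

/-- The normalized frame `g` of `γ` (junk value `1` if there is none). -/
def frame (a : E) (γ : ℝ → E) : ℝ → U :=
  open Classical in
  if h : ∃ p : (ℝ → U) × 𝓢(ℝ, E), IsDevelopment a γ p.1 p.2 then h.choose.1 else fun _ => 1

/-- The development map `Φ(γ) = g⁻¹ g_x`, with values in the Schwartz space (junk value `0` if `γ`
has no normalized frame). -/
def Φ (a : E) (γ : ℝ → E) : 𝓢(ℝ, E) :=
  open Classical in
  if h : ∃ p : (ℝ → U) × 𝓢(ℝ, E), IsDevelopment a γ p.1 p.2 then h.choose.2 else 0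

/-- `dΦ_γ(X) = w`: there is a family `Γ_s` in `C_a(ℝ, M_a)` with `Γ_0 = γ` and `∂_s Γ_s = X` at
`s = 0`, along which `Φ` has the derivative `w` at `s = 0`, in the topology of the Schwartz space. -/
def HasDevDeriv (a : E) (γ X : ℝ → E) (w : 𝓢(ℝ, E)) : Prop :=
  IsTangentField U γ X ∧
  ∃ Γ : ℝ → ℝ → E, Γ 0 = γ ∧ (∀ s, IsCurve U a (Γ s)) ∧
    (∀ x, HasDerivAt (fun s => Γ s x) (X x) 0) ∧
    Tendsto (fun s : ℝ => s⁻¹ • (Φ U a (Γ s) - Φ U a γ)) (𝓝[≠] 0) (𝓝 w)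

/-! ### The Poisson operator `Λ = Φ^*(J₃)` -/

/-- `w` is a covector along `Φ(γ)`: a smooth map into `𝒰_a^⊥` which, with all its derivatives,
decays rapidly as `x → -∞`.  On this space `J_a` and `P_u` are defined and invertible. -/
structure IsCovector (a : E) (w : ℝ → E) : Prop where
  smooth : ContDiff ℝ ∞ w
  mem : ∀ x, w x ∈ (isotropy U a)ᗮ
  decay : ∀ k n : ℕ, ∃ C : ℝ, ∀ x ≤ 0, |x| ^ k * ‖iteratedDeriv n w x‖ ≤ C

/-- `(dΦ_γ)^* w = ξ`, for the `L²` adjoint of `dΦ_γ`.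

The first clause is the duality `(w, dΦ_γ(η)) = (ξ, η)` for the `L²` inner products, against all
tangent vectors `η` at `γ` that come from a compactly supported variation `Y = g⁻¹ δg` of the
frame `g` of `γ` (then `η` and `dΦ_γ(η) = Y_x + [u, Y]` have compact support as well).  It
determines `ξ` up to the constant of integration in the antiderivative that occurs in `dΦ_γ`.  The
second clause fixes this constant by the convention `∂⁻¹ = ∫_{-∞}^x`, `(∂⁻¹)^* = -∂⁻¹`, under which
`P_u` and `J_a` are skew-adjoint: it reads `w = P_u⁻¹ J_a (g⁻¹ ξ g)`. -/
def HasAdjoint (a : E) (γ w ξ : ℝ → E) : Prop :=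
  (∀ (η Y : ℝ → E) (v : 𝓢(ℝ, E)), HasDevDeriv U a γ η v →
    ContDiff ℝ ∞ Y → HasCompactSupport Y →
    (∀ x, η x = Ad (frame U a γ x) (J U a (Y x))) →
    (∀ x, v x = deriv Y x + br U (Φ U a γ x) (Y x)) →
    ∫ x, ⟪w x, v x⟫ = ∫ x, ⟪ξ x, η x⟫) ∧
  ∀ x, ξ x = Ad (frame U a γ x) (JInv U a (P U a (Φ U a γ) w x))

/-- `X = Λ_γ(ξ)` for the induced Poisson operator
`Λ_γ = Φ^*(J₃)_γ = dΦ_γ⁻¹ ∘ (J₃)_{Φ(γ)} ∘ dΦ_γ ∘ B_γ⁻¹`, where `B_γ = (dΦ_γ)^* dΦ_γ` relates the `L²`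
metrics: `X` is the vector with `dΦ_γ(X) = J₃(w)` for the covector `w` with `(dΦ_γ)^* w = ξ`. -/
def IsLambda (a : E) (γ ξ X : ℝ → E) : Prop :=
  ∃ w : ℝ → E, IsCovector U a w ∧ HasAdjoint U a γ w ξ ∧
    ∃ v : 𝓢(ℝ, E), (∀ x, v x = J₃ U a (Φ U a γ) w x) ∧ HasDevDeriv U a γ X v

/-! ### Hamiltonian flows of functionals `∫ f(γ(x)) dx` -/

/-- A smooth variation of `γ` through curves in `M_a` that agree with `γ` outside a compact set. -/
structure IsVariation (a : E) (γ : ℝ → E) (Γ : ℝ → ℝ → E) : Prop where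
  smooth : ContDiff ℝ ∞ (fun p : ℝ × ℝ => Γ p.1 p.2)
  zero : Γ 0 = γ
  mem : ∀ s x, Γ s x ∈ orbit U a
  deriv_mem : ∀ x, deriv (fun s => Γ s x) 0 ∈ orbitTangent U (γ x)
  support : ∃ R : ℝ, ∀ s x, R ≤ |x| → Γ s x = γ x

/-- `ξ = ∇H(γ)` is the `L²` gradient at `γ` of the functional `H(γ) = ∫ f(γ(x)) dx`.  The integral
itself need not converge, but along a compactly supported variation the change
`∫ (f(Γ_s(x)) - f(γ(x))) dx` of `H` does, and its derivative at `s = 0` is `∫ ⟨ξ, ∂_s Γ⟩ dx`. -/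
def IsGradient (a : E) (f : E → ℝ) (γ ξ : ℝ → E) : Prop :=
  IsTangentField U γ ξ ∧
  ∀ Γ : ℝ → ℝ → E, IsVariation U a γ Γ →
    HasDerivAt (fun s => ∫ x, (f (Γ s x) - f (γ x)))
      (∫ x, ⟪ξ x, deriv (fun s => Γ s x) 0⟫) 0

/-- `X = Λ_γ(∇H(γ))` is the Hamiltonian vector field of `H(γ) = ∫ f(γ(x)) dx` at `γ` with respect
to `Λ`. -/
def IsHamiltonianVector (a : E) (f : E → ℝ) (γ X : ℝ → E) : Prop :=
  ∃ ξ : ℝ → E, IsGradient U a f γ ξ ∧ IsLambda U a γ ξ X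

/-- `Γ` solves `γ_t = Λ_γ(∇H(γ))`, `H(γ) = ∫ f(γ(x)) dx`, for times `t ∈ T`. -/
def IsHamiltonianFlow (a : E) (f : E → ℝ) (T : Set ℝ) (Γ : ℝ → ℝ → E) : Prop :=
  ∀ t ∈ T, ∃ X : ℝ → E, (∀ x, HasDerivAt (fun τ => Γ τ x) (X x) t) ∧
    IsHamiltonianVector U a f (Γ t) X

/-- `Γ` solves the Ferapontov flow `γ_t = (b̂(γ))_x` for times `t ∈ T`. -/
def IsFerapontovFlow (a b : E) (T : Set ℝ) (Γ : ℝ → ℝ → E) : Prop :=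
  ∀ t ∈ T, ∀ x, HasDerivAt (fun τ => Γ τ x) (deriv (fun y => hat U a b (Γ t y)) x) t

end Algebra

end AdjointCurves

end

/-!
# The Ferapontov flow is Hamiltonian for the third Poisson structure

Everything is computed in the moving frame `g` of `γ`, with `u = g⁻¹ g_x` and `A = Ad(g)`.  A vector
`A Y` along `γ` has the derivative `A (Y_x + [u, Y])` (`IsFrame.hasDerivAt_AdL`), so in the frame
differentiation along `γ` is the covariant derivative `∂ + ad u`.  The operator `P_u` is this
covariant derivative with the component in `𝒰_a` solved for: if `W_x + [u, W] = z` with `z` in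
`𝒰_a^⊥` and `W → l` at `-∞`, then `P_u(π₁ W) = z - [u, π₀ l]` (`P_proj₁`).

* Along a variation the gradient of `H_b` pairs with vectors tangent to the orbit only, so it is the
  tangential part of `b`, `∇H_b = A π₁(B)` with `B = A⁻¹ b` (`isGradient_inner`); the
  variations `Ad(k(s ψ(x))) γ(x)`, with curves `k` in `U` and bump functions `ψ`, show that it is
  the only gradient (`eq_of_integral_variation`).
* `B` is covariantly constant with limit `b`, so `P_u(π₁ B) = -[u, b]`.  The covector `w` of `∇H_b`
  satisfies `P_u w = [B, a]`, that is `J_a⁻¹ P_u w = π₁ B` (`exists_covector`); hence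
  `J₃ w = P_u J_a⁻¹ P_u J_a⁻¹ P_u w = P_u Z₁`, where `[Z₁, a] = -[u, b]` (`J₃_eq`).
* `dΦ_γ(X) = v` means that `v` is in `𝒰_a^⊥` and `X = [∫_{-∞}^x A v, γ]` (`HasDevDeriv.eq_br`,
  `hasDevDeriv_of_mem`), by variation of constants in the equation of the frame.  For `v = P_u Z₁`
  the integral is `A (Z₁ + h)` with `h` in `𝒰_a` (`AdL_eq_integral_P`), so
  `X = A [Z₁, a] = -A [u, b] = -(A b)_x = -(b̂(γ))_x` (`br_integral_eq`).

The identity `A b = b̂(γ)` needs `b̂` to be well defined (`hat_AdL`): the isotropy group of a principal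
`a` fixes its normal space `𝒰_a` (`AdL_eq_of_isPrincipal`).

Two facts on Lie groups have to be supplied from the definitions: the derivative of `Ad(g) w` is
`Ad(g) [g⁻¹ g_t, w]` (`HasLogDeriv.hasDerivAt_AdL`), proved in the chart at the identity by comparing
left- and right-invariant vector fields; and the equation `g⁻¹ g_x = u` with rapidly decreasing `u`
is solvable on `ℝ` with `g → 1` at `-∞` (`exists_frame_of_schwartz`), by Picard-Lindelöf in the same
chart.  The frame itself is obtained by inverting `J_γ` on the tangent vector `γ_x` by a polynomial
in `J_γ` (`exists_isDevelopment`).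
-/

set_option linter.unusedSectionVars false

noncomputable section

namespace AdjointCurves

/-! ### The chart of a Lie group at the identity -/

section LieGroup

variable {E U : Type*} [NormedAddCommGroup E] [InnerProductSpace ℝ E] [FiniteDimensional ℝ E]
  [TopologicalSpace U] [ChartedSpace E U] [Group U]

variable (E U) in
/-- The chart of the Lie group `U` at the identity, with values in the Lie algebra `E`. -/
def chartOne : PartialEquiv U E := extChartAt 𝓘(ℝ, E) (1 : U)

variable (E U) in
/-- The coordinates of the identity. -/
abbrev coordOne : E := chartOne E U 1

/-- `HasLogDeriv g v t`: the map `g` into the group is continuous at `t` and `g⁻¹ g_t = v` there,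
the derivative of `s ↦ g(t)⁻¹ g(s)` being computed in the chart at the identity. -/
def HasLogDeriv (g : ℝ → U) (v : E) (t : ℝ) : Prop :=
  ContinuousAt g t ∧ HasDerivAt (fun s => chartOne E U ((g t)⁻¹ * g s)) v t

variable [LieGroup 𝓘(ℝ, E) ∞ U]

lemma chartOne_contMDiffAt {g : U} (hg : g ∈ (chartOne E U).source) :
    ContMDiffAt 𝓘(ℝ, E) 𝓘(ℝ, E) ∞ (chartOne E U) g := by
  have : IsManifold 𝓘(ℝ, E) ∞ U := inferInstance
  exact contMDiffAt_extChartAt' (by simpa [chartOne] using hg)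

lemma chartOne_symm_contMDiffAt {y : E} (hy : y ∈ (chartOne E U).target) :
    ContMDiffAt 𝓘(ℝ, E) 𝓘(ℝ, E) ∞ (chartOne E U).symm y :=
  (contMDiffOn_extChartAt_symm (1 : U)).contMDiffAt
    ((isOpen_extChartAt_target (I := 𝓘(ℝ, E)) (1 : U)).mem_nhds hy)

variable (E U) in
lemma coordOne_mem : coordOne E U ∈ (chartOne E U).target := mem_extChartAt_target (1 : U)

lemma chartOne_target_mem_nhds {y : E} (hy : y ∈ (chartOne E U).target) :
    (chartOne E U).target ∈ 𝓝 y :=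
  (isOpen_extChartAt_target (I := 𝓘(ℝ, E)) (1 : U)).mem_nhds hy

lemma chartOne_source_mem_nhds {g : U} (hg : g ∈ (chartOne E U).source) :
    (chartOne E U).source ∈ 𝓝 g :=
  (isOpen_extChartAt_source (I := 𝓘(ℝ, E)) (1 : U)).mem_nhds hg

variable (E U) in
lemma one_mem_source : (1 : U) ∈ (chartOne E U).source := mem_extChartAt_source (1 : U)

variable (E U) in
lemma chartOne_symm_coordOne : (chartOne E U).symm (coordOne E U) = 1 :=
  extChartAt_to_inv (I := 𝓘(ℝ, E)) (1 : U)

/-- A smooth map into `U` is smooth when written in the chart at the identity. -/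
lemma contDiffAt_chartOne_comp {F : Type*} [NormedAddCommGroup F] [NormedSpace ℝ F] {f : F → U}
    {x : F} (hf : ContMDiffAt 𝓘(ℝ, F) 𝓘(ℝ, E) ∞ f x) (hx : f x ∈ (chartOne E U).source) :
    ContDiffAt ℝ ∞ (fun z => chartOne E U (f z)) x :=
  ((chartOne_contMDiffAt hx).comp x hf).contDiffAt

lemma hasFDerivAt_chartOne_comp {F : Type*} [NormedAddCommGroup F] [NormedSpace ℝ F] {f : F → U}
    {x : F} (hf : MDifferentiableAt 𝓘(ℝ, F) 𝓘(ℝ, E) f x) (hx : f x = 1) :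
    HasFDerivAt (fun z => chartOne E U (f z))
      (show F →L[ℝ] E from mfderiv 𝓘(ℝ, F) 𝓘(ℝ, E) f x) x := by
  have h := hf.hasMFDerivAt.2
  have h2 : writtenInExtChartAt 𝓘(ℝ, F) 𝓘(ℝ, E) x f = fun z => chartOne E U (f z) := by
    ext z
    simp only [writtenInExtChartAt, hx, extChartAt_model_space_eq_id, Function.comp,
      PartialEquiv.refl_symm, PartialEquiv.refl_coe, id, chartOne]
  rw [h2, modelWithCornersSelf_coe, range_id] at h
  exact hasFDerivWithinAt_univ.1 h

lemma hasLogDeriv_leftLogDeriv {g : ℝ → U} {t : ℝ}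
    (hg : MDifferentiableAt 𝓘(ℝ, ℝ) 𝓘(ℝ, E) g t) : HasLogDeriv g (leftLogDeriv g t : E) t := by
  refine ⟨hg.continuousAt, ?_⟩
  have h1 : MDifferentiableAt 𝓘(ℝ, ℝ) 𝓘(ℝ, E) (fun s => (g t)⁻¹ * g s) t :=
    MDifferentiableAt.comp t (g := fun h : U => (g t)⁻¹ * h)
      ((contMDiff_mul_left (I := 𝓘(ℝ, E)) (n := ∞)).mdifferentiableAt (by simp)) hg
  exact (hasFDerivAt_chartOne_comp h1 (by simp)).hasDerivAt

/-- A map into `U` with a logarithmic derivative is differentiable. -/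
lemma HasLogDeriv.mdifferentiableAt {g : ℝ → U} {t : ℝ} {v : E} (h : HasLogDeriv g v t) :
    MDifferentiableAt 𝓘(ℝ, ℝ) 𝓘(ℝ, E) g t := by
  have h1 : MDifferentiableAt 𝓘(ℝ, ℝ) 𝓘(ℝ, E)
      (fun s => (chartOne E U).symm (chartOne E U ((g t)⁻¹ * g s))) t := by
    refine MDifferentiableAt.comp t (g := (chartOne E U).symm) (I' := 𝓘(ℝ, E)) ?_
      h.2.differentiableAt.mdifferentiableAt
    rw [inv_mul_cancel]
    exact (chartOne_symm_contMDiffAt (coordOne_mem E U)).mdifferentiableAt (by simp)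
  have h2 : MDifferentiableAt 𝓘(ℝ, ℝ) 𝓘(ℝ, E)
      (fun s => g t * (chartOne E U).symm (chartOne E U ((g t)⁻¹ * g s))) t :=
    MDifferentiableAt.comp t (g := fun h : U => g t * h)
      ((contMDiff_mul_left (I := 𝓘(ℝ, E)) (n := ∞)).mdifferentiableAt (by simp)) h1
  refine h2.congr_of_eventuallyEq ?_
  have h3 : ∀ᶠ s in 𝓝 t, (g t)⁻¹ * g s ∈ (chartOne E U).source := by
    have h4 : ContinuousAt (fun s => (g t)⁻¹ * g s) t :=
      (contMDiff_mul_left (I := 𝓘(ℝ, E)) (n := ∞)).continuous.continuousAt.comp h.1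
    refine h4 (chartOne_source_mem_nhds ?_)
    simp [one_mem_source]
  filter_upwards [h3] with s hs
  rw [PartialEquiv.left_inv _ hs]
  group

lemma HasLogDeriv.leftLogDeriv_eq {g : ℝ → U} {t : ℝ} {v : E} (h : HasLogDeriv g v t) :
    leftLogDeriv g t = v :=
  (hasLogDeriv_leftLogDeriv h.mdifferentiableAt).2.unique h.2

/-! ### The Adjoint action in the chart at the identity -/

/-- The Adjoint action of `g` as a continuous linear map. -/
def AdL (g : U) : E →L[ℝ] E :=
  mfderiv 𝓘(ℝ, E) 𝓘(ℝ, E) (fun h : U => g * h * g⁻¹) 1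

lemma AdL_apply (g : U) (x : E) : AdL g x = Ad g x := rfl

lemma contMDiff_conj (g : U) : ContMDiff 𝓘(ℝ, E) 𝓘(ℝ, E) ∞ (fun h : U => g * h * g⁻¹) :=
  (contMDiff_mul_right (I := 𝓘(ℝ, E)) (n := ∞) (a := g⁻¹)).comp
    (contMDiff_mul_left (I := 𝓘(ℝ, E)) (n := ∞) (a := g))

lemma hasFDerivAt_conj (g : U) :
    HasFDerivAt (fun z : E => chartOne E U (g * (chartOne E U).symm z * g⁻¹)) (AdL g)
      (coordOne E U) := by
  have hd : MDifferentiableAt 𝓘(ℝ, E) 𝓘(ℝ, E) (fun h : U => g * h * g⁻¹) 1 :=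
    (contMDiff_conj g).mdifferentiableAt (by simp)
  have h := hd.hasMFDerivAt.2
  have h2 : writtenInExtChartAt 𝓘(ℝ, E) 𝓘(ℝ, E) 1 (fun h : U => g * h * g⁻¹) =
      fun z : E => chartOne E U (g * (chartOne E U).symm z * g⁻¹) := by
    ext z
    simp only [writtenInExtChartAt, Function.comp, mul_one, mul_inv_cancel, chartOne]
  rw [h2, modelWithCornersSelf_coe, range_id] at h
  exact hasFDerivWithinAt_univ.1 h

lemma AdL_mul (g h : U) : (AdL (g * h) : E →L[ℝ] E) = (AdL g).comp (AdL h) := by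
  have h1 := hasFDerivAt_conj (E := E) g
  have h2 := hasFDerivAt_conj (E := E) h
  have h3 : coordOne E U = chartOne E U (h * (chartOne E U).symm (coordOne E U) * h⁻¹) := by
    rw [chartOne_symm_coordOne, mul_one, mul_inv_cancel]
  rw [h3] at h1
  have h4 := HasFDerivAt.comp (coordOne E U) h1 h2
  refine (hasFDerivAt_conj (E := E) (g * h)).unique (h4.congr_of_eventuallyEq ?_)
  have h5 : ContinuousAt (fun z : E => h * (chartOne E U).symm z * h⁻¹) (coordOne E U) :=
    (contMDiff_conj (E := E) h).continuous.continuousAt.comp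
      (chartOne_symm_contMDiffAt (coordOne_mem E U)).continuousAt
  have h5' : h * (chartOne E U).symm (coordOne E U) * h⁻¹ ∈ (chartOne E U).source := by
    rw [chartOne_symm_coordOne, mul_one, mul_inv_cancel]; exact one_mem_source E U
  have h6 := h5 (chartOne_source_mem_nhds h5')
  filter_upwards [h6] with z hz
  have hz' : h * (chartOne E U).symm z * h⁻¹ ∈ (chartOne E U).source := hz
  simp only [Function.comp]
  rw [PartialEquiv.left_inv _ hz']
  simp [mul_assoc]

lemma AdL_one : (AdL (1 : U) : E →L[ℝ] E) = ContinuousLinearMap.id ℝ E := by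
  refine (hasFDerivAt_conj (E := E) (1 : U)).unique
    ((hasFDerivAt_id _).congr_of_eventuallyEq ?_)
  filter_upwards [chartOne_target_mem_nhds (coordOne_mem E U)] with z hz
  simp [PartialEquiv.right_inv _ hz]

lemma AdL_inv_apply (g : U) (x : E) : AdL g⁻¹ (AdL g x) = x := by
  rw [← ContinuousLinearMap.comp_apply, ← AdL_mul, inv_mul_cancel, AdL_one]; rfl

lemma AdL_apply_inv (g : U) (x : E) : AdL g (AdL g⁻¹ x) = x := by
  rw [← ContinuousLinearMap.comp_apply, ← AdL_mul, mul_inv_cancel, AdL_one]; rfl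

end LieGroup

/-! ### Logarithmic derivatives of curves in the group -/

section LocalGroup

variable {E U : Type*} [NormedAddCommGroup E] [InnerProductSpace ℝ E] [FiniteDimensional ℝ E]
  [TopologicalSpace U] [ChartedSpace E U] [Group U]

variable (U) in
/-- The group law in the chart at the identity. -/
def localMul (y z : E) : E :=
  chartOne E U ((chartOne E U).symm y * (chartOne E U).symm z)

variable (U) in
/-- The left-invariant vector fields in the chart at the identity: `leftField U y v` is the value
at `y` of the left-invariant field with value `v` at the identity. -/
def leftField (y : E) : E →L[ℝ] E := fderiv ℝ (localMul U y) (coordOne E U)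

variable [LieGroup 𝓘(ℝ, E) ∞ U]

lemma localMul_coordOne {y : E} (hy : y ∈ (chartOne E U).target) :
    localMul U y (coordOne E U) = y := by
  rw [localMul, chartOne_symm_coordOne, mul_one, PartialEquiv.right_inv _ hy]

lemma coordOne_localMul {y : E} (hy : y ∈ (chartOne E U).target) :
    localMul U (coordOne E U) y = y := by
  rw [localMul, chartOne_symm_coordOne, one_mul, PartialEquiv.right_inv _ hy]

lemma contDiffAt_localMul {y z : E} (hy : y ∈ (chartOne E U).target)
    (hz : z ∈ (chartOne E U).target)
    (hyz : (chartOne E U).symm y * (chartOne E U).symm z ∈ (chartOne E U).source) :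
    ContDiffAt ℝ ∞ (fun p : E × E => localMul U p.1 p.2) (y, z) := by
  refine contDiffAt_chartOne_comp (f := fun p : E × E =>
    (chartOne E U).symm p.1 * (chartOne E U).symm p.2) ?_ hyz
  have h1 : ContMDiffAt 𝓘(ℝ, E × E) 𝓘(ℝ, E) ∞ (fun p : E × E => (chartOne E U).symm p.1) (y, z) :=
    (chartOne_symm_contMDiffAt hy).comp (y, z) contDiff_fst.contMDiff.contMDiffAt
  have h2 : ContMDiffAt 𝓘(ℝ, E × E) 𝓘(ℝ, E) ∞ (fun p : E × E => (chartOne E U).symm p.2) (y, z) :=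
    (chartOne_symm_contMDiffAt hz).comp (y, z) contDiff_snd.contMDiff.contMDiffAt
  exact h1.mul h2

lemma contDiffAt_localMul_left {y : E} (hy : y ∈ (chartOne E U).target) :
    ContDiffAt ℝ ∞ (fun p : E × E => localMul U p.1 p.2) (y, coordOne E U) :=
  contDiffAt_localMul hy (coordOne_mem E U) (by
    rw [chartOne_symm_coordOne, mul_one]; exact PartialEquiv.map_target _ hy)

lemma contDiffAt_leftField {y : E} (hy : y ∈ (chartOne E U).target) :
    ContDiffAt ℝ ∞ (leftField U : E → E →L[ℝ] E) y :=
  ContDiffAt.fderiv (f := localMul U) (g := fun _ => coordOne E U)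
    (contDiffAt_localMul_left hy) contDiffAt_const (by simp)

lemma hasFDerivAt_localMul_right {y : E} (hy : y ∈ (chartOne E U).target) :
    HasFDerivAt (localMul U y) (leftField U y) (coordOne E U) := by
  have h : ContDiffAt ℝ ∞ (fun z : E => localMul U y z) (coordOne E U) :=
    (contDiffAt_localMul_left hy).comp (coordOne E U) (f := fun z : E => (y, z))
      (contDiffAt_const.prodMk contDiffAt_id)
  exact (h.differentiableAt (by simp)).hasFDerivAt

lemma leftField_coordOne : leftField U (coordOne E U) = ContinuousLinearMap.id ℝ E := by
  refine (hasFDerivAt_localMul_right (coordOne_mem E U)).unique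
    ((hasFDerivAt_id _).congr_of_eventuallyEq ?_)
  filter_upwards [chartOne_target_mem_nhds (coordOne_mem E U)] with z hz
  exact coordOne_localMul hz

lemma hasFDerivAt_localMul :
    HasFDerivAt (fun p : E × E => localMul U p.1 p.2)
      (ContinuousLinearMap.fst ℝ E E + ContinuousLinearMap.snd ℝ E E)
      (coordOne E U, coordOne E U) := by
  have h := ((contDiffAt_localMul_left (coordOne_mem E U)).differentiableAt
    (by simp)).hasFDerivAt
  set D := fderiv ℝ (fun p : E × E => localMul U p.1 p.2) (coordOne E U, coordOne E U) with hD
  have h1 : D.comp (ContinuousLinearMap.inl ℝ E E) = ContinuousLinearMap.id ℝ E := by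
    have h2 := HasFDerivAt.comp (f := fun e : E => (e, coordOne E U)) (coordOne E U) h
      (hasFDerivAt_prodMk_left (𝕜 := ℝ) (coordOne E U) (coordOne E U))
    refine h2.unique ((hasFDerivAt_id _).congr_of_eventuallyEq ?_)
    filter_upwards [chartOne_target_mem_nhds (coordOne_mem E U)] with z hz
    exact localMul_coordOne hz
  have h2 : D.comp (ContinuousLinearMap.inr ℝ E E) = ContinuousLinearMap.id ℝ E := by
    have h2 := HasFDerivAt.comp (f := fun e : E => (coordOne E U, e)) (coordOne E U) h
      (hasFDerivAt_prodMk_right (𝕜 := ℝ) (coordOne E U) (coordOne E U))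
    refine h2.unique ((hasFDerivAt_id _).congr_of_eventuallyEq ?_)
    filter_upwards [chartOne_target_mem_nhds (coordOne_mem E U)] with z hz
    exact coordOne_localMul hz
  have h3 : D = ContinuousLinearMap.fst ℝ E E + ContinuousLinearMap.snd ℝ E E := by
    ext p
    · simpa using DFunLike.congr_fun h1 p
    · simpa using DFunLike.congr_fun h2 p
  rwa [h3] at h

/-- In the chart at the identity, `g⁻¹ g_t = v` is the differential equation of the left-invariant
vector fields. -/
lemma HasLogDeriv.hasDerivAt_chartOne {g : ℝ → U} {t : ℝ} {v : E} (h : HasLogDeriv g v t)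
    (ht : g t ∈ (chartOne E U).source) :
    HasDerivAt (fun s => chartOne E U (g s)) (leftField U (chartOne E U (g t)) v) t := by
  have h1 := hasFDerivAt_localMul_right ((chartOne E U).map_source ht)
  have h0 : chartOne E U ((g t)⁻¹ * g t) = coordOne E U := by rw [inv_mul_cancel]
  rw [← h0] at h1
  refine (h1.comp_hasDerivAt t h.2).congr_of_eventuallyEq ?_
  have h3 : ∀ᶠ s in 𝓝 t, (g t)⁻¹ * g s ∈ (chartOne E U).source := by
    have h4 : ContinuousAt (fun s => (g t)⁻¹ * g s) t :=
      (contMDiff_mul_left (I := 𝓘(ℝ, E)) (n := ∞)).continuous.continuousAt.comp h.1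
    refine h4 (chartOne_source_mem_nhds ?_)
    simp [one_mem_source]
  filter_upwards [h3] with s hs
  simp only [Function.comp, localMul]
  rw [PartialEquiv.left_inv _ hs, PartialEquiv.left_inv _ ht]
  group

lemma hasLogDeriv_chartOne_symm {y : ℝ → E} {t : ℝ} {v : E} (ht : y t ∈ (chartOne E U).target)
    (h : HasDerivAt y (leftField U (y t) v) t) :
    HasLogDeriv (fun s => (chartOne E U).symm (y s)) v t := by
  have hc : ContinuousAt (fun s => (chartOne E U).symm (y s)) t :=
    (chartOne_symm_contMDiffAt ht).continuousAt.comp h.continuousAt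
  refine ⟨hc, ?_⟩
  set k : U := (chartOne E U).symm (y t) with hk
  -- the left translation by the inverse of the value at `t`, in the chart
  have hn : DifferentiableAt ℝ (fun z : E => chartOne E U (k⁻¹ * (chartOne E U).symm z)) (y t) := by
    refine (contDiffAt_chartOne_comp (E := E) (f := fun z : E => k⁻¹ * (chartOne E U).symm z)
      ?_ ?_).differentiableAt (by simp)
    · exact (contMDiff_mul_left (I := 𝓘(ℝ, E)) (n := ∞)).contMDiffAt.comp (y t)
        (chartOne_symm_contMDiffAt ht)
    · simp [hk, one_mem_source]
  have h1 := hasFDerivAt_localMul_right ht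
  have hn' := hn.hasFDerivAt
  set D := fderiv ℝ (fun z : E => chartOne E U (k⁻¹ * (chartOne E U).symm z)) (y t)
  have hn2 := hn'
  rw [← localMul_coordOne ht] at hn2
  have h2 : D.comp (leftField U (y t)) = ContinuousLinearMap.id ℝ E := by
    refine (HasFDerivAt.comp (coordOne E U) hn2 h1).unique
      ((hasFDerivAt_id _).congr_of_eventuallyEq ?_)
    have h5 : ContinuousAt (fun z : E => k * (chartOne E U).symm z) (coordOne E U) :=
      (contMDiff_mul_left (I := 𝓘(ℝ, E)) (n := ∞)).continuous.continuousAt.comp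
        (chartOne_symm_contMDiffAt (coordOne_mem E U)).continuousAt
    have h5' : k * (chartOne E U).symm (coordOne E U) ∈ (chartOne E U).source := by
      rw [chartOne_symm_coordOne, mul_one]
      exact PartialEquiv.map_target _ ht
    filter_upwards [h5 (chartOne_source_mem_nhds h5'),
      chartOne_target_mem_nhds (coordOne_mem E U)] with z hz hz2
    have hz' : k * (chartOne E U).symm z ∈ (chartOne E U).source := hz
    simp only [Function.comp, localMul, id]
    rw [← hk, PartialEquiv.left_inv _ hz', inv_mul_cancel_left, PartialEquiv.right_inv _ hz2]
  have h3 := hn'.comp_hasDerivAt t h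
  have h4 : D (leftField U (y t) v) = v := DFunLike.congr_fun h2 v
  rw [h4] at h3
  exact h3

lemma HasLogDeriv.const (c : U) (t : ℝ) : HasLogDeriv (fun _ => c) (0 : E) t :=
  ⟨continuousAt_const, hasDerivAt_const _ _⟩

/-- The logarithmic derivative of a product. -/
lemma HasLogDeriv.mul {g k : ℝ → U} {t : ℝ} {v w : E} (hg : HasLogDeriv g v t)
    (hk : HasLogDeriv k w t) : HasLogDeriv (fun s => k s * g s) (v + AdL (g t)⁻¹ w) t := by
  have hcont : ∀ f : ℝ → U, ContinuousAt f t → ContinuousAt (fun s => (f t)⁻¹ * f s) t :=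
    fun f hf => (contMDiff_mul_left (I := 𝓘(ℝ, E)) (n := ∞)).continuous.continuousAt.comp hf
  have : IsTopologicalGroup U := topologicalGroup_of_lieGroup 𝓘(ℝ, E) ∞
  refine ⟨hk.1.mul hg.1, ?_⟩
  have hK : ∀ᶠ s in 𝓝 t, (k t)⁻¹ * k s ∈ (chartOne E U).source :=
    hcont k hk.1 (chartOne_source_mem_nhds (by simp [one_mem_source]))
  have hH : ∀ᶠ s in 𝓝 t, (g t)⁻¹ * g s ∈ (chartOne E U).source :=
    hcont g hg.1 (chartOne_source_mem_nhds (by simp [one_mem_source]))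
  have hC : ∀ᶠ s in 𝓝 t, (g t)⁻¹ * ((k t)⁻¹ * k s) * g t ∈ (chartOne E U).source := by
    have h1 : ContinuousAt (fun s => (g t)⁻¹ * ((k t)⁻¹ * k s) * g t) t :=
      (continuousAt_const.mul (hcont k hk.1)).mul continuousAt_const
    exact h1 (chartOne_source_mem_nhds (by simp [one_mem_source]))
  have h1 := hasFDerivAt_conj (E := E) (g t)⁻¹
  have e1 : coordOne E U = chartOne E U ((k t)⁻¹ * k t) := by rw [inv_mul_cancel]
  have e2 : coordOne E U = chartOne E U ((g t)⁻¹ * g t) := by rw [inv_mul_cancel]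
  rw [e1] at h1
  have h2 := h1.comp_hasDerivAt t hk.2
  have h3 := h2.prodMk hg.2
  have h4 := hasFDerivAt_localMul (E := E) (U := U)
  have e3 : (coordOne E U, coordOne E U) = (((fun z : E => chartOne E U ((g t)⁻¹ *
      (chartOne E U).symm z * (g t)⁻¹⁻¹)) ∘ fun s => chartOne E U ((k t)⁻¹ * k s)) t,
      chartOne E U ((g t)⁻¹ * g t)) := by
    refine Prod.ext ?_ e2
    simp only [Function.comp]
    rw [← e1, chartOne_symm_coordOne]
    simp
  rw [e3] at h4
  have h5 := h4.comp_hasDerivAt t h3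
  have e4 : (ContinuousLinearMap.fst ℝ E E + ContinuousLinearMap.snd ℝ E E)
      ((AdL (g t)⁻¹) w, v) = v + AdL (g t)⁻¹ w := by simp [add_comm]
  rw [e4] at h5
  refine h5.congr_of_eventuallyEq ?_
  filter_upwards [hK, hH, hC] with s hs1 hs2 hs3
  simp only [Function.comp, localMul]
  rw [PartialEquiv.left_inv _ hs1, inv_inv, PartialEquiv.left_inv _ hs3,
    PartialEquiv.left_inv _ hs2]
  congr 1
  group

lemma HasLogDeriv.inv {g : ℝ → U} {t : ℝ} {v : E} (hg : HasLogDeriv g v t) :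
    HasLogDeriv (fun s => (g s)⁻¹) (-AdL (g t) v) t := by
  have hd : MDifferentiableAt 𝓘(ℝ, ℝ) 𝓘(ℝ, E) (fun s => (g s)⁻¹) t :=
    MDifferentiableAt.comp t (g := fun h : U => h⁻¹)
      ((contMDiff_inv 𝓘(ℝ, E) ∞).mdifferentiableAt (by simp)) hg.mdifferentiableAt
  have h1 := hasLogDeriv_leftLogDeriv hd
  have h2 := hg.mul h1
  have h3 : (fun s => (g s)⁻¹ * g s) = fun _ => 1 := by ext s; simp
  rw [h3] at h2
  have h4 : v + AdL (g t)⁻¹ (leftLogDeriv (fun s => (g s)⁻¹) t) = 0 :=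
    h2.2.unique (HasLogDeriv.const 1 t).2
  have h5 : leftLogDeriv (fun s => (g s)⁻¹) t = -AdL (g t) v := by
    have h6 := congrArg (AdL (g t)) h4
    rw [map_add, AdL_apply_inv, map_zero] at h6
    exact eq_neg_of_add_eq_zero_right h6
  rwa [h5] at h1

lemma HasLogDeriv.comp {g : ℝ → U} {τ : ℝ → ℝ} {t c : ℝ} {v : E}
    (hg : HasLogDeriv g v (τ t)) (hτ : HasDerivAt τ c t) :
    HasLogDeriv (fun s => g (τ s)) (c • v) t :=
  ⟨hg.1.comp hτ.continuousAt, hg.2.scomp t hτ⟩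

end LocalGroup

/-! ### The differential of the Adjoint action -/

section AdjointDerivative

variable {E U : Type*} [NormedAddCommGroup E] [InnerProductSpace ℝ E] [FiniteDimensional ℝ E]
  [TopologicalSpace U] [ChartedSpace E U] [Group U] [LieGroup 𝓘(ℝ, E) ∞ U]

lemma contDiffAt_AdL_chart {y : E} (hy : y ∈ (chartOne E U).target) :
    ContDiffAt ℝ ∞ (fun y : E => (AdL ((chartOne E U).symm y) : E →L[ℝ] E)) y := by
  have h1 : (fun y : E => (AdL ((chartOne E U).symm y) : E →L[ℝ] E)) = fun y =>
      fderiv ℝ (fun z : E => chartOne E U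
        ((chartOne E U).symm y * (chartOne E U).symm z * ((chartOne E U).symm y)⁻¹))
        (coordOne E U) := by
    ext1 y
    exact (hasFDerivAt_conj _).fderiv.symm
  rw [h1]
  refine ContDiffAt.fderiv (n := ∞) (g := fun _ => coordOne E U) (f := fun y z : E => chartOne E U
    ((chartOne E U).symm y * (chartOne E U).symm z * ((chartOne E U).symm y)⁻¹))
    ?_ contDiffAt_const (by simp)
  refine contDiffAt_chartOne_comp (f := fun p : E × E => (chartOne E U).symm p.1 *
    (chartOne E U).symm p.2 * ((chartOne E U).symm p.1)⁻¹) ?_ ?_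
  · have h1 : ContMDiffAt 𝓘(ℝ, E × E) 𝓘(ℝ, E) ∞ (fun p : E × E => (chartOne E U).symm p.1)
        (y, coordOne E U) :=
      (chartOne_symm_contMDiffAt hy).comp (y, _) contDiff_fst.contMDiff.contMDiffAt
    have h2 : ContMDiffAt 𝓘(ℝ, E × E) 𝓘(ℝ, E) ∞ (fun p : E × E => (chartOne E U).symm p.2)
        (y, coordOne E U) :=
      (chartOne_symm_contMDiffAt (coordOne_mem E U)).comp (y, coordOne E U)
        contDiff_snd.contMDiff.contMDiffAt
    exact (h1.mul h2).mul h1.inv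
  · simp only [chartOne_symm_coordOne, mul_one, mul_inv_cancel]
    exact one_mem_source E U

variable (U) in
/-- The right-invariant vector fields in the chart at the identity. -/
def rightField (y : E) : E →L[ℝ] E := fderiv ℝ (fun z => localMul U z y) (coordOne E U)

lemma contDiffAt_localMul_right {y : E} (hy : y ∈ (chartOne E U).target) :
    ContDiffAt ℝ ∞ (fun p : E × E => localMul U p.1 p.2) (coordOne E U, y) :=
  contDiffAt_localMul (coordOne_mem E U) hy (by
    rw [chartOne_symm_coordOne, one_mul]; exact PartialEquiv.map_target _ hy)

lemma leftField_eq {y : E} (hy : y ∈ (chartOne E U).target) (v : E) :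
    leftField U y v = fderiv ℝ (fun p : E × E => localMul U p.1 p.2) (y, coordOne E U) (0, v) := by
  have h := ((contDiffAt_localMul_left hy).differentiableAt (by simp)).hasFDerivAt
  have h2 := HasFDerivAt.comp (f := fun e : E => (y, e)) (coordOne E U) h
    (hasFDerivAt_prodMk_right (𝕜 := ℝ) y (coordOne E U))
  exact DFunLike.congr_fun h2.fderiv v

lemma hasFDerivAt_rightField {y : E} (hy : y ∈ (chartOne E U).target) :
    HasFDerivAt (fun z => localMul U z y) (rightField U y) (coordOne E U) := by
  have h := ((contDiffAt_localMul_right hy).differentiableAt (by simp)).hasFDerivAt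
  have h2 := HasFDerivAt.comp (f := fun e : E => (e, y)) (coordOne E U) h
    (hasFDerivAt_prodMk_left (𝕜 := ℝ) (coordOne E U) y)
  exact h2.differentiableAt.hasFDerivAt

lemma rightField_eq {y : E} (hy : y ∈ (chartOne E U).target) (v : E) :
    rightField U y v = fderiv ℝ (fun p : E × E => localMul U p.1 p.2) (coordOne E U, y) (v, 0) := by
  have h := ((contDiffAt_localMul_right hy).differentiableAt (by simp)).hasFDerivAt
  have h2 := HasFDerivAt.comp (f := fun e : E => (e, y)) (coordOne E U) h
    (hasFDerivAt_prodMk_left (𝕜 := ℝ) (coordOne E U) y)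
  exact DFunLike.congr_fun h2.fderiv v

lemma rightField_coordOne : rightField U (coordOne E U) = ContinuousLinearMap.id ℝ E := by
  refine (hasFDerivAt_rightField (coordOne_mem E U)).unique
    ((hasFDerivAt_id _).congr_of_eventuallyEq ?_)
  filter_upwards [chartOne_target_mem_nhds (coordOne_mem E U)] with z hz
  exact localMul_coordOne hz

/-- Right translation carries `Ad(g) v` to the left translate of `v`. -/
lemma rightField_comp_AdL {y : E} (hy : y ∈ (chartOne E U).target) :
    (rightField U y).comp (AdL ((chartOne E U).symm y)) = leftField U y := by
  set k : U := (chartOne E U).symm y with hk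
  have h1 := hasFDerivAt_rightField hy
  have h2 := hasFDerivAt_conj (E := E) k
  have e : coordOne E U = chartOne E U (k * (chartOne E U).symm (coordOne E U) * k⁻¹) := by
    rw [chartOne_symm_coordOne, mul_one, mul_inv_cancel]
  rw [e] at h1
  refine (HasFDerivAt.comp (coordOne E U) h1 h2).unique
    ((hasFDerivAt_localMul_right hy).congr_of_eventuallyEq ?_)
  have h5 : ContinuousAt (fun z : E => k * (chartOne E U).symm z * k⁻¹) (coordOne E U) :=
    (contMDiff_conj (E := E) k).continuous.continuousAt.comp
      (chartOne_symm_contMDiffAt (coordOne_mem E U)).continuousAt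
  have h5' : k * (chartOne E U).symm (coordOne E U) * k⁻¹ ∈ (chartOne E U).source := by
    rw [chartOne_symm_coordOne, mul_one, mul_inv_cancel]; exact one_mem_source E U
  filter_upwards [h5 (chartOne_source_mem_nhds h5')] with z hz
  have hz' : k * (chartOne E U).symm z * k⁻¹ ∈ (chartOne E U).source := hz
  simp only [Function.comp, localMul]
  rw [PartialEquiv.left_inv _ hz', ← hk]
  congr 1
  group

lemma fderiv_rightField (v w : E) :
    DifferentiableAt ℝ (rightField U : E → E →L[ℝ] E) (coordOne E U) ∧
    fderiv ℝ (rightField U : E → E →L[ℝ] E) (coordOne E U) w v =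
      fderiv ℝ (leftField U : E → E →L[ℝ] E) (coordOne E U) v w := by
  set p : E × E := (coordOne E U, coordOne E U)
  set M := fun p : E × E => localMul U p.1 p.2 with hM
  have hc : ContDiffAt ℝ ∞ M p := contDiffAt_localMul_left (coordOne_mem E U)
  have hD : HasFDerivAt (fderiv ℝ M) (fderiv ℝ (fderiv ℝ M) p) p :=
    ((hc.fderiv_right (m := ∞) (by simp)).differentiableAt (by simp)).hasFDerivAt
  have hsymm : IsSymmSndFDerivAt ℝ M p :=
    hc.isSymmSndFDerivAt (by rw [minSmoothness_of_isRCLikeNormedField]; exact WithTop.coe_le_coe.2 (le_top (a := (2 : ℕ∞))))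
  have hr : ContDiffAt ℝ ∞ (rightField U : E → E →L[ℝ] E) (coordOne E U) := by
    refine ContDiffAt.fderiv (n := ∞) (f := fun y z => localMul U z y)
      (g := fun _ => coordOne E U) ?_ contDiffAt_const (by simp)
    exact hc.comp (coordOne E U, coordOne E U) (f := fun p : E × E => (p.2, p.1))
      (contDiffAt_snd.prodMk contDiffAt_fst)
  have hrd := hr.differentiableAt (by simp)
  have hld := (contDiffAt_leftField (U := U) (coordOne_mem E U)).differentiableAt (by simp)
  refine ⟨hrd, ?_⟩
  have h1 : HasFDerivAt (fun y : E => fderiv ℝ M (y, coordOne E U) (0, w))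
      (((fderiv ℝ (fderiv ℝ M) p).comp (ContinuousLinearMap.inl ℝ E E)).flip (0, w))
      (coordOne E U) := by
    have := HasFDerivAt.comp (g := fderiv ℝ M) (f := fun e : E => (e, coordOne E U)) (coordOne E U) hD
      (hasFDerivAt_prodMk_left (𝕜 := ℝ) (coordOne E U) (coordOne E U))
    simpa using this.clm_apply (hasFDerivAt_const (0, w) _)
  have h2 : HasFDerivAt (fun y : E => fderiv ℝ M (coordOne E U, y) (v, 0))
      (((fderiv ℝ (fderiv ℝ M) p).comp (ContinuousLinearMap.inr ℝ E E)).flip (v, 0))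
      (coordOne E U) := by
    have := HasFDerivAt.comp (g := fderiv ℝ M) (f := fun e : E => (coordOne E U, e)) (coordOne E U) hD
      (hasFDerivAt_prodMk_right (𝕜 := ℝ) (coordOne E U) (coordOne E U))
    simpa using this.clm_apply (hasFDerivAt_const (v, 0) _)
  have h3 : HasFDerivAt (fun y : E => leftField U y w)
      ((fderiv ℝ (leftField U : E → E →L[ℝ] E) (coordOne E U)).flip w) (coordOne E U) := by
    simpa using hld.hasFDerivAt.clm_apply (hasFDerivAt_const w _)
  have h4 : HasFDerivAt (fun y : E => rightField U y v)
      ((fderiv ℝ (rightField U : E → E →L[ℝ] E) (coordOne E U)).flip v) (coordOne E U) := by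
    simpa using hrd.hasFDerivAt.clm_apply (hasFDerivAt_const v _)
  have e1 := h3.unique (h1.congr_of_eventuallyEq (by
    filter_upwards [chartOne_target_mem_nhds (coordOne_mem E U)] with y hy
    exact leftField_eq hy w))
  have e2 := h4.unique (h2.congr_of_eventuallyEq (by
    filter_upwards [chartOne_target_mem_nhds (coordOne_mem E U)] with y hy
    exact rightField_eq hy v))
  have f1 := DFunLike.congr_fun e1 v
  have f2 := DFunLike.congr_fun e2 w
  simp only [ContinuousLinearMap.flip_apply, ContinuousLinearMap.comp_apply,
    ContinuousLinearMap.inl_apply, ContinuousLinearMap.inr_apply] at f1 f2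
  rw [f1, f2]
  exact hsymm _ _

variable (U) in
/-- The left-invariant vector field with value `v` at the identity, pulled back by the inverse of
the chart at the identity. -/
def pullField (v y : E) : E :=
  VectorField.mpullbackWithin 𝓘(ℝ, E) 𝓘(ℝ, E) (chartOne E U).symm
    (mulInvariantVectorField (I := 𝓘(ℝ, E)) (G := U) v) (range 𝓘(ℝ, E)) y

lemma pullField_eq {y : E} (hy : y ∈ (chartOne E U).target) (v : E) :
    pullField U v y = leftField U y v := by
  set k : U := (chartOne E U).symm y with hk
  have hks : k ∈ (chartOne E U).source := PartialEquiv.map_target _ hy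
  have hinv : (mfderivWithin 𝓘(ℝ, E) 𝓘(ℝ, E) (chartOne E U).symm (range 𝓘(ℝ, E)) y).inverse =
      mfderiv 𝓘(ℝ, E) 𝓘(ℝ, E) (chartOne E U) k := by
    refine ContinuousLinearMap.inverse_eq ?_ ?_
    · exact mfderivWithin_extChartAt_symm_comp_mfderiv_extChartAt hy
    · exact mfderiv_extChartAt_comp_mfderivWithin_extChartAt_symm hy
  have hd1 : MDifferentiableAt 𝓘(ℝ, E) 𝓘(ℝ, E) (fun x : U => k * x) 1 :=
    (contMDiff_mul_left (I := 𝓘(ℝ, E)) (n := ∞)).mdifferentiableAt (by simp)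
  have hd2 : MDifferentiableAt 𝓘(ℝ, E) 𝓘(ℝ, E) (chartOne E U) (k * 1) := by
    rw [mul_one]
    exact (chartOne_contMDiffAt hks).mdifferentiableAt (by simp)
  have hcomp := mfderiv_comp (I' := 𝓘(ℝ, E)) (1 : U) hd2 hd1
  have h3 : HasFDerivAt (localMul U y)
      (show E →L[ℝ] E from mfderiv 𝓘(ℝ, E) 𝓘(ℝ, E) ((chartOne E U) ∘ fun x : U => k * x) 1)
      (coordOne E U) := by
    have h := (hd2.comp (1 : U) hd1).hasMFDerivAt.2
    have h2 : writtenInExtChartAt 𝓘(ℝ, E) 𝓘(ℝ, E) (1 : U)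
        ((chartOne E U) ∘ fun x : U => k * x) = localMul U y := by
      ext z
      simp only [writtenInExtChartAt, Function.comp, extChartAt_model_space_eq_id,
        PartialEquiv.refl_coe, id, localMul, ← hk]
      rfl
    rw [h2, modelWithCornersSelf_coe, range_id] at h
    exact hasFDerivWithinAt_univ.1 h
  have h4 := h3.unique (hasFDerivAt_localMul_right hy)
  rw [← DFunLike.congr_fun h4 v]
  have h5 : (mfderiv 𝓘(ℝ, E) 𝓘(ℝ, E) ((chartOne E U) ∘ fun x : U => k * x) 1 v : E) =
      (mfderiv 𝓘(ℝ, E) 𝓘(ℝ, E) (chartOne E U) (k * 1)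
        (mfderiv 𝓘(ℝ, E) 𝓘(ℝ, E) (fun x : U => k * x) 1 v) : E) :=
    DFunLike.congr_fun hcomp v
  refine Eq.trans ?_ h5.symm
  rw [mul_one]
  exact DFunLike.congr_fun hinv _

lemma br_eq_lieBracket (v w : E) :
    br U v w = VectorField.lieBracket ℝ (pullField U v) (pullField U w) (coordOne E U) := by
  have h1 : br U v w = VectorField.mlieBracketWithin 𝓘(ℝ, E)
      (mulInvariantVectorField (I := 𝓘(ℝ, E)) (G := U) v)
      (mulInvariantVectorField (I := 𝓘(ℝ, E)) (G := U) w) univ (1 : U) := rfl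
  have h2 : ∀ z : E, ((mfderiv 𝓘(ℝ, E) 𝓘(ℝ, E) (extChartAt 𝓘(ℝ, E) (1 : U)) 1).inverse z : E) =
      z := by
    intro z
    rw [mfderiv_extChartAt_self]
    exact DFunLike.congr_fun (ContinuousLinearMap.inverse_id (R := ℝ) (M := E)) z
  rw [h1, VectorField.mlieBracketWithin_apply]
  refine (h2 _).trans ?_
  have hs : ((extChartAt 𝓘(ℝ, E) (1 : U)).symm ⁻¹' univ ∩ range 𝓘(ℝ, E) : Set E) = univ := by
    simp
  rw [← VectorField.lieBracketWithin_univ, ← hs]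
  rfl

lemma br_eq_fderiv (v w : E) :
    br U v w = fderiv ℝ (leftField U : E → E →L[ℝ] E) (coordOne E U) v w -
      fderiv ℝ (leftField U : E → E →L[ℝ] E) (coordOne E U) w v := by
  have hld := (contDiffAt_leftField (U := U) (coordOne_mem E U)).differentiableAt (by simp)
  have hV : ∀ v : E, HasFDerivAt (pullField U v)
      ((fderiv ℝ (leftField U : E → E →L[ℝ] E) (coordOne E U)).flip v) (coordOne E U) := by
    intro v
    have h3 : HasFDerivAt (fun y : E => leftField U y v)
        ((fderiv ℝ (leftField U : E → E →L[ℝ] E) (coordOne E U)).flip v) (coordOne E U) := by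
      simpa using hld.hasFDerivAt.clm_apply (hasFDerivAt_const v _)
    refine h3.congr_of_eventuallyEq ?_
    filter_upwards [chartOne_target_mem_nhds (coordOne_mem E U)] with y hy
    exact pullField_eq hy v
  have hV0 : ∀ v : E, pullField U v (coordOne E U) = v := by
    intro v
    rw [pullField_eq (coordOne_mem E U), leftField_coordOne]
    rfl
  rw [br_eq_lieBracket, VectorField.lieBracket_eq]
  simp only [(hV w).fderiv, (hV v).fderiv, hV0, ContinuousLinearMap.flip_apply]

/-- The differential of `Ad` at the identity is `ad`. -/
lemma hasFDerivAt_AdL_chart (w : E) :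
    ∃ D : E →L[ℝ] E, (∀ v, D v = br U v w) ∧
      HasFDerivAt (fun y : E => AdL ((chartOne E U).symm y) w) D (coordOne E U) := by
  have hC := (contDiffAt_AdL_chart (U := U) (coordOne_mem E U)).differentiableAt (by simp)
  have hC' := hC.hasFDerivAt.clm_apply (hasFDerivAt_const w (coordOne E U))
  refine ⟨_, fun v => ?_, hC'⟩
  have hR := (fderiv_rightField (U := U) w v).1.hasFDerivAt
  have h1 := hR.clm_apply hC'
  have hld := (contDiffAt_leftField (U := U) (coordOne_mem E U)).differentiableAt (by simp)
  have h2 := hld.hasFDerivAt.clm_apply (hasFDerivAt_const w (coordOne E U))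
  have h3 := h1.unique (h2.congr_of_eventuallyEq (by
    filter_upwards [chartOne_target_mem_nhds (coordOne_mem E U)] with y hy
    exact DFunLike.congr_fun (rightField_comp_AdL hy) w))
  have h4 := DFunLike.congr_fun h3 v
  simp only [chartOne_symm_coordOne, AdL_one, rightField_coordOne, add_apply,
    ContinuousLinearMap.comp_apply, ContinuousLinearMap.flip_apply, ContinuousLinearMap.id_apply,
    zero_apply, map_zero, zero_add] at h4 ⊢
  rw [(fderiv_rightField (U := U) w v).2] at h4
  rw [br_eq_fderiv, ← h4]
  abel

/-- The derivative of `Ad(g) w` along a curve `g` is `Ad(g) [g⁻¹ g_t, w]`. -/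
lemma HasLogDeriv.hasDerivAt_AdL {g : ℝ → U} {t : ℝ} {v : E} (hg : HasLogDeriv g v t) (w : E) :
    HasDerivAt (fun s => AdL (g s) w) (AdL (g t) (br U v w)) t := by
  obtain ⟨D, hD, hD'⟩ := hasFDerivAt_AdL_chart (U := U) w
  have e : coordOne E U = chartOne E U ((g t)⁻¹ * g t) := by rw [inv_mul_cancel]
  rw [e] at hD'
  have h1 := (AdL (g t)).hasFDerivAt.comp_hasDerivAt t (hD'.comp_hasDerivAt t hg.2)
  rw [hD] at h1
  refine h1.congr_of_eventuallyEq ?_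
  have h3 : ∀ᶠ s in 𝓝 t, (g t)⁻¹ * g s ∈ (chartOne E U).source := by
    have h4 : ContinuousAt (fun s => (g t)⁻¹ * g s) t :=
      (contMDiff_mul_left (I := 𝓘(ℝ, E)) (n := ∞)).continuous.continuousAt.comp hg.1
    refine h4 (chartOne_source_mem_nhds ?_)
    simp [one_mem_source]
  filter_upwards [h3] with s hs
  simp only [Function.comp]
  rw [PartialEquiv.left_inv _ hs, ← ContinuousLinearMap.comp_apply, ← AdL_mul, mul_inv_cancel_left]

end AdjointDerivative

/-! ### The equation `g⁻¹ g_x = u` -/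

section Bootstrap

/-- A solution of a differential equation with smooth right-hand side is smooth. -/
lemma contDiffOn_of_hasDerivAt {F : Type*} [NormedAddCommGroup F] [NormedSpace ℝ F]
    {G : F × ℝ → F} {Ω : Set (F × ℝ)} (hG : ContDiffOn ℝ ∞ G Ω) {y : ℝ → F} {S : Set ℝ}
    (hS : IsOpen S) (hy : ∀ s ∈ S, (y s, s) ∈ Ω) (hd : ∀ s ∈ S, HasDerivAt y (G (y s, s)) s) :
    ContDiffOn ℝ ∞ y S := by
  rw [contDiffOn_infty]
  intro n
  induction n with
  | zero =>
    exact contDiffOn_zero.2 fun s hs => (hd s hs).continuousAt.continuousWithinAt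
  | succ n ih =>
    have h1 : ContDiffOn ℝ n (deriv y) S := by
      refine ((hG.of_le (by exact_mod_cast le_top)).comp (ih.prodMk contDiffOn_id)
        (fun s hs => hy s hs)).congr fun s hs => ?_
      exact (hd s hs).deriv
    have h2 := (contDiffOn_succ_iff_deriv_of_isOpen (n := (n : WithTop ℕ∞)) hS).2
      ⟨fun s hs => (hd s hs).differentiableAt.differentiableWithinAt, by simp, h1⟩
    exact_mod_cast h2

lemma contDiff_of_hasDerivAt {F : Type*} [NormedAddCommGroup F] [NormedSpace ℝ F]
    {G : F × ℝ → F} (hG : ContDiff ℝ ∞ G) {y : ℝ → F}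
    (hd : ∀ s, HasDerivAt y (G (y s, s)) s) : ContDiff ℝ ∞ y :=
  contDiffOn_univ.1 (contDiffOn_of_hasDerivAt hG.contDiffOn isOpen_univ (fun _ _ => mem_univ _)
    fun s _ => hd s)

end Bootstrap

section Equation

variable {E U : Type*} [NormedAddCommGroup E] [InnerProductSpace ℝ E] [FiniteDimensional ℝ E]
  [TopologicalSpace U] [ChartedSpace E U] [Group U] [LieGroup 𝓘(ℝ, E) ∞ U]

lemma continuous_AdL : Continuous (AdL : U → E →L[ℝ] E) := by
  have : IsTopologicalGroup U := topologicalGroup_of_lieGroup 𝓘(ℝ, E) ∞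
  have h1 : ContinuousAt (AdL : U → E →L[ℝ] E) 1 := by
    have h2 : ContinuousAt (fun g : U => AdL ((chartOne E U).symm (chartOne E U g)) : U → E →L[ℝ] E)
        1 := by
      refine ContinuousAt.comp (g := fun y : E => (AdL ((chartOne E U).symm y) : E →L[ℝ] E)) ?_
        (chartOne_contMDiffAt (one_mem_source E U)).continuousAt
      exact (contDiffAt_AdL_chart (coordOne_mem E U)).continuousAt
    refine h2.congr ?_
    filter_upwards [chartOne_source_mem_nhds (one_mem_source E U)] with g hg
    rw [PartialEquiv.left_inv _ hg]
  rw [continuous_iff_continuousAt]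
  intro g
  have h2 : ContinuousAt (fun h : U => (AdL g : E →L[ℝ] E).comp (AdL (g⁻¹ * h))) g := by
    refine continuousAt_const.clm_comp (ContinuousAt.comp (g := AdL) ?_ (by fun_prop))
    rwa [inv_mul_cancel]
  refine h2.congr (Eventually.of_forall fun h => ?_)
  simp only
  rw [← AdL_mul, mul_inv_cancel_left]

lemma norm_AdL (hinv : AdInvariant E U) (g : U) (x : E) : ‖AdL g x‖ = ‖x‖ := by
  have h := hinv g x x
  rw [real_inner_self_eq_norm_sq, real_inner_self_eq_norm_sq] at h
  exact (sq_eq_sq₀ (norm_nonneg _) (norm_nonneg _)).1 h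

lemma HasLogDeriv.const_mul {g : ℝ → U} {t : ℝ} {v : E} (hg : HasLogDeriv g v t) (c : U) :
    HasLogDeriv (fun s => c * g s) v t := by
  have h := hg.mul (HasLogDeriv.const (E := E) c t)
  simpa using h

/-- A curve in `U` with smooth logarithmic derivative is smooth. -/
lemma contMDiff_of_hasLogDeriv {g : ℝ → U} {u : ℝ → E} (hu : ContDiff ℝ ∞ u)
    (hg : ∀ t, HasLogDeriv g (u t) t) : ContMDiff 𝓘(ℝ, ℝ) 𝓘(ℝ, E) ∞ g := by
  intro t
  set h : ℝ → U := fun s => (g t)⁻¹ * g s with hh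
  have hl : ∀ s, HasLogDeriv h (u s) s := fun s => (hg s).const_mul _
  have hc : Continuous h := continuous_iff_continuousAt.2 fun s => (hl s).1
  set S : Set ℝ := h ⁻¹' (chartOne E U).source with hS
  have hSo : IsOpen S := (isOpen_extChartAt_source (I := 𝓘(ℝ, E)) (1 : U)).preimage hc
  have htS : h t ∈ (chartOne E U).source := by
    simp only [hh, inv_mul_cancel]; exact one_mem_source E U
  have hsm : ContDiffOn ℝ ∞ (fun s => chartOne E U (h s)) S := by
    refine contDiffOn_of_hasDerivAt (G := fun p : E × ℝ => leftField U p.1 (u p.2))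
      (Ω := {p | p.1 ∈ (chartOne E U).target}) ?_ hSo
      (fun s hs => PartialEquiv.map_source (chartOne E U) hs) (fun s hs => (hl s).hasDerivAt_chartOne hs)
    intro p hp
    refine ContDiffAt.contDiffWithinAt ?_
    exact ((contDiffAt_leftField hp).comp p contDiffAt_fst).clm_apply
      (hu.contDiffAt.comp p contDiffAt_snd)
  have h1 : ContMDiffAt 𝓘(ℝ, ℝ) 𝓘(ℝ, E) ∞
      (fun s => g t * (chartOne E U).symm (chartOne E U (h s))) t := by
    refine ContMDiffAt.comp t (g := fun k : U => g t * k)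
      (contMDiff_mul_left (I := 𝓘(ℝ, E)) (n := ∞)).contMDiffAt ?_
    exact ContMDiffAt.comp t (chartOne_symm_contMDiffAt (PartialEquiv.map_source _ htS))
      (hsm.contDiffAt (hSo.mem_nhds htS)).contMDiffAt
  refine h1.congr_of_eventuallyEq ?_
  filter_upwards [hSo.mem_nhds htS] with s hs
  rw [PartialEquiv.left_inv _ hs, hh]
  simp

variable (E U) in
/-- The equation `g⁻¹ g_t = w` with small `w` has a solution inside the chart at the identity. -/
lemma exists_hasLogDeriv_of_small {t₀ : ℝ} (ht₀ : t₀ ∈ Icc (-2 : ℝ) 2) :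
    ∃ δ > 0, ∀ w : ℝ → E, Continuous w → (∀ t, ‖w t‖ ≤ δ) →
      ∃ g : ℝ → U, g t₀ = 1 ∧ ∀ t ∈ Ioo (-2 : ℝ) 2, HasLogDeriv g (w t) t := by
  obtain ⟨K, s, hs, hK⟩ := ((contDiffAt_leftField (U := U) (coordOne_mem E U)).of_le
    (m := 1) (by simp)).exists_lipschitzOnWith
  obtain ⟨r, hr, hrs⟩ := Metric.nhds_basis_closedBall.mem_iff.1
    (Filter.inter_mem hs (chartOne_target_mem_nhds (coordOne_mem E U)))
  set B : ℝ := ‖leftField U (coordOne E U)‖ + K * r with hB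
  have hBn : 0 ≤ B := by positivity
  have hbound : ∀ y ∈ Metric.closedBall (coordOne E U) r, ‖leftField U y‖ ≤ B := by
    intro y hy
    have h1 := hK.dist_le_mul y (hrs hy).1 _ (hrs (Metric.mem_closedBall_self hr.le)).1
    have h2 : ‖leftField U y‖ ≤ ‖leftField U (coordOne E U)‖ +
        ‖leftField U y - leftField U (coordOne E U)‖ := by
      simpa using norm_add_le (leftField U (coordOne E U))
        (leftField U y - leftField U (coordOne E U))
    rw [dist_eq_norm] at h1
    have h3 : K * dist y (coordOne E U) ≤ K * r := by
      gcongr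
      exact hy
    linarith
  refine ⟨r / (4 * (B + 1)), by positivity, fun w hw hwδ => ?_⟩
  set δ := r / (4 * (B + 1)) with hδ
  have hδ0 : 0 < δ := by positivity
  have hf : IsPicardLindelof (fun t y => leftField U y (w t)) (tmin := -2) (tmax := 2)
      ⟨t₀, ht₀⟩ (coordOne E U) (.mk r hr.le) 0 (.mk (B * δ) (by positivity)) (K * .mk δ hδ0.le) := by
    refine ⟨fun t _ => ?_, fun y _ => ?_, fun t _ y hy => ?_, ?_⟩
    · refine LipschitzOnWith.of_dist_le_mul fun y hy z hz => ?_
      have h1 := hK.dist_le_mul y (hrs hy).1 z (hrs hz).1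
      rw [dist_eq_norm] at h1 ⊢
      have h2 : leftField U y (w t) - leftField U z (w t) =
          (leftField U y - leftField U z) (w t) := rfl
      rw [h2]
      refine (ContinuousLinearMap.le_opNorm _ _).trans ?_
      calc ‖leftField U y - leftField U z‖ * ‖w t‖ ≤ (K * dist y z) * δ := by
            gcongr
            exact hwδ t
        _ = _ := by simp only [NNReal.coe_mul, NNReal.coe_mk]; ring
    · exact ((leftField U y).continuous.comp hw).continuousOn
    · refine (ContinuousLinearMap.le_opNorm _ _).trans ?_
      simp only [NNReal.coe_mk]
      gcongr
      · exact hbound y hy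
      · exact hwδ t
    · simp only [NNReal.coe_mk, NNReal.coe_zero, sub_zero]
      have h1 : max (2 - t₀) (t₀ - -2) ≤ 4 := by
        refine max_le ?_ ?_ <;> linarith [ht₀.1, ht₀.2]
      have h2 : B * δ * 4 ≤ r := by
        rw [hδ]
        rw [mul_div_assoc', div_mul_eq_mul_div, div_le_iff₀ (by positivity)]
        nlinarith
      calc B * δ * max (2 - t₀) (t₀ - -2) ≤ B * δ * 4 := by gcongr
        _ ≤ r := h2
  have hx : coordOne E U ∈ Metric.closedBall (coordOne E U) ((0 : NNReal) : ℝ) := by simp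
  obtain ⟨α, hα⟩ := ODE.FunSpace.exists_isFixedPt_next hf hx
  refine ⟨fun t => (chartOne E U).symm (α.compProj t), ?_, fun t ht => ?_⟩
  · have h1 : α.compProj t₀ = coordOne E U := by
      have h2 : α.compProj ((⟨t₀, ht₀⟩ : Icc (-2 : ℝ) 2) : ℝ) = coordOne E U := by
        rw [ODE.FunSpace.compProj_val, ← hα, ODE.FunSpace.next_apply₀]
      exact h2
    simp only [h1]
    exact chartOne_symm_coordOne E U
  · have hmem : α.compProj t ∈ Metric.closedBall (coordOne E U) r :=
      α.compProj_mem_closedBall hf.mul_max_le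
    refine hasLogDeriv_chartOne_symm (hrs hmem).2 ?_
    have h1 : HasDerivWithinAt α.compProj (leftField U (α.compProj t) (w t)) (Icc (-2) 2) t := by
      refine (ODE.hasDerivWithinAt_picard_Icc (⟨t₀, ht₀⟩ : Icc (-2 : ℝ) 2).2
        hf.continuousOn_uncurry α.continuous_compProj.continuousOn
        (fun _ ht' ↦ α.compProj_mem_closedBall hf.mul_max_le)
        (coordOne E U) (Ioo_subset_Icc_self ht)).congr_of_mem ?_ (Ioo_subset_Icc_self ht)
      intro t' ht'
      nth_rw 1 [← hα]
      rw [ODE.FunSpace.compProj_of_mem ht', ODE.FunSpace.next_apply]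
    exact h1.hasDerivAt (Icc_mem_nhds ht.1 ht.2)

/-- The equation `g⁻¹ g_t = w` on a compact interval.  A solution for `w` is a product of solutions
of equations with the small right-hand sides `Ad(g) w / N`. -/
lemma exists_hasLogDeriv_of_compact (hinv : AdInvariant E U) {w : ℝ → E} (hw : Continuous w)
    (hw0 : ∀ t, t ∉ Icc (-(Real.pi / 2)) (Real.pi / 2) → w t = 0) :
    ∃ g : ℝ → U, g (-(Real.pi / 2)) = 1 ∧ ∀ t ∈ Ioo (-2 : ℝ) 2, HasLogDeriv g (w t) t := by
  have hpi : Real.pi / 2 < 2 := by linarith [Real.pi_lt_d2]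
  have hpi0 := Real.pi_pos
  obtain ⟨δ, hδ, hsol⟩ := exists_hasLogDeriv_of_small E U (t₀ := -(Real.pi / 2))
    ⟨by linarith, by linarith⟩
  obtain ⟨M, hM⟩ : ∃ M, ∀ t, ‖w t‖ ≤ M := by
    obtain ⟨M, hM⟩ := (isCompact_Icc (a := -(Real.pi / 2)) (b := Real.pi / 2)).exists_bound_of_continuousOn
      hw.continuousOn
    refine ⟨max M 0, fun t => ?_⟩
    by_cases ht : t ∈ Icc (-(Real.pi / 2)) (Real.pi / 2)
    · exact (hM t ht).trans (le_max_left _ _)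
    · rw [hw0 t ht, norm_zero]; exact le_max_right _ _
  obtain ⟨N, hN⟩ := exists_nat_gt (M / δ)
  have hM0 : 0 ≤ M := (norm_nonneg _).trans (hM 0)
  have hNpos : 0 < (N : ℝ) := lt_of_le_of_lt (by positivity) hN
  have hstep : ∀ n : ℕ, ∃ g : ℝ → U, g (-(Real.pi / 2)) = 1 ∧
      ∀ t ∈ Ioo (-2 : ℝ) 2, HasLogDeriv g ((n / N : ℝ) • w t) t := by
    intro n
    induction n with
    | zero => exact ⟨fun _ => 1, rfl, fun t _ => by simpa using HasLogDeriv.const (E := E) (1 : U) t⟩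
    | succ n ih =>
      obtain ⟨g, hg1, hg⟩ := ih
      have hcont : Continuous (fun t => AdL (g t) ((1 / N : ℝ) • w t)) := by
        rw [continuous_iff_continuousAt]
        intro t
        by_cases ht : t ∈ Ioo (-2 : ℝ) 2
        · exact (continuous_AdL.continuousAt.comp (hg t ht).1).clm_apply
            (hw.continuousAt.const_smul _)
        · have h1 : t ∈ (Icc (-(Real.pi / 2)) (Real.pi / 2))ᶜ := fun h =>
            ht ⟨by linarith [h.1], by linarith [h.2]⟩
          refine ContinuousAt.congr (continuousAt_const (y := (0 : E))) ?_
          filter_upwards [isClosed_Icc.isOpen_compl.mem_nhds h1] with s hs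
          simp [hw0 s hs]
      obtain ⟨k, hk1, hk⟩ := hsol _ hcont (fun t => by
        rw [norm_AdL hinv, norm_smul, Real.norm_of_nonneg (by positivity), one_div,
          inv_mul_le_iff₀ hNpos]
        rw [div_lt_iff₀ hδ] at hN
        linarith [hM t])
      refine ⟨fun t => k t * g t, by simp [hk1, hg1], fun t ht => ?_⟩
      have h := (hg t ht).mul (hk t ht)
      rw [AdL_inv_apply, ← add_smul] at h
      convert h using 2
      push_cast
      ring
  obtain ⟨g, hg1, hg⟩ := hstep N
  refine ⟨g, hg1, fun t ht => ?_⟩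
  have h := hg t ht
  rwa [div_self hNpos.ne', one_smul] at h

/-- The equation `g⁻¹ g_x = u` with Schwartz right-hand side has a smooth solution with
`g(x) → 1` as `x → -∞`.  In the variable `t = arctan x` it becomes an equation on a compact
interval. -/
lemma exists_frame_of_schwartz (hinv : AdInvariant E U) (u : 𝓢(ℝ, E)) :
    ∃ g : ℝ → U, ContMDiff 𝓘(ℝ, ℝ) 𝓘(ℝ, E) ∞ g ∧ Tendsto g atBot (𝓝 1) ∧
      ∀ x, HasLogDeriv g (u x) x := by
  have hpi : Real.pi / 2 < 2 := by linarith [Real.pi_lt_d2]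
  have hpi0 := Real.pi_pos
  set w : ℝ → E := fun t => if t ∈ Ioo (-(Real.pi / 2)) (Real.pi / 2) then
    (1 + Real.tan t ^ 2) • u (Real.tan t) else 0 with hw
  obtain ⟨C, hC0, hC⟩ : ∃ C : ℝ, 0 ≤ C ∧ ∀ x : ℝ, (1 + x ^ 2) ^ 2 * ‖u x‖ ≤ C := by
    obtain ⟨C0, h0, hC0⟩ := u.decay 0 0
    obtain ⟨C2, h2, hC2⟩ := u.decay 2 0
    obtain ⟨C4, h4, hC4⟩ := u.decay 4 0
    refine ⟨C0 + 2 * C2 + C4, by positivity, fun x => ?_⟩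
    have a0 := hC0 x
    have a2 := hC2 x
    have a4 := hC4 x
    simp only [norm_iteratedFDeriv_zero, pow_zero, one_mul, Real.norm_eq_abs] at a0 a2 a4
    rw [Even.pow_abs (by decide)] at a2 a4
    nlinarith
  have hwb : ∀ t ∈ Icc (-(Real.pi / 2)) (Real.pi / 2), ‖w t‖ ≤ C * |Real.cos t| := by
    intro t ht
    by_cases h : t ∈ Ioo (-(Real.pi / 2)) (Real.pi / 2)
    · have hc := Real.cos_pos_of_mem_Ioo h
      have h1 : (1 + Real.tan t ^ 2) * Real.cos t ^ 2 = 1 := by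
        have := Real.inv_one_add_tan_sq hc.ne'
        rw [← this]
        exact mul_inv_cancel₀ (by positivity)
      simp only [hw, if_pos h]
      rw [norm_smul, Real.norm_of_nonneg (by positivity), abs_of_pos hc]
      have h2 := hC (Real.tan t)
      have h3 : (1 + Real.tan t ^ 2) * ‖u (Real.tan t)‖ ≤ C * Real.cos t ^ 2 := by
        calc _ = (1 + Real.tan t ^ 2) ^ 2 * ‖u (Real.tan t)‖ * Real.cos t ^ 2 := by
              linear_combination -((1 + Real.tan t ^ 2) * ‖u (Real.tan t)‖) * h1
          _ ≤ _ := by gcongr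
      refine h3.trans ?_
      gcongr
      nlinarith [Real.cos_le_one t]
    · simp only [hw, if_neg h, norm_zero]
      positivity
  have hw0 : ∀ t, t ∉ Icc (-(Real.pi / 2)) (Real.pi / 2) → w t = 0 := fun t ht => by
    simp only [hw, if_neg (fun h => ht (Ioo_subset_Icc_self h))]
  have hwb' : ∀ t, ‖w t‖ ≤ C * |Real.cos t| := by
    intro t
    by_cases ht : t ∈ Icc (-(Real.pi / 2)) (Real.pi / 2)
    · exact hwb t ht
    · rw [hw0 t ht, norm_zero]; positivity
  have hcont : Continuous w := by
    rw [continuous_iff_continuousAt]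
    intro t
    by_cases h : t ∈ Ioo (-(Real.pi / 2)) (Real.pi / 2)
    · have hc := Real.cos_pos_of_mem_Ioo h
      have h1 : ContinuousAt (fun t => (1 + Real.tan t ^ 2) • u (Real.tan t)) t := by
        have := Real.continuousAt_tan.2 hc.ne'
        exact (continuousAt_const.add (this.pow 2)).smul (u.continuous.continuousAt.comp this)
      refine h1.congr ?_
      filter_upwards [isOpen_Ioo.mem_nhds h] with s hs
      simp only [hw, if_pos hs]
    · by_cases h' : t ∈ Icc (-(Real.pi / 2)) (Real.pi / 2)
      · have hc : Real.cos t = 0 := by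
          rcases eq_or_lt_of_le h'.1 with h1 | h1
          · rw [← h1, Real.cos_neg, Real.cos_pi_div_two]
          · rcases eq_or_lt_of_le h'.2 with h2 | h2
            · rw [h2, Real.cos_pi_div_two]
            · exact absurd ⟨h1, h2⟩ h
        have hwt : w t = 0 := by simp only [hw, if_neg h]
        rw [ContinuousAt, hwt]
        refine squeeze_zero_norm hwb' ?_
        have : Tendsto (fun t => C * |Real.cos t|) (𝓝 t) (𝓝 (C * |Real.cos t|)) :=
          (continuous_const.mul Real.continuous_cos.abs).continuousAt
        simpa [hc] using this
      · refine ContinuousAt.congr (continuousAt_const (y := (0 : E))) ?_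
        filter_upwards [isClosed_Icc.isOpen_compl.mem_nhds h'] with s hs
        exact (hw0 s hs).symm
  obtain ⟨g, hg1, hg⟩ := exists_hasLogDeriv_of_compact hinv hcont hw0
  have hlog : ∀ x, HasLogDeriv (fun x => g (Real.arctan x)) (u x) x := by
    intro x
    have hx := Real.arctan_mem_Ioo x
    have h1 := (hg (Real.arctan x) ⟨by linarith [hx.1], by linarith [hx.2]⟩).comp
      (Real.hasDerivAt_arctan x)
    have h2 : (1 / (1 + x ^ 2)) • w (Real.arctan x) = u x := by
      simp only [hw]
      rw [if_pos hx, Real.tan_arctan, smul_smul, one_div, inv_mul_cancel₀ (by positivity), one_smul]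
    rwa [h2] at h1
  refine ⟨fun x => g (Real.arctan x), contMDiff_of_hasLogDeriv (u.smooth ⊤) hlog, ?_, hlog⟩
  have h1 := (hg (-(Real.pi / 2)) ⟨by linarith, by linarith⟩).1
  rw [ContinuousAt, hg1] at h1
  exact h1.comp (Real.tendsto_arctan_atBot.mono_right nhdsWithin_le_nhds)

end Equation

/-! ### The Lie algebra and isotropy subalgebras -/

section Algebra

variable {E U : Type*} [NormedAddCommGroup E] [InnerProductSpace ℝ E] [FiniteDimensional ℝ E]
  [TopologicalSpace U] [ChartedSpace E U] [Group U] [LieGroup 𝓘(ℝ, E) ∞ U]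

lemma J_apply (x y : E) : J U y x = br U x y := rfl

lemma br_add_left (x x' y : E) : br U (x + x') y = br U x y + br U x' y := map_add (J U y) x x'

lemma br_smul_left (c : ℝ) (x y : E) : br U (c • x) y = c • br U x y := map_smul (J U y) c x

lemma br_skew (x y : E) : br U x y = -br U y x := by
  rw [br_eq_fderiv, br_eq_fderiv]; abel

lemma br_self (x : E) : br U x x = 0 := by
  rw [br_eq_fderiv, sub_self]

lemma br_jacobi (x y z : E) : br U x (br U y z) = br U (br U x y) z + br U y (br U x z) := by
  have : LieGroup 𝓘(ℝ, E) (minSmoothness ℝ 3) U := by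
    rw [minSmoothness_of_isRCLikeNormedField]; infer_instance
  have : CompleteSpace E := FiniteDimensional.complete ℝ E
  exact leibniz_lie (show GroupLieAlgebra 𝓘(ℝ, E) U from x) (show GroupLieAlgebra 𝓘(ℝ, E) U from y)
    (show GroupLieAlgebra 𝓘(ℝ, E) U from z)

lemma br_add_right (x y y' : E) : br U x (y + y') = br U x y + br U x y' := by
  rw [br_skew, br_add_left, neg_add, ← br_skew, ← br_skew]

lemma br_smul_right (c : ℝ) (x y : E) : br U x (c • y) = c • br U x y := by
  rw [br_skew, br_smul_left, ← smul_neg, ← br_skew]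

variable (U) in
/-- The adjoint representation of the Lie algebra as a continuous bilinear map. -/
def adL : E →L[ℝ] E →L[ℝ] E :=
  LinearMap.toContinuousLinearMap
    ((LinearMap.toContinuousLinearMap : (E →ₗ[ℝ] E) ≃ₗ[ℝ] E →L[ℝ] E).toLinearMap ∘ₗ
      LinearMap.mk₂ ℝ (br U) br_add_left br_smul_left br_add_right br_smul_right)

lemma adL_apply (x y : E) : adL U x y = br U x y := rfl

lemma br_zero_left (x : E) : br U (0 : E) x = 0 := map_zero (J U x)

lemma br_zero_right (x : E) : br U x (0 : E) = 0 := map_zero (adL U x)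

lemma br_neg_left (x y : E) : br U (-x) y = -br U x y := map_neg (J U y) x

lemma br_neg_right (x y : E) : br U x (-y) = -br U x y := map_neg (adL U x) y

lemma br_sub_right (x y z : E) : br U x (y - z) = br U x y - br U x z := map_sub (adL U x) y z

lemma br_sub_left (x y z : E) : br U (x - y) z = br U x z - br U y z := map_sub (J U z) x y

lemma exists_curve_hasLogDeriv (v : E) : ∃ g : ℝ → U, g 0 = 1 ∧ HasLogDeriv g v 0 := by
  refine ⟨fun s => (chartOne E U).symm (coordOne E U + s • v), by simp [chartOne_symm_coordOne],
    hasLogDeriv_chartOne_symm (by simpa using coordOne_mem E U) ?_⟩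
  simp only [zero_smul, add_zero, leftField_coordOne, ContinuousLinearMap.id_apply]
  simpa using ((hasDerivAt_id (0 : ℝ)).smul_const v).const_add (coordOne E U)

/-- `Ad g` is an automorphism of the Lie algebra. -/
lemma AdL_br (k : U) (x y : E) : AdL k (br U x y) = br U (AdL k x) (AdL k y) := by
  obtain ⟨g, hg0, hg⟩ := exists_curve_hasLogDeriv (U := U) x
  have h1 := (AdL k).hasFDerivAt.comp_hasDerivAt 0 (hg.hasDerivAt_AdL y)
  have h2 : HasLogDeriv (fun s => k * (g s * k⁻¹)) (AdL k x) 0 := by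
    have := ((HasLogDeriv.const (E := E) k⁻¹ 0).mul hg).const_mul k
    simpa using this
  have h3 := h2.hasDerivAt_AdL (AdL k y)
  have h4 : (fun s => AdL (k * (g s * k⁻¹)) (AdL k y)) = (AdL k) ∘ fun s => AdL (g s) y := by
    ext s
    simp only [AdL_mul, ContinuousLinearMap.comp_apply, AdL_inv_apply, Function.comp]
  rw [h4] at h3
  have h5 := h1.unique h3
  simpa [hg0, AdL_one] using h5

lemma inner_AdL (hinv : AdInvariant E U) (g : U) (x y : E) : ⟪AdL g x, AdL g y⟫ = ⟪x, y⟫ :=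
  hinv g x y

lemma inner_br (hinv : AdInvariant E U) (x y z : E) : ⟪br U x y, z⟫ = -⟪y, br U x z⟫ := by
  obtain ⟨g, hg0, hg⟩ := exists_curve_hasLogDeriv (U := U) x
  have h1 := (hg.hasDerivAt_AdL y).inner ℝ (hg.hasDerivAt_AdL z)
  have h2 : (fun s => ⟪AdL (g s) y, AdL (g s) z⟫) = fun _ => ⟪y, z⟫ := by
    ext s; exact inner_AdL hinv _ _ _
  rw [h2] at h1
  have h3 := h1.unique (hasDerivAt_const 0 _)
  simp only [hg0, AdL_one, ContinuousLinearMap.id_apply] at h3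
  linarith

lemma mem_isotropy {x y : E} : x ∈ isotropy U y ↔ br U x y = 0 := Iff.rfl

lemma self_mem_isotropy (a : E) : a ∈ isotropy U a := br_self a

lemma mem_isotropy_comm {x y : E} : x ∈ isotropy U y ↔ y ∈ isotropy U x := by
  rw [mem_isotropy, mem_isotropy, br_skew, neg_eq_zero]

/-- The normal space of the orbit is the isotropy algebra, since `J_a` is skew-adjoint. -/
lemma orbitNormal_eq (hinv : AdInvariant E U) (a : E) : orbitNormal U a = isotropy U a := by
  ext y
  rw [orbitNormal, Submodule.mem_orthogonal, mem_isotropy_comm, mem_isotropy]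
  constructor
  · intro h
    have h1 := h (br U (br U a y) a) ⟨br U a y, rfl⟩
    rw [br_skew, inner_neg_left, inner_br hinv, neg_neg, real_inner_self_eq_norm_sq] at h1
    simpa using h1
  · rintro h _ ⟨x, rfl⟩
    rw [J_apply, br_skew, inner_neg_left, inner_br hinv, h, inner_zero_right, neg_zero, neg_zero]

lemma orbitTangent_eq (hinv : AdInvariant E U) (a : E) :
    orbitTangent U a = (isotropy U a)ᗮ := by
  rw [← orbitNormal_eq hinv, orbitNormal, Submodule.orthogonal_orthogonal]

lemma br_mem_isotropy {a x y : E} (hx : x ∈ isotropy U a) (hy : y ∈ isotropy U a) :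
    br U x y ∈ isotropy U a := by
  rw [mem_isotropy_comm, mem_isotropy] at *
  rw [br_jacobi, hx, hy, br_zero_left, br_zero_right, add_zero]

lemma br_mem_isotropy_orthogonal (hinv : AdInvariant E U) {a x y : E} (hx : x ∈ isotropy U a)
    (hy : y ∈ (isotropy U a)ᗮ) : br U x y ∈ (isotropy U a)ᗮ := by
  rw [Submodule.mem_orthogonal'] at *
  intro z hz
  rw [inner_br hinv, hy _ (br_mem_isotropy hx hz), neg_zero]

lemma br_mem_isotropy_orthogonal_right (hinv : AdInvariant E U) (a x : E) :
    br U x a ∈ (isotropy U a)ᗮ := by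
  rw [← orbitTangent_eq hinv]; exact ⟨x, rfl⟩

lemma AdL_mem_isotropy {a x : E} (k : U) (hx : x ∈ isotropy U a) :
    AdL k x ∈ isotropy U (AdL k a) := by
  rw [mem_isotropy] at *
  rw [← AdL_br, hx, map_zero]

lemma AdL_mem_isotropy_orthogonal (hinv : AdInvariant E U) {a x : E} (k : U)
    (hx : x ∈ (isotropy U a)ᗮ) : AdL k x ∈ (isotropy U (AdL k a))ᗮ := by
  rw [Submodule.mem_orthogonal'] at *
  intro z hz
  have h1 := AdL_mem_isotropy k⁻¹ hz
  rw [AdL_inv_apply] at h1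
  rw [← AdL_apply_inv k z, inner_AdL hinv, hx _ h1]

/-! ### The isotropy group of a point on a principal orbit -/

/-- Vectors fixed by the isotropy group of `a` commute with the isotropy algebra of `a`. -/
lemma br_eq_zero_of_fixed {a f x : E} (hx : x ∈ isotropy U a)
    (hf : ∀ h : U, AdL h a = a → AdL h f = f) : br U x f = 0 := by
  obtain ⟨δ, hδ, hsol⟩ := exists_hasLogDeriv_of_small E U (t₀ := 0) ⟨by norm_num, by norm_num⟩
  set c : ℝ := δ / (‖x‖ + 1) with hc
  have hc0 : 0 < c := by positivity
  obtain ⟨g, hg0, hg⟩ := hsol (fun _ => c • x) continuous_const (fun _ => by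
    rw [norm_smul, Real.norm_of_nonneg hc0.le, hc, div_mul_eq_mul_div, div_le_iff₀ (by positivity)]
    nlinarith [norm_nonneg x])
  have h1 : ∀ t ∈ Ioo (-2 : ℝ) 2, AdL (g t) a = a := by
    intro t ht
    have h2 : ∀ s ∈ Ioo (-2 : ℝ) 2, HasDerivAt (fun s => AdL (g s) a) 0 s := by
      intro s hs
      have h3 := (hg s hs).hasDerivAt_AdL a
      rwa [br_smul_left, mem_isotropy.1 hx, smul_zero, map_zero] at h3
    have h4 := isOpen_Ioo.is_const_of_deriv_eq_zero isPreconnected_Ioo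
      (fun s hs => (h2 s hs).differentiableAt.differentiableWithinAt)
      (fun s hs => (h2 s hs).deriv) ht (show (0 : ℝ) ∈ Ioo (-2 : ℝ) 2 by norm_num)
    simpa [hg0, AdL_one] using h4
  have h0 : (0 : ℝ) ∈ Ioo (-2 : ℝ) 2 := by norm_num
  have h5 := (hg 0 h0).hasDerivAt_AdL f
  have h6 := h5.unique ((hasDerivAt_const 0 f).congr_of_eventuallyEq (by
    filter_upwards [isOpen_Ioo.mem_nhds h0] with s hs
    exact hf _ (h1 s hs)))
  simp only [hg0, AdL_one, ContinuousLinearMap.id_apply, br_smul_left] at h6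
  exact (smul_eq_zero.1 h6).resolve_left hc0.ne'

/-- The isotropy algebra has minimal dimension on principal orbits. -/
lemma finrank_isotropy_le {a : E} (ha : IsPrincipal U a) (y : E) :
    Module.finrank ℝ (isotropy U a) ≤ Module.finrank ℝ (isotropy U y) := by
  obtain ⟨k, hk⟩ := ha y
  have hinj : Function.Injective (AdL k : E →L[ℝ] E).toLinearMap := fun x x' h => by
    have := congrArg (AdL k⁻¹) h
    simpa [AdL_inv_apply] using this
  rw [← (Submodule.equivMapOfInjective _ hinj (isotropy U a)).symm.finrank_eq]
  refine Submodule.finrank_mono ?_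
  rintro _ ⟨x, hx, rfl⟩
  have h1 : br U x (AdL k⁻¹ y) = 0 := by
    refine br_eq_zero_of_fixed hx fun h hh => ?_
    have h2 : AdL (k * h * k⁻¹) y = y := hk h hh
    have h3 := congrArg (AdL k⁻¹) h2
    rwa [AdL_mul, AdL_mul, ContinuousLinearMap.comp_apply, ContinuousLinearMap.comp_apply,
      AdL_inv_apply] at h3
  have h2 := AdL_mem_isotropy k (mem_isotropy.2 h1)
  rwa [AdL_apply_inv] at h2

lemma exists_pos_mul_norm_le (a : E) :
    ∃ c > 0, ∀ x ∈ (isotropy U a)ᗮ, c * ‖x‖ ≤ ‖br U x a‖ := by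
  have hker : LinearMap.ker ((J U a).domRestrict (isotropy U a)ᗮ) = ⊥ := by
    rw [LinearMap.ker_eq_bot']
    rintro ⟨x, hx⟩ h
    have h1 : x ∈ isotropy U a := h
    have h2 : x ∈ isotropy U a ⊓ (isotropy U a)ᗮ := ⟨h1, hx⟩
    rw [Submodule.inf_orthogonal_eq_bot] at h2
    exact Subtype.ext h2
  obtain ⟨K, hK, hK2⟩ := LinearMap.exists_antilipschitzWith _ hker
  refine ⟨(K : ℝ)⁻¹, by positivity, fun x hx => ?_⟩
  have h1 := hK2.le_mul_dist ⟨x, hx⟩ 0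
  rw [map_zero, dist_zero_right, dist_zero_right] at h1
  rw [inv_mul_le_iff₀ (by positivity)]
  exact h1

/-- For `b` in the isotropy algebra of a principal `a`, the points `a + t b` with small `t > 0` have
the same isotropy algebra as `a`: it cannot be bigger, since `J_a` is bounded below on `𝒰_a^⊥`, and
it cannot have smaller dimension. -/
lemma isotropy_add_smul (hinv : AdInvariant E U) {a b : E} (ha : IsPrincipal U a)
    (hb : b ∈ isotropy U a) :
    ∃ ε > 0, ∀ t : ℝ, 0 < t → t < ε → isotropy U (a + t • b) = isotropy U a := by
  obtain ⟨c, hc, hcx⟩ := exists_pos_mul_norm_le (U := U) a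
  set C : ℝ := ‖(adL U).flip b‖ with hC
  refine ⟨c / (C + 1), by positivity, fun t ht htε => ?_⟩
  refine Submodule.eq_of_le_of_finrank_le ?_ (finrank_isotropy_le ha _)
  intro x hx
  set x0 := (isotropy U a).starProjection x with hx0
  set x1 := (isotropy U a)ᗮ.starProjection x with hx1
  have hx01 : x0 + x1 = x := Submodule.starProjection_add_starProjection_orthogonal x
  have m0 : x0 ∈ isotropy U a := Submodule.starProjection_apply_mem _ _
  have m1 : x1 ∈ (isotropy U a)ᗮ := Submodule.starProjection_apply_mem _ _
  have e1 : t • br U x0 b + br U x1 (a + t • b) = 0 := by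
    have h1 := mem_isotropy.1 hx
    rw [← hx01, br_add_left, br_add_right, mem_isotropy.1 m0, zero_add, br_smul_right] at h1
    exact h1
  have m2 : br U x1 (a + t • b) ∈ (isotropy U a)ᗮ := by
    rw [br_add_right, br_smul_right]
    refine add_mem (br_mem_isotropy_orthogonal_right hinv a x1) (Submodule.smul_mem _ _ ?_)
    rw [br_skew]
    exact neg_mem (br_mem_isotropy_orthogonal hinv hb m1)
  have e2 : br U x1 (a + t • b) = 0 := by
    have h2 : br U x1 (a + t • b) ∈ isotropy U a := by
      rw [eq_neg_of_add_eq_zero_right e1]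
      exact neg_mem (Submodule.smul_mem _ _ (br_mem_isotropy m0 hb))
    have h3 : br U x1 (a + t • b) ∈ isotropy U a ⊓ (isotropy U a)ᗮ := ⟨h2, m2⟩
    rw [Submodule.inf_orthogonal_eq_bot] at h3
    exact h3
  have e3 : x1 = 0 := by
    rw [br_add_right, br_smul_right] at e2
    have h1 := hcx x1 m1
    rw [eq_neg_of_add_eq_zero_left e2, norm_neg, norm_smul, Real.norm_of_nonneg ht.le] at h1
    have h2 : ‖br U x1 b‖ ≤ C * ‖x1‖ := ((adL U).flip b).le_opNorm x1
    rw [lt_div_iff₀ (by positivity)] at htε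
    by_contra hne
    have h3 : 0 < ‖x1‖ := norm_pos_iff.2 hne
    have h4 : t * ‖br U x1 b‖ ≤ t * (C * ‖x1‖) := by gcongr
    have h5 : c * ‖x1‖ ≤ (t * C) * ‖x1‖ := by linarith
    have h6 := le_of_mul_le_mul_right h5 h3
    nlinarith
  rw [e3, add_zero] at hx01
  rw [← hx01]
  exact m0

/-- Elements of `U` near the identity act trivially on the centre of the Lie algebra. -/
lemma eventually_AdL_central :
    ∀ᶠ k in 𝓝 (1 : U), ∀ z : E, (∀ x, br U x z = 0) → AdL k z = z := by
  obtain ⟨r, hr, hrs⟩ := Metric.nhds_basis_ball.mem_iff.1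
    (chartOne_target_mem_nhds (coordOne_mem E U))
  have h1 : ContinuousAt (chartOne E U) (1 : U) :=
    (chartOne_contMDiffAt (one_mem_source E U)).continuousAt
  filter_upwards [h1 (Metric.ball_mem_nhds _ hr), chartOne_source_mem_nhds (one_mem_source E U)]
    with k hk hks z hz
  set v := chartOne E U k - coordOne E U with hv
  set l : ℝ → E := fun s => coordOne E U + s • v with hl
  set S : Set ℝ := l ⁻¹' Metric.ball (coordOne E U) r with hS
  have hSo : IsOpen S := Metric.isOpen_ball.preimage (by fun_prop)
  have hSc : Convex ℝ S := by
    have : l = AffineMap.lineMap (coordOne E U) (chartOne E U k) := by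
      ext s
      simp only [hl, hv, AffineMap.lineMap_apply, vsub_eq_sub, vadd_eq_add]
      abel
    rw [hS, this]
    exact (convex_ball _ _).affine_preimage _
  have hd : ∀ s ∈ S, HasDerivAt (fun s => AdL ((chartOne E U).symm (l s)) z) 0 s := by
    intro s hs
    have hd1 : MDifferentiableAt 𝓘(ℝ, ℝ) 𝓘(ℝ, E) (fun s => (chartOne E U).symm (l s)) s := by
      refine MDifferentiableAt.comp s (g := (chartOne E U).symm) (I' := 𝓘(ℝ, E))
        ((chartOne_symm_contMDiffAt (hrs hs)).mdifferentiableAt (by simp)) ?_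
      have : DifferentiableAt ℝ l s := by fun_prop
      exact this.mdifferentiableAt
    have h2 := (hasLogDeriv_leftLogDeriv hd1).hasDerivAt_AdL z
    rwa [hz, map_zero] at h2
  have m1 : (1 : ℝ) ∈ S := by simpa [hS, hl, hv] using hk
  have m0 : (0 : ℝ) ∈ S := by simpa [hS, hl] using hr
  have h4 := hSo.is_const_of_deriv_eq_zero hSc.isPreconnected
    (fun s hs => (hd s hs).differentiableAt.differentiableWithinAt)
    (fun s hs => (hd s hs).deriv) m1 m0
  simpa [hl, hv, chartOne_symm_coordOne, AdL_one, PartialEquiv.left_inv _ hks] using h4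

end Algebra

section Polynomial

open Polynomial in
lemma aeval_mul_of_semiconj {A : Type*} [Ring A] [Algebra ℝ A] {S T P : A} (h : S * P = P * T)
    (p : ℝ[X]) : aeval S p * P = P * aeval T p := by
  have hn : ∀ n : ℕ, S ^ n * P = P * T ^ n := by
    intro n
    induction n with
    | zero => simp
    | succ n ih => rw [pow_succ', mul_assoc, ih, ← mul_assoc, h, mul_assoc, ← pow_succ']
  induction p using Polynomial.induction_on' with
  | add p q hp hq => rw [map_add, map_add, add_mul, mul_add, hp, hq]
  | monomial n c =>
    rw [aeval_monomial, aeval_monomial, mul_assoc, hn, ← mul_assoc, ← mul_assoc,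
      Algebra.commutes]

open Polynomial in
/-- If `T` is a simple root of `p`, in the sense that `p'(T)` is invertible, then `T` is isolated
among the roots of `p` that commute with `T`. -/
lemma eventually_eq_of_commute {A : Type*} [NormedRing A] [NormedAlgebra ℝ A] [CompleteSpace A]
    {T : A} {p : ℝ[X]} (hT : aeval T p = 0) (hu : IsUnit (aeval T (derivative p))) :
    ∀ᶠ S in 𝓝 T, Commute S T → aeval S p = 0 → S = T := by
  set R : A → A := fun S => ∑ n ∈ p.support, p.coeff n •
    ∑ i ∈ Finset.range n, S ^ i * T ^ (n - 1 - i) with hR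
  have hRc : Continuous R := by fun_prop
  have hRT : R T = aeval T (derivative p) := by
    rw [derivative_apply, Polynomial.sum, map_sum]
    refine Finset.sum_congr rfl fun n _ => ?_
    have h1 : ∀ i ∈ Finset.range n, T ^ i * T ^ (n - 1 - i) = T ^ (n - 1) := by
      intro i hi
      rw [← pow_add]
      congr 1
      have := Finset.mem_range.1 hi
      omega
    rw [Finset.sum_congr rfl h1, Finset.sum_const, Finset.card_range, map_mul, aeval_C, map_pow,
      aeval_X, map_mul, map_natCast, nsmul_eq_mul]
    simp [Algebra.smul_def, mul_assoc]
  have hRu : ∀ᶠ S in 𝓝 T, IsUnit (R S) := by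
    refine hRc.continuousAt.eventually (p := IsUnit) ?_
    rw [hRT]
    exact Units.isOpen.mem_nhds hu
  filter_upwards [hRu] with S hS hc hp
  have h1 : R S * (S - T) = 0 := by
    have h2 : R S * (S - T) = aeval S p - aeval T p := by
      rw [aeval_eq_sum_range' (n := p.natDegree + 1) (by omega),
        aeval_eq_sum_range' (n := p.natDegree + 1) (by omega), ← Finset.sum_sub_distrib, hR]
      simp only
      rw [Finset.sum_mul]
      refine (Finset.sum_subset (supp_subset_range (Nat.lt_succ_self _)) fun n _ hn => ?_).trans ?_
      · rw [notMem_support_iff.1 hn, zero_smul, zero_mul]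
      · refine Finset.sum_congr rfl fun n _ => ?_
        rw [smul_mul_assoc, hc.geom_sum₂_mul, smul_sub]
    rw [h2, hp, hT, sub_zero]
  exact sub_eq_zero.1 ((hS.mul_right_eq_zero).1 h1)

end Polynomial

/-! ### Isotropy groups of principal elements -/

section Principal

variable {E U : Type*} [NormedAddCommGroup E] [InnerProductSpace ℝ E] [FiniteDimensional ℝ E]
  [TopologicalSpace U] [ChartedSpace E U] [Group U] [LieGroup 𝓘(ℝ, E) ∞ U]

lemma isSemisimple_J (hinv : AdInvariant E U) (a : E) :
    Module.End.IsSemisimple (J U a : Module.End ℝ E) := by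
  rw [Module.End.isSemisimple_iff]
  intro p hp
  refine ⟨pᗮ, ?_, Submodule.isCompl_orthogonal p⟩
  intro x hx
  rw [Submodule.mem_comap, Submodule.mem_orthogonal'] at *
  intro y hy
  have h1 : J U a y ∈ p := hp hy
  rw [J_apply] at *
  rw [br_skew, inner_neg_left, inner_br hinv, neg_neg, br_skew, inner_neg_right, hx _ h1, neg_zero]

open Polynomial in
lemma squarefree_minpoly_J (hinv : AdInvariant E U) (a : E) :
    Squarefree (minpoly ℝ (J U a : Module.End ℝ E)) :=
  (isSemisimple_J hinv a).minpoly_squarefree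

open Polynomial in
/-- The skew-adjoint map `J_a` has a generalized inverse that is a polynomial in `J_a`. -/
lemma exists_polynomial_pseudoInverse (hinv : AdInvariant E U) (a : E) :
    ∃ q : ℝ[X], (J U a : Module.End ℝ E) * aeval (J U a : Module.End ℝ E) q * J U a = J U a := by
  set T : Module.End ℝ E := J U a with hT
  have hsq := squarefree_minpoly_J hinv a
  have hr : ∃ r : ℝ[X], T * aeval T r = 0 ∧ r.coeff 0 ≠ 0 := by
    by_cases hX : X ∣ minpoly ℝ T
    · obtain ⟨r, hr⟩ := hX
      refine ⟨r, ?_, fun h0 => ?_⟩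
      · have := minpoly.aeval ℝ T
        rwa [hr, map_mul, aeval_X] at this
      · obtain ⟨r', hr'⟩ := X_dvd_iff.2 h0
        have h2 : (X : ℝ[X]) * X ∣ minpoly ℝ T := ⟨r', by rw [hr, hr', mul_assoc]⟩
        exact not_isUnit_X (hsq _ h2)
    · exact ⟨minpoly ℝ T, by rw [minpoly.aeval, mul_zero], fun h => hX (X_dvd_iff.2 h)⟩
  obtain ⟨r, hr, hr0⟩ := hr
  refine ⟨C (-(r.coeff 0)⁻¹) * divX r, ?_⟩
  rw [← divX_mul_X_add r, map_add, map_mul, aeval_X, aeval_C, mul_add, ← mul_assoc] at hr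
  have h1 : T * aeval T (divX r) * T = -(r.coeff 0 • T) := by
    rw [eq_neg_of_add_eq_zero_left hr, Algebra.smul_def, Algebra.commutes]
  rw [map_mul, aeval_C, ← Algebra.smul_def, mul_smul_comm, smul_mul_assoc, h1, smul_neg, smul_smul,
    neg_mul, inv_mul_cancel₀ hr0, neg_one_smul, neg_neg]

lemma flip_adL_apply (x y : E) : (adL U).flip y x = br U x y := rfl

lemma semiconj_flip_adL (k : U) (a : E) :
    (adL U).flip (AdL k a) * AdL k = AdL k * (adL U).flip a := by
  ext x
  simp only [mul_apply_eq_comp, flip_adL_apply, AdL_br]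

open Polynomial in
lemma exists_polynomial_simple_root (hinv : AdInvariant E U) (a : E) :
    ∃ p : ℝ[X], aeval ((adL U).flip a) p = 0 ∧ IsUnit (aeval ((adL U).flip a) (derivative p)) := by
  set T : Module.End ℝ E := J U a with hT
  have hp : aeval ((adL U).flip a) (minpoly ℝ T) = 0 := by
    have h1 : ∀ p : ℝ[X], ∀ x, aeval ((adL U).flip a) p x = aeval T p x := by
      intro p
      induction p using Polynomial.induction_on' with
      | add p q hp hq => intro x; rw [map_add, map_add, add_apply, LinearMap.add_apply, hp, hq]
      | monomial n c =>
        intro x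
        have hn : ∀ n : ℕ, ((adL U).flip a ^ n) x = (T ^ n) x := by
          intro n
          induction n with
          | zero => rfl
          | succ n ih => rw [pow_succ', pow_succ', mul_apply_eq_comp, ih]; rfl
        rw [aeval_monomial, aeval_monomial, ← Algebra.smul_def, ← Algebra.smul_def,
          smul_apply, LinearMap.smul_apply, hn]
    ext x
    rw [h1, minpoly.aeval]
    rfl
  refine ⟨minpoly ℝ T, hp, ?_⟩
  obtain ⟨u, v, huv⟩ := PerfectField.separable_iff_squarefree.2 (squarefree_minpoly_J hinv a)
  have h2 := congrArg (aeval ((adL U).flip a)) huv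
  rw [map_add, map_mul, map_mul, hp, mul_zero, zero_add, map_one] at h2
  refine ⟨⟨_, _, ?_, h2⟩, rfl⟩
  rw [← map_mul, mul_comm, map_mul, h2]

/-- A conjugate of `a` near `a` that commutes with `a` differs from `a` by a central element. -/
lemma eventually_central (hinv : AdInvariant E U) (a : E) :
    ∀ᶠ y in 𝓝 a, y ∈ orbit U a → y ∈ isotropy U a → ∀ x, br U x (y - a) = 0 := by
  obtain ⟨p, hp, hu⟩ := exists_polynomial_simple_root hinv a
  have h1 := (adL U).flip.continuous.continuousAt.eventually (eventually_eq_of_commute hp hu)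
  filter_upwards [h1] with y hy hyo hya x
  have hc : Commute ((adL U).flip y) ((adL U).flip a) := by
    ext x
    simp only [mul_apply_eq_comp, flip_adL_apply]
    rw [br_skew _ y, br_skew _ a, br_skew _ a, br_skew _ y, br_neg_right, br_neg_right, neg_neg,
      neg_neg, br_jacobi y a x, mem_isotropy.1 hya, br_zero_left, zero_add]
  have hroot : Polynomial.aeval ((adL U).flip y) p = 0 := by
    obtain ⟨k, hk⟩ := hyo
    have h2 := aeval_mul_of_semiconj (semiconj_flip_adL k a) p
    rw [hp, mul_zero, AdL_apply, hk] at h2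
    ext x
    have h3 := DFunLike.congr_fun h2 (AdL k⁻¹ x)
    rwa [mul_apply_eq_comp, AdL_apply_inv] at h3
  have h3 := DFunLike.congr_fun (hy hc hroot) x
  rw [flip_adL_apply, flip_adL_apply] at h3
  rw [br_sub_right, h3, sub_self]

/-- For `b` in the isotropy algebra of a principal `a` and small `t > 0`, the isotropy group of
`a + t b` is contained in the isotropy group of `a`. -/
lemma eventually_isotropyGroup_le [CompactSpace U] (hinv : AdInvariant E U) {a b : E}
    (ha : IsPrincipal U a) (hb : b ∈ isotropy U a) :
    ∀ᶠ t in 𝓝 (0 : ℝ), ∀ h ∈ (univ : Set U),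
      0 < t → AdL h (a + t • b) = a + t • b → AdL h a = a := by
  have : IsTopologicalGroup U := topologicalGroup_of_lieGroup 𝓘(ℝ, E) ∞
  have hAc : ∀ x : E, Continuous fun h : U => AdL h x := fun x =>
    continuous_AdL.clm_apply continuous_const
  refine isCompact_univ.eventually_forall_of_forall_eventually
    (P := fun t h => 0 < t → AdL h (a + t • b) = a + t • b → AdL h a = a) fun h0 _ => ?_
  by_cases h0a : AdL h0 a = a
  · obtain ⟨ε, hε, hiso⟩ := isotropy_add_smul hinv ha hb
    have e1 : ∀ᶠ z : ℝ × U in 𝓝 (0, h0), z.1 < ε :=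
      continuous_fst.continuousAt.eventually (gt_mem_nhds hε)
    have e2 : ∀ᶠ z : ℝ × U in 𝓝 (0, h0), AdL z.2 a ∈ orbit U a →
        AdL z.2 a ∈ isotropy U a → ∀ x, br U x (AdL z.2 a - a) = 0 := by
      have hc : Tendsto (fun z : ℝ × U => AdL z.2 a) (𝓝 (0, h0)) (𝓝 a) := by
        have := ((hAc a).comp continuous_snd).tendsto ((0 : ℝ), h0)
        rwa [Function.comp_apply, h0a] at this
      exact hc.eventually (eventually_central hinv a)
    have e3 : ∀ᶠ z : ℝ × U in 𝓝 (0, h0), ∀ y : E, (∀ x, br U x y = 0) →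
        AdL (z.2 * h0⁻¹) y = y := by
      have hc : Tendsto (fun z : ℝ × U => z.2 * h0⁻¹) (𝓝 (0, h0)) (𝓝 1) := by
        have : Continuous fun z : ℝ × U => z.2 * h0⁻¹ := by fun_prop
        simpa using this.tendsto ((0 : ℝ), h0)
      exact hc.eventually eventually_AdL_central
    filter_upwards [e1, e2, e3] with z h1 h2 h3 hz hfix
    have hmem : AdL z.2 a ∈ isotropy U a := by
      have h4 := AdL_mem_isotropy z.2 (show a ∈ isotropy U (a + z.1 • b) by
        rw [hiso _ hz h1]; exact self_mem_isotropy a)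
      rwa [hfix, hiso _ hz h1] at h4
    have hcen := h2 ⟨z.2, rfl⟩ hmem
    set d := AdL z.2 a - a with hd
    -- `d` is central, hence fixed by `z.2 * h0⁻¹`, which maps `a` to `a + d`; so `d` is orthogonal
    -- to itself
    have h5 : AdL (z.2 * h0⁻¹) a = a + d := by
      have : AdL h0⁻¹ a = a := by
        nth_rw 1 [← h0a]; exact AdL_inv_apply _ _
      rw [AdL_mul, ContinuousLinearMap.comp_apply, this, hd]; abel
    have h6 := inner_AdL hinv (z.2 * h0⁻¹) a d
    rw [h3 d hcen, h5, inner_add_left] at h6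
    have h7 : d = 0 := by
      have : ⟪d, d⟫ = 0 := by linarith
      exact inner_self_eq_zero.1 this
    exact sub_eq_zero.1 h7
  · have hc : Continuous fun z : ℝ × U => AdL z.2 (a + z.1 • b) - (a + z.1 • b) :=
      ((continuous_AdL.comp continuous_snd).clm_apply (by fun_prop)).sub (by fun_prop)
    have h1 : ∀ᶠ z : ℝ × U in 𝓝 (0, h0), AdL z.2 (a + z.1 • b) - (a + z.1 • b) ≠ 0 := by
      refine hc.continuousAt.eventually_ne ?_
      simpa using sub_ne_zero.2 h0a
    filter_upwards [h1] with z hz _ hfix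
    exact absurd (sub_eq_zero.2 hfix) hz

/-- The isotropy group of a principal `a` acts trivially on the normal space of the orbit.  The
isotropy group of `z = a + t b` is contained in the isotropy group `H` of `a`, and contains a
conjugate `k H k⁻¹`; since `U` is compact, some powers of `k` tend to the identity, so it contains
`H`. -/
theorem AdL_eq_of_isPrincipal [CompactSpace U] (hinv : AdInvariant E U) {a b : E}
    (ha : IsPrincipal U a) (hb : b ∈ isotropy U a) {h : U} (hh : AdL h a = a) : AdL h b = b := by
  have : IsTopologicalGroup U := topologicalGroup_of_lieGroup 𝓘(ℝ, E) ∞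
  obtain ⟨ε, hε, hball⟩ := Metric.eventually_nhds_iff.1 (eventually_isotropyGroup_le hinv ha hb)
  set t := ε / 2 with ht
  have ht0 : 0 < t := by positivity
  have hsub : ∀ k : U, AdL k (a + t • b) = a + t • b → AdL k a = a := fun k hk =>
    hball (y := t) (by rw [Real.dist_eq, sub_zero, abs_of_pos ht0]; linarith) k (mem_univ _) ht0 hk
  obtain ⟨k, hk⟩ := ha (a + t • b)
  have hpow : ∀ m : ℕ, AdL (k ^ (m + 1) * h * (k ^ (m + 1))⁻¹) (a + t • b) = a + t • b := by
    intro m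
    induction m with
    | zero => rw [zero_add, pow_one]; exact hk h hh
    | succ m ih =>
      have h1 := hk _ (hsub _ ih)
      have h2 : k * (k ^ (m + 1) * h * (k ^ (m + 1))⁻¹) * k⁻¹ =
          k ^ (m + 1 + 1) * h * (k ^ (m + 1 + 1))⁻¹ := by
        rw [pow_succ' k (m + 1), mul_inv_rev]; group
      rw [h2] at h1
      exact h1
  have hclosed : IsClosed {c : U | AdL (c * h * c⁻¹) (a + t • b) = a + t • b} := by
    refine isClosed_eq ?_ continuous_const
    exact (continuous_AdL.comp (by fun_prop)).clm_apply continuous_const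
  have h1 : (1 : U) ∈ {c : U | AdL (c * h * c⁻¹) (a + t • b) = a + t • b} := by
    refine hclosed.mem_of_frequently_of_tendsto (b := 𝓝 (1 : U)) (f := id) ?_ tendsto_id
    have hcl := mapClusterPt_one_atTop_pow k
    rw [mapClusterPt_iff_frequently] at hcl
    rw [Filter.frequently_iff]
    intro s hs
    obtain ⟨m, hm, hms⟩ := (Filter.frequently_atTop.1 (hcl s hs)) 1
    refine ⟨k ^ m, hms, ?_⟩
    have := hpow (m - 1)
    rwa [Nat.sub_add_cancel hm] at this
  have h2 : AdL h (a + t • b) = a + t • b := by simpa using h1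
  rw [map_add, hh, map_smul] at h2
  exact smul_right_injective E ht0.ne' (add_left_cancel h2)

lemma hat_AdL [CompactSpace U] (hinv : AdInvariant E U) {a b : E} (ha : IsPrincipal U a)
    (hb : b ∈ isotropy U a) (g : U) : hat U a b (AdL g a) = AdL g b := by
  have hex : ∃ k : U, Ad k a = AdL g a := ⟨g, rfl⟩
  rw [hat, dif_pos hex]
  have h1 : AdL (g⁻¹ * hex.choose) a = a := by
    rw [AdL_mul, ContinuousLinearMap.comp_apply, AdL_apply, AdL_apply, hex.choose_spec,
      ← AdL_apply g⁻¹, AdL_inv_apply]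
  have h2 := congrArg (AdL g) (AdL_eq_of_isPrincipal hinv ha hb h1)
  rwa [AdL_mul, ContinuousLinearMap.comp_apply, AdL_apply_inv] at h2

end Principal

/-! ### Rapidly decreasing and bounded smooth functions -/

section Decay

variable {F G H : Type*} [NormedAddCommGroup F] [NormedSpace ℝ F] [NormedAddCommGroup G]
  [NormedSpace ℝ G] [NormedAddCommGroup H] [NormedSpace ℝ H]

/-- `f` is smooth, and it decays rapidly on `S` with all its derivatives. -/
def IsDecaying (S : Set ℝ) (f : ℝ → F) : Prop :=
  ContDiff ℝ ∞ f ∧ ∀ k n : ℕ, ∃ C : ℝ, ∀ x ∈ S, |x| ^ k * ‖iteratedDeriv n f x‖ ≤ C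

/-- `f` is smooth, and it is bounded on `S` with all its derivatives. -/
def IsBddSmooth (S : Set ℝ) (f : ℝ → F) : Prop :=
  ContDiff ℝ ∞ f ∧ ∀ n : ℕ, ∃ C : ℝ, ∀ x ∈ S, ‖iteratedDeriv n f x‖ ≤ C

variable {S : Set ℝ} {f f' : ℝ → F} {g : ℝ → G}

lemma IsDecaying.isBddSmooth (hf : IsDecaying S f) : IsBddSmooth S f :=
  ⟨hf.1, fun n => (hf.2 0 n).imp fun C hC x hx => by simpa using hC x hx⟩

lemma IsDecaying.mono (hf : IsDecaying univ f) : IsDecaying S f :=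
  ⟨hf.1, fun k n => (hf.2 k n).imp fun _ hC x _ => hC x (mem_univ x)⟩

lemma IsBddSmooth.mono (hf : IsBddSmooth univ f) : IsBddSmooth S f :=
  ⟨hf.1, fun n => (hf.2 n).imp fun _ hC x _ => hC x (mem_univ x)⟩

lemma IsBddSmooth.const (c : F) : IsBddSmooth S (fun _ => c) := by
  refine ⟨contDiff_const, fun n => ⟨‖c‖, fun x _ => ?_⟩⟩
  rw [iteratedDeriv_const]
  split_ifs <;> simp

lemma norm_iteratedDeriv_bilinear_le (B : F →L[ℝ] G →L[ℝ] H) (hf : ContDiff ℝ ∞ f)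
    (hg : ContDiff ℝ ∞ g) (n : ℕ) (x : ℝ) :
    ‖iteratedDeriv n (fun x => B (f x) (g x)) x‖ ≤ ‖B‖ * ∑ i ∈ Finset.range (n + 1),
      (n.choose i : ℝ) * ‖iteratedDeriv i f x‖ * ‖iteratedDeriv (n - i) g x‖ := by
  simp only [← norm_iteratedFDeriv_eq_norm_iteratedDeriv]
  exact B.norm_iteratedFDeriv_le_of_bilinear hf hg x (by exact_mod_cast le_top)

lemma IsBddSmooth.bilin_decaying (B : F →L[ℝ] G →L[ℝ] H) (hf : IsBddSmooth S f)
    (hg : IsDecaying S g) : IsDecaying S (fun x => B (f x) (g x)) := by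
  refine ⟨B.isBoundedBilinearMap.contDiff.comp (hf.1.prodMk hg.1), fun k n => ?_⟩
  choose C hC using hf.2
  choose D hD using hg.2
  refine ⟨‖B‖ * ∑ i ∈ Finset.range (n + 1), (n.choose i : ℝ) * |C i| * D k (n - i),
    fun x hx => ?_⟩
  calc |x| ^ k * ‖iteratedDeriv n (fun x => B (f x) (g x)) x‖
      ≤ |x| ^ k * (‖B‖ * ∑ i ∈ Finset.range (n + 1),
          (n.choose i : ℝ) * ‖iteratedDeriv i f x‖ * ‖iteratedDeriv (n - i) g x‖) := by
        gcongr
        exact norm_iteratedDeriv_bilinear_le B hf.1 hg.1 n x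
    _ = ‖B‖ * ∑ i ∈ Finset.range (n + 1), (n.choose i : ℝ) * ‖iteratedDeriv i f x‖ *
          (|x| ^ k * ‖iteratedDeriv (n - i) g x‖) := by
        rw [mul_left_comm, Finset.mul_sum]
        congr 1
        exact Finset.sum_congr rfl fun i _ => by ring
    _ ≤ _ := by
        gcongr with i _
        · exact (hC i x hx).trans (le_abs_self _)
        · exact hD k (n - i) x hx

lemma IsDecaying.bilin_bddSmooth (B : F →L[ℝ] G →L[ℝ] H) (hf : IsDecaying S f)
    (hg : IsBddSmooth S g) : IsDecaying S (fun x => B (f x) (g x)) :=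
  hg.bilin_decaying B.flip hf

lemma IsBddSmooth.bilin (B : F →L[ℝ] G →L[ℝ] H) (hf : IsBddSmooth S f)
    (hg : IsBddSmooth S g) : IsBddSmooth S (fun x => B (f x) (g x)) := by
  refine ⟨B.isBoundedBilinearMap.contDiff.comp (hf.1.prodMk hg.1), fun n => ?_⟩
  choose C hC using hf.2
  choose D hD using hg.2
  refine ⟨‖B‖ * ∑ i ∈ Finset.range (n + 1), (n.choose i : ℝ) * |C i| * D (n - i),
    fun x hx => (norm_iteratedDeriv_bilinear_le B hf.1 hg.1 n x).trans ?_⟩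
  gcongr with i _
  · exact (hC i x hx).trans (le_abs_self _)
  · exact hD (n - i) x hx

lemma IsDecaying.clm (L : F →L[ℝ] G) (hf : IsDecaying S f) : IsDecaying S (fun x => L (f x)) :=
  (IsBddSmooth.const L).bilin_decaying (ContinuousLinearMap.id ℝ (F →L[ℝ] G)) hf

lemma IsBddSmooth.clm (L : F →L[ℝ] G) (hf : IsBddSmooth S f) : IsBddSmooth S (fun x => L (f x)) :=
  (IsBddSmooth.const L).bilin (ContinuousLinearMap.id ℝ (F →L[ℝ] G)) hf

lemma IsDecaying.add (hf : IsDecaying S f) (hf' : IsDecaying S f') :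
    IsDecaying S (fun x => f x + f' x) := by
  refine ⟨hf.1.add hf'.1, fun k n => ?_⟩
  obtain ⟨C, hC⟩ := hf.2 k n
  obtain ⟨D, hD⟩ := hf'.2 k n
  refine ⟨C + D, fun x hx => ?_⟩
  have h1 : iteratedDeriv n (fun x => f x + f' x) x =
      iteratedDeriv n f x + iteratedDeriv n f' x :=
    iteratedDeriv_fun_add (hf.1.contDiffAt.of_le (by exact_mod_cast le_top))
      (hf'.1.contDiffAt.of_le (by exact_mod_cast le_top))
  rw [h1]
  calc _ ≤ |x| ^ k * (‖iteratedDeriv n f x‖ + ‖iteratedDeriv n f' x‖) := by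
        gcongr; exact norm_add_le _ _
    _ ≤ _ := by rw [mul_add]; exact add_le_add (hC x hx) (hD x hx)

lemma IsDecaying.neg (hf : IsDecaying S f) : IsDecaying S (fun x => -f x) :=
  hf.clm (-ContinuousLinearMap.id ℝ F)

lemma IsDecaying.deriv (hf : IsDecaying S f) : IsDecaying S (deriv f) :=
  ⟨(contDiff_infty_iff_deriv.1 hf.1).2, fun k n => by
    have := hf.2 k (n + 1)
    rwa [iteratedDeriv_succ'] at this⟩

lemma IsBddSmooth.of_deriv (hf : ContDiff ℝ ∞ f) {C : ℝ} (hC : ∀ x ∈ S, ‖f x‖ ≤ C)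
    (hd : IsBddSmooth S (_root_.deriv f)) : IsBddSmooth S f := by
  refine ⟨hf, fun n => ?_⟩
  cases n with
  | zero => exact ⟨C, fun x hx => by simpa using hC x hx⟩
  | succ n => rw [iteratedDeriv_succ']; exact hd.2 n

lemma IsDecaying.of_deriv (hf : ContDiff ℝ ∞ f)
    (hC : ∀ k : ℕ, ∃ C : ℝ, ∀ x ∈ S, |x| ^ k * ‖f x‖ ≤ C)
    (hd : IsDecaying S (_root_.deriv f)) : IsDecaying S f := by
  refine ⟨hf, fun k n => ?_⟩
  cases n with
  | zero => simpa using hC k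
  | succ n => rw [iteratedDeriv_succ']; exact hd.2 k n

/-- Bounded solutions of a linear equation with bounded coefficients have bounded derivatives. -/
lemma IsBddSmooth.of_linear (B : F →L[ℝ] G →L[ℝ] F) (hg : IsBddSmooth univ g)
    (hd : ∀ x, HasDerivAt f (B (f x) (g x)) x) {C : ℝ} (hC : ∀ x, ‖f x‖ ≤ C) :
    IsBddSmooth univ f := by
  have hs : ContDiff ℝ ∞ f := by
    refine contDiff_of_hasDerivAt (G := fun p : F × ℝ => B p.1 (g p.2)) ?_ hd
    exact B.isBoundedBilinearMap.contDiff.comp (contDiff_fst.prodMk (hg.1.comp contDiff_snd))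
  have hder : deriv f = fun x => B (f x) (g x) := funext fun x => (hd x).deriv
  refine ⟨hs, fun n => ?_⟩
  induction n using Nat.strong_induction_on with
  | _ n ih =>
    cases n with
    | zero => exact ⟨C, fun x _ => by simpa using hC x⟩
    | succ n =>
      rw [iteratedDeriv_succ', hder]
      choose! D hD using ih
      choose K hK using hg.2
      refine ⟨‖B‖ * ∑ i ∈ Finset.range (n + 1), (n.choose i : ℝ) * |D i| * K (n - i),
        fun x hx => (norm_iteratedDeriv_bilinear_le B hs hg.1 n x).trans ?_⟩
      gcongr with i hi
      · exact (hD i (Finset.mem_range.1 hi) x hx).trans (le_abs_self _)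
      · exact hK (n - i) x hx

lemma IsDecaying.exists_schwartz (hf : IsDecaying univ f) : ∃ φ : 𝓢(ℝ, F), ∀ x, φ x = f x := by
  refine ⟨⟨f, hf.1, fun k n => (hf.2 k n).imp fun C hC x => ?_⟩, fun x => rfl⟩
  rw [norm_iteratedFDeriv_eq_norm_iteratedDeriv]
  exact hC x (mem_univ x)

lemma isDecaying_schwartz (φ : 𝓢(ℝ, F)) : IsDecaying univ φ := by
  refine ⟨φ.smooth ⊤, fun k n => (φ.decay k n).imp fun C hC x _ => ?_⟩
  have := hC.2 x
  rwa [norm_iteratedFDeriv_eq_norm_iteratedDeriv] at this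

lemma isDecaying_of_schwartz (h : ∃ φ : 𝓢(ℝ, F), ∀ x, φ x = f x) : IsDecaying univ f := by
  obtain ⟨φ, hφ⟩ := h
  have : f = φ := funext fun x => (hφ x).symm
  rw [this]
  exact isDecaying_schwartz φ

lemma IsDecaying.integrableOn_Iic_zero (hf : IsDecaying (Iic 0) f) (k : ℕ) :
    IntegrableOn (fun x => |x| ^ k * ‖f x‖) (Iic 0) := by
  obtain ⟨C, hC⟩ := hf.2 k 0
  obtain ⟨D, hD⟩ := hf.2 (k + 2) 0
  have h1 : IntegrableOn (fun x : ℝ => (C + D) * (1 + x ^ 2)⁻¹) (Iic 0) :=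
    (integrable_inv_one_add_sq.const_mul _).integrableOn
  refine Integrable.mono' h1 ?_ ?_
  · have : Continuous f := hf.1.continuous
    exact Continuous.aestronglyMeasurable (by fun_prop)
  · refine (ae_restrict_iff' measurableSet_Iic).2 (Eventually.of_forall fun x hx => ?_)
    have a := hC x hx
    have b := hD x hx
    simp only [iteratedDeriv_zero] at a b
    rw [pow_add, sq_abs] at b
    rw [norm_mul, norm_pow, norm_norm, Real.norm_eq_abs, abs_abs, ← div_eq_mul_inv,
      le_div_iff₀ (by positivity)]
    linarith

lemma IsDecaying.integrableOn_Iic (hf : IsDecaying (Iic 0) f) (x : ℝ) :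
    IntegrableOn f (Iic x) := by
  have h1 : IntegrableOn f (Iic 0) := by
    have h := hf.integrableOn_Iic_zero 0
    simp only [pow_zero, one_mul] at h
    exact (integrable_norm_iff hf.1.continuous.aestronglyMeasurable).1 h
  have h2 : IntegrableOn f (Icc 0 x) := hf.1.continuous.continuousOn.integrableOn_Icc
  refine (h1.union h2).mono_set fun s hs => ?_
  rcases le_or_gt s 0 with h | h
  · exact Or.inl h
  · exact Or.inr ⟨h.le, hs⟩

lemma IsDecaying.integrable (hf : IsDecaying univ f) : Integrable f := by
  obtain ⟨φ, hφ⟩ := hf.exists_schwartz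
  have : f = φ := funext fun x => (hφ x).symm
  rw [this]
  exact φ.integrable

lemma IsDecaying.tendsto_atBot (hf : IsDecaying (Iic 0) f) : Tendsto f atBot (𝓝 0) := by
  obtain ⟨C, hC⟩ := hf.2 1 0
  have h1 : Tendsto (fun x : ℝ => C * |x|⁻¹) atBot (𝓝 0) := by
    simpa using (tendsto_abs_atBot_atTop.inv_tendsto_atTop).const_mul C
  refine squeeze_zero_norm' ?_ h1
  filter_upwards [Iio_mem_atBot (0 : ℝ)] with x hx
  have a := hC x (mem_Iic.2 (le_of_lt hx))
  simp only [iteratedDeriv_zero, pow_one] at a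
  rw [← div_eq_mul_inv, le_div_iff₀ (abs_pos.2 (ne_of_lt hx)), mul_comm]
  exact a

variable [CompleteSpace F]

lemma hasDerivAt_integral_Iic (hc : Continuous f) (hi : ∀ x, IntegrableOn f (Iic x)) (x : ℝ) :
    HasDerivAt (fun x => ∫ s in Iic x, f s) (f x) x := by
  have h1 : (fun x => ∫ s in Iic x, f s) = fun x => (∫ s in Iic (0 : ℝ), f s) + ∫ s in (0)..x, f s := by
    ext y
    rw [← intervalIntegral.integral_Iic_sub_Iic (hi 0) (hi y)]
    abel
  rw [h1]
  exact ((hc.integral_hasStrictDerivAt 0 x).hasDerivAt).const_add _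

lemma eq_integral_Iic {l : F} (hf : ContDiff ℝ ∞ f) (hd : IsDecaying (Iic 0) (deriv f))
    (hl : Tendsto f atBot (𝓝 l)) (x : ℝ) : f x = l + ∫ s in Iic x, deriv f s := by
  rw [integral_Iic_of_hasDerivAt_of_tendsto hf.continuous.continuousAt.continuousWithinAt
    (fun y _ => (hf.differentiable (by simp) y).hasDerivAt) (hd.integrableOn_Iic x) hl]
  abel

/-- A function that tends to `0` at `-∞` decays there as rapidly as its derivative. -/
lemma IsDecaying.of_tendsto (hf : ContDiff ℝ ∞ f) (hd : IsDecaying (Iic 0) (_root_.deriv f))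
    (hl : Tendsto f atBot (𝓝 0)) : IsDecaying (Iic 0) f := by
  refine IsDecaying.of_deriv hf (fun k => ?_) hd
  refine ⟨∫ s in Iic (0 : ℝ), |s| ^ k * ‖_root_.deriv f s‖, fun x hx => ?_⟩
  have hx0 : x ≤ 0 := hx
  rw [eq_integral_Iic hf hd hl x, zero_add]
  have hik := hd.integrableOn_Iic_zero k
  calc |x| ^ k * ‖∫ s in Iic x, _root_.deriv f s‖
      ≤ |x| ^ k * ∫ s in Iic x, ‖_root_.deriv f s‖ := by
        gcongr; exact norm_integral_le_integral_norm _
    _ = ∫ s in Iic x, |x| ^ k * ‖_root_.deriv f s‖ := (integral_const_mul _ _).symm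
    _ ≤ ∫ s in Iic x, |s| ^ k * ‖_root_.deriv f s‖ := by
        refine setIntegral_mono_on ((hd.integrableOn_Iic x).norm.const_mul _)
          (hik.mono_set (Iic_subset_Iic.2 hx0)) measurableSet_Iic fun s hs => ?_
        have hs' : s ≤ x := hs
        rw [abs_of_nonpos hx0, abs_of_nonpos (hs'.trans hx0)]
        have : 0 ≤ -x := by linarith
        gcongr
    _ ≤ _ := setIntegral_mono_set hik
        (Eventually.of_forall fun s => by simp only [Pi.zero_apply]; positivity)
        (Iic_subset_Iic.2 hx0).eventuallyLE

/-- A function with a limit at `-∞` and rapidly decreasing derivative is bounded with all its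
derivatives. -/
lemma IsBddSmooth.of_tendsto {l : F} (hf : ContDiff ℝ ∞ f) (hd : IsDecaying univ (_root_.deriv f))
    (hl : Tendsto f atBot (𝓝 l)) : IsBddSmooth univ f := by
  refine IsBddSmooth.of_deriv hf (C := ‖l‖ + ∫ s, ‖_root_.deriv f s‖) (fun x _ => ?_) hd.isBddSmooth
  rw [eq_integral_Iic hf hd.mono hl x]
  refine (norm_add_le _ _).trans ?_
  gcongr
  refine (norm_integral_le_integral_norm _).trans ?_
  exact setIntegral_le_integral hd.integrable.norm (Eventually.of_forall fun s => norm_nonneg _)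

end Decay

/-! ### Frames -/

section Frames

variable {E U : Type*} [NormedAddCommGroup E] [InnerProductSpace ℝ E] [FiniteDimensional ℝ E]
  [TopologicalSpace U] [ChartedSpace E U] [Group U] [LieGroup 𝓘(ℝ, E) ∞ U]

lemma norm_AdL_le (hinv : AdInvariant E U) (g : U) : ‖(AdL g : E →L[ℝ] E)‖ ≤ 1 :=
  ContinuousLinearMap.opNorm_le_bound _ zero_le_one fun x => by rw [norm_AdL hinv, one_mul]

lemma HasLogDeriv.hasDerivAt_AdL_clm {g : ℝ → U} {t : ℝ} {v : E} (hg : HasLogDeriv g v t) :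
    HasDerivAt (fun s => (AdL (g s) : E →L[ℝ] E)) ((AdL (g t)).comp (adL U v)) t := by
  have hd : DifferentiableAt ℝ (fun s => (AdL (g s) : E →L[ℝ] E)) t := by
    have h1 : DifferentiableAt ℝ (fun y : E => (AdL ((chartOne E U).symm y) : E →L[ℝ] E))
        (chartOne E U ((g t)⁻¹ * g t)) := by
      rw [inv_mul_cancel]
      exact (contDiffAt_AdL_chart (coordOne_mem E U)).differentiableAt (by simp)
    have h2 : DifferentiableAt ℝ (fun s => (AdL (g t) : E →L[ℝ] E).comp
        (AdL ((chartOne E U).symm (chartOne E U ((g t)⁻¹ * g s))))) t :=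
      (differentiableAt_const _).clm_comp (DifferentiableAt.comp
        (g := fun y : E => (AdL ((chartOne E U).symm y) : E →L[ℝ] E)) t h1 hg.2.differentiableAt)
    refine h2.congr_of_eventuallyEq ?_
    have h3 : ∀ᶠ s in 𝓝 t, (g t)⁻¹ * g s ∈ (chartOne E U).source := by
      have h4 : ContinuousAt (fun s => (g t)⁻¹ * g s) t :=
        (contMDiff_mul_left (I := 𝓘(ℝ, E)) (n := ∞)).continuous.continuousAt.comp hg.1
      refine h4 (chartOne_source_mem_nhds ?_)
      simp [one_mem_source]
    filter_upwards [h3] with s hs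
    rw [PartialEquiv.left_inv _ hs, ← AdL_mul, mul_inv_cancel_left]
  have h5 : deriv (fun s => (AdL (g s) : E →L[ℝ] E)) t = (AdL (g t)).comp (adL U v) := by
    ext w
    have h6 := hd.hasDerivAt.clm_apply (hasDerivAt_const t w)
    have h7 := h6.unique (hg.hasDerivAt_AdL w)
    simpa [adL_apply] using h7
  rw [← h5]
  exact hd.hasDerivAt

lemma HasLogDeriv.hasDerivAt_AdL_inv {g : ℝ → U} {t : ℝ} {v : E} (hg : HasLogDeriv g v t) :
    HasDerivAt (fun s => (AdL (g s)⁻¹ : E →L[ℝ] E)) (-(adL U v).comp (AdL (g t)⁻¹)) t := by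
  have h := hg.inv.hasDerivAt_AdL_clm
  have e : (AdL (g t)⁻¹).comp (adL U (-AdL (g t) v)) = -(adL U v).comp (AdL (g t)⁻¹) := by
    ext w
    simp only [ContinuousLinearMap.comp_apply, neg_apply, adL_apply]
    rw [AdL_br, map_neg, AdL_inv_apply, br_neg_left]
  rwa [e] at h

/-- `g` is the solution of `g⁻¹ g_x = u` with `g → 1` at `-∞`, for a rapidly decreasing `u`. -/
structure IsFrame (g : ℝ → U) (u : ℝ → E) : Prop where
  decaying : IsDecaying univ u
  log : ∀ x, HasLogDeriv g (u x) x
  lim : Tendsto g atBot (𝓝 1)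

namespace IsFrame

variable {g : ℝ → U} {u : ℝ → E}

lemma bddSmooth_AdL (h : IsFrame g u) (hinv : AdInvariant E U) :
    IsBddSmooth univ (fun x => (AdL (g x) : E →L[ℝ] E)) :=
  IsBddSmooth.of_linear ((ContinuousLinearMap.compL ℝ E E E).flip.comp (adL U)).flip
    h.decaying.isBddSmooth (fun x => (h.log x).hasDerivAt_AdL_clm) (fun _ => norm_AdL_le hinv _)

lemma bddSmooth_AdL_inv (h : IsFrame g u) (hinv : AdInvariant E U) :
    IsBddSmooth univ (fun x => (AdL (g x)⁻¹ : E →L[ℝ] E)) :=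
  IsBddSmooth.of_linear (-((ContinuousLinearMap.compL ℝ E E E).comp (adL U)).flip)
    h.decaying.isBddSmooth (fun x => (h.log x).hasDerivAt_AdL_inv) (fun _ => norm_AdL_le hinv _)

lemma tendsto_AdL (h : IsFrame g u) :
    Tendsto (fun x => (AdL (g x) : E →L[ℝ] E)) atBot (𝓝 (ContinuousLinearMap.id ℝ E)) := by
  have := (continuous_AdL (E := E) (U := U)).tendsto 1
  rw [AdL_one] at this
  exact this.comp h.lim

lemma tendsto_AdL_inv (h : IsFrame g u) :
    Tendsto (fun x => (AdL (g x)⁻¹ : E →L[ℝ] E)) atBot (𝓝 (ContinuousLinearMap.id ℝ E)) := by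
  have : IsTopologicalGroup U := topologicalGroup_of_lieGroup 𝓘(ℝ, E) ∞
  have := (continuous_AdL (E := E) (U := U)).tendsto (1 : U)⁻¹
  rw [inv_one, AdL_one] at this
  refine this.comp ?_
  simpa using h.lim.inv

variable {S : Set ℝ} {f : ℝ → E}

lemma tendsto_AdL_apply (h : IsFrame g u) {y : E} (hf : Tendsto f atBot (𝓝 y)) :
    Tendsto (fun x => AdL (g x) (f x)) atBot (𝓝 y) := by
  have h1 := (isBoundedBilinearMap_apply (𝕜 := ℝ) (E := E) (F := E)).continuous.tendsto
    (ContinuousLinearMap.id ℝ E, y)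
  exact h1.comp (h.tendsto_AdL.prodMk_nhds hf)

lemma tendsto_AdL_inv_apply (h : IsFrame g u) {y : E} (hf : Tendsto f atBot (𝓝 y)) :
    Tendsto (fun x => AdL (g x)⁻¹ (f x)) atBot (𝓝 y) := by
  have h1 := (isBoundedBilinearMap_apply (𝕜 := ℝ) (E := E) (F := E)).continuous.tendsto
    (ContinuousLinearMap.id ℝ E, y)
  exact h1.comp (h.tendsto_AdL_inv.prodMk_nhds hf)

lemma decaying_AdL (h : IsFrame g u) (hinv : AdInvariant E U) (hf : IsDecaying S f) :
    IsDecaying S (fun x => AdL (g x) (f x)) :=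
  (h.bddSmooth_AdL hinv).mono.bilin_decaying (ContinuousLinearMap.id ℝ (E →L[ℝ] E)) hf

lemma decaying_AdL_inv (h : IsFrame g u) (hinv : AdInvariant E U) (hf : IsDecaying S f) :
    IsDecaying S (fun x => AdL (g x)⁻¹ (f x)) :=
  (h.bddSmooth_AdL_inv hinv).mono.bilin_decaying (ContinuousLinearMap.id ℝ (E →L[ℝ] E)) hf

lemma contDiff_AdL (h : IsFrame g u) (hinv : AdInvariant E U) (hf : ContDiff ℝ ∞ f) :
    ContDiff ℝ ∞ (fun x => AdL (g x) (f x)) :=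
  (h.bddSmooth_AdL hinv).1.clm_apply hf

lemma contDiff_AdL_inv (h : IsFrame g u) (hinv : AdInvariant E U) (hf : ContDiff ℝ ∞ f) :
    ContDiff ℝ ∞ (fun x => AdL (g x)⁻¹ (f x)) :=
  (h.bddSmooth_AdL_inv hinv).1.clm_apply hf

/-- Differentiation of a vector given in the moving frame. -/
lemma hasDerivAt_AdL (h : IsFrame g u) {x : ℝ} {f' : E} (hf : HasDerivAt f f' x) :
    HasDerivAt (fun x => AdL (g x) (f x)) (AdL (g x) (f' + br U (u x) (f x))) x := by
  have h1 := (h.log x).hasDerivAt_AdL_clm.clm_apply hf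
  simp only [ContinuousLinearMap.comp_apply, adL_apply] at h1
  rwa [map_add, add_comm]

lemma hasDerivAt_AdL_inv (h : IsFrame g u) {x : ℝ} {f' : E} (hf : HasDerivAt f f' x) :
    HasDerivAt (fun x => AdL (g x)⁻¹ (f x))
      (AdL (g x)⁻¹ f' - br U (u x) (AdL (g x)⁻¹ (f x))) x := by
  have h1 := (h.log x).hasDerivAt_AdL_inv.clm_apply hf
  simp only [neg_apply, ContinuousLinearMap.comp_apply, adL_apply] at h1
  rwa [sub_eq_neg_add]

end IsFrame

lemma IsDecaying.br_left {S : Set ℝ} {f f' : ℝ → E} (hf : IsDecaying S f) (hf' : IsBddSmooth S f') :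
    IsDecaying S (fun x => br U (f x) (f' x)) :=
  hf.bilin_bddSmooth (adL U) hf'

lemma IsDecaying.br_right {S : Set ℝ} {f f' : ℝ → E} (hf : IsBddSmooth S f)
    (hf' : IsDecaying S f') : IsDecaying S (fun x => br U (f x) (f' x)) :=
  hf.bilin_decaying (adL U) hf'

lemma contDiff_br {f f' : ℝ → E} (hf : ContDiff ℝ ∞ f) (hf' : ContDiff ℝ ∞ f') :
    ContDiff ℝ ∞ (fun x => br U (f x) (f' x)) :=
  (adL U).isBoundedBilinearMap.contDiff.comp (hf.prodMk hf')

lemma hasDerivAt_br {f f' : ℝ → E} {x : ℝ} {d d' : E} (hf : HasDerivAt f d x)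
    (hf' : HasDerivAt f' d' x) :
    HasDerivAt (fun x => br U (f x) (f' x)) (br U (f x) d' + br U d (f' x)) x :=
  (adL U).hasDerivAt_of_bilinear (fun _ => hf) (fun _ => hf')

/-- A function with vanishing derivative equals its limit at `-∞`. -/
lemma eq_of_hasDerivAt_zero {F : Type*} [NormedAddCommGroup F] [NormedSpace ℝ F] {f : ℝ → F}
    {l : F} (hf : ∀ x, HasDerivAt f 0 x) (hl : Tendsto f atBot (𝓝 l)) (x : ℝ) : f x = l := by
  have h1 : ∀ y, f y = f x := fun y =>
    is_const_of_deriv_eq_zero (fun z => (hf z).differentiableAt) (fun z => (hf z).deriv) y x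
  have h2 : f = fun _ => f x := funext h1
  rw [h2] at hl
  exact tendsto_nhds_unique tendsto_const_nhds hl

lemma IsDevelopment.isFrame {a : E} {γ : ℝ → E} {g : ℝ → U} {u : 𝓢(ℝ, E)}
    (h : IsDevelopment a γ g u) : IsFrame g u where
  decaying := isDecaying_schwartz u
  log x := by
    rw [h.logDeriv x]
    exact hasLogDeriv_leftLogDeriv ((h.smooth x).mdifferentiableAt (by simp))
  lim := h.lim

lemma IsCurve.bddSmooth {a : E} {γ : ℝ → E} (hγ : IsCurve U a γ) : IsBddSmooth univ γ :=
  IsBddSmooth.of_tendsto hγ.smooth (isDecaying_of_schwartz hγ.schwartz) hγ.lim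

/-! ### The development map -/

open Polynomial in
lemma decaying_aeval_J {γ f : ℝ → E} (hγ : IsBddSmooth univ γ) (hf : IsDecaying univ f)
    (p : ℝ[X]) : IsDecaying univ (fun x => aeval (J U (γ x) : Module.End ℝ E) p (f x)) := by
  induction p using Polynomial.induction_on' with
  | add p q hp hq =>
    simp only [map_add, LinearMap.add_apply]
    exact hp.add hq
  | monomial n c =>
    have hn : IsDecaying univ (fun x => ((J U (γ x) : Module.End ℝ E) ^ n) (f x)) := by
      induction n with
      | zero => exact hf
      | succ n ih =>
        simp only [pow_succ', Module.End.mul_apply, J_apply]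
        exact ih.br_left hγ
    simp only [aeval_monomial, ← Algebra.smul_def, LinearMap.smul_apply]
    exact hn.clm (c • ContinuousLinearMap.id ℝ E)

open Polynomial in
/-- There is one polynomial `q` such that, on the whole orbit of `a`, `q(J_y)` inverts `J_y` on
its range, with values in the range. -/
lemma exists_polynomial_inverse_orbit (hinv : AdInvariant E U) (a : E) :
    ∃ q : ℝ[X], ∀ y ∈ orbit U a, ∀ z ∈ orbitTangent U y,
      J U y (aeval (J U y : Module.End ℝ E) q z) = z ∧
      aeval (J U y : Module.End ℝ E) q z ∈ orbitTangent U y := by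
  obtain ⟨q, hq⟩ := exists_polynomial_pseudoInverse hinv a
  refine ⟨X * (q * q), ?_⟩
  rintro y ⟨k, rfl⟩ _ ⟨z, rfl⟩
  set S : Module.End ℝ E := J U (Ad k a) with hS
  set T : Module.End ℝ E := J U a with hT
  have hsemi : S * (AdL k : E →L[ℝ] E).toLinearMap = (AdL k : E →L[ℝ] E).toLinearMap * T := by
    ext x
    exact (AdL_br k x a).symm
  have h1 := aeval_mul_of_semiconj hsemi (X * q * X - X)
  have h2 : S * aeval S q * S = S := by
    have h3 : aeval T (X * q * X - X) = 0 := by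
      rw [map_sub, map_mul, map_mul, aeval_X, hq, sub_self]
    rw [h3, mul_zero] at h1
    have h4 : aeval S (X * q * X - X) = 0 := by
      ext x
      have := DFunLike.congr_fun h1 (AdL k⁻¹ x)
      simpa [AdL_apply_inv] using this
    rwa [map_sub, map_mul, map_mul, aeval_X, sub_eq_zero] at h4
  refine ⟨?_, ?_⟩
  · have hc : S * aeval S q = aeval S q * S := by
      have : aeval S (X * q) = aeval S (q * X) := by rw [mul_comm]
      rwa [map_mul, map_mul, aeval_X] at this
    have h5 : S * (S * (aeval S q * aeval S q)) * S = S := by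
      calc S * (S * (aeval S q * aeval S q)) * S
          = S * (S * aeval S q) * aeval S q * S := by simp only [mul_assoc]
        _ = S * (aeval S q * S) * aeval S q * S := by rw [hc]
        _ = (S * aeval S q * S) * aeval S q * S := by simp only [mul_assoc]
        _ = S := by rw [h2, h2]
    have h6 := DFunLike.congr_fun h5 z
    rw [map_mul, map_mul, aeval_X]
    exact h6
  · rw [map_mul, map_mul, aeval_X]
    exact ⟨(aeval S q * aeval S q) (S z), rfl⟩

/-- A vector `ξ` orthogonal to the isotropy algebra of `y` is determined by `[ξ, y]`. -/
lemma eq_of_br_eq {y ξ ξ' : E} (h : ξ ∈ (isotropy U y)ᗮ) (h' : ξ' ∈ (isotropy U y)ᗮ)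
    (he : br U ξ y = br U ξ' y) : ξ = ξ' := by
  have h1 : ξ - ξ' ∈ isotropy U y ⊓ (isotropy U y)ᗮ := by
    refine ⟨?_, sub_mem h h'⟩
    rw [SetLike.mem_coe, mem_isotropy, br_sub_left, he, sub_self]
  rw [Submodule.inf_orthogonal_eq_bot] at h1
  exact sub_eq_zero.1 h1

/-- Every curve has a normalized frame.  The equation `[ξ, γ] = γ_x` has a unique solution `ξ` that
is orthogonal to the isotropy algebra of `γ`, a polynomial in `J_γ` applied to `γ_x`; the frame is
the solution of `g_x g⁻¹ = ξ`. -/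
lemma exists_isDevelopment [CompactSpace U] (hinv : AdInvariant E U) {a : E} {γ : ℝ → E}
    (hγ : IsCurve U a γ) : ∃ p : (ℝ → U) × 𝓢(ℝ, E), IsDevelopment a γ p.1 p.2 := by
  have : IsTopologicalGroup U := topologicalGroup_of_lieGroup 𝓘(ℝ, E) ∞
  obtain ⟨q, hq⟩ := exists_polynomial_inverse_orbit hinv a
  set ξ : ℝ → E := fun x => Polynomial.aeval (J U (γ x) : Module.End ℝ E) q (deriv γ x) with hξ
  have hξd : IsDecaying univ ξ :=
    decaying_aeval_J hγ.bddSmooth (isDecaying_of_schwartz hγ.schwartz) q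
  have hξγ : ∀ x, br U (ξ x) (γ x) = deriv γ x := fun x =>
    (hq _ (hγ.mem x) _ (hγ.deriv_mem x)).1
  have hξo : ∀ x, ξ x ∈ (isotropy U (γ x))ᗮ := fun x => by
    rw [← orbitTangent_eq hinv]
    exact (hq _ (hγ.mem x) _ (hγ.deriv_mem x)).2
  obtain ⟨φ, hφ⟩ := hξd.neg.exists_schwartz
  obtain ⟨k, -, hklim, hklog⟩ := exists_frame_of_schwartz hinv φ
  have hk : IsFrame k φ := ⟨isDecaying_schwartz φ, hklog, hklim⟩
  obtain ⟨u, hu⟩ := (hk.decaying_AdL hinv hξd).exists_schwartz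
  have hglog : ∀ x, HasLogDeriv (fun x => (k x)⁻¹) (u x) x := by
    intro x
    have h1 := (hklog x).inv
    rwa [hφ, map_neg, neg_neg, ← hu] at h1
  have hγk : ∀ x, AdL (k x) (γ x) = a := by
    intro x
    refine eq_of_hasDerivAt_zero (f := fun x => AdL (k x) (γ x)) (fun y => ?_) ?_ x
    · have h1 := hk.hasDerivAt_AdL (hγ.smooth.differentiable (by simp) y).hasDerivAt
      rwa [hφ, br_neg_left, hξγ, add_neg_cancel, map_zero] at h1
    · exact hk.tendsto_AdL_apply hγ.lim
  refine ⟨(fun x => (k x)⁻¹, u), ⟨contMDiff_of_hasLogDeriv (u.smooth ⊤) hglog, ?_, fun x => ?_,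
    fun x => ?_, fun x => ?_⟩⟩
  · simpa using hklim.inv
  · rw [← hγk x, ← AdL_apply, AdL_inv_apply]
  · exact (hglog x).leftLogDeriv_eq.symm
  · simp only [hu]
    rw [← hγk x]
    exact AdL_mem_isotropy_orthogonal hinv _ (hξo x)

/-- Two normalized frames of a curve have the same development and the same Adjoint action. -/
lemma IsDevelopment.unique (hinv : AdInvariant E U) {a : E} {γ : ℝ → E} {g g' : ℝ → U}
    {u u' : 𝓢(ℝ, E)} (h : IsDevelopment a γ g u) (h' : IsDevelopment a γ g' u') :
    u = u' ∧ ∀ x, (AdL (g x) : E →L[ℝ] E) = AdL (g' x) := by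
  have key : ∀ {g : ℝ → U} {u : 𝓢(ℝ, E)}, IsDevelopment a γ g u → ∀ x,
      AdL (g x) (u x) ∈ (isotropy U (γ x))ᗮ ∧ br U (AdL (g x) (u x)) (γ x) = deriv γ x := by
    intro g u h x
    have e : γ x = AdL (g x) a := h.curve x
    refine ⟨?_, ?_⟩
    · rw [e]; exact AdL_mem_isotropy_orthogonal hinv _ (h.mem x)
    · have e2 : γ = fun x => AdL (g x) a := funext h.curve
      have h1 := ((h.isFrame.log x).hasDerivAt_AdL a).deriv
      rw [e, e2, h1, AdL_br]
  have hξ : ∀ x, AdL (g x) (u x) = AdL (g' x) (u' x) := fun x =>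
    eq_of_br_eq (key h x).1 (key h' x).1 ((key h x).2.trans (key h' x).2.symm)
  have hA : ∀ x, (AdL (g x) : E →L[ℝ] E) = AdL (g' x) := by
    intro x
    ext w
    have h1 : AdL (g x)⁻¹ (AdL (g' x) w) = w := by
      refine eq_of_hasDerivAt_zero (f := fun x => AdL (g x)⁻¹ (AdL (g' x) w)) (fun y => ?_)
        (h.isFrame.tendsto_AdL_inv_apply (h'.isFrame.tendsto_AdL_apply tendsto_const_nhds)) x
      have h2 := h.isFrame.hasDerivAt_AdL_inv ((h'.isFrame.log y).hasDerivAt_AdL w)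
      rwa [AdL_br (g' y), ← hξ y, AdL_br, AdL_inv_apply, sub_self] at h2
    rw [← h1, AdL_apply_inv, h1]
  refine ⟨?_, hA⟩
  ext x
  have h1 := congrArg (AdL (g x)⁻¹) (hξ x)
  rwa [← hA x, AdL_inv_apply, AdL_inv_apply] at h1

lemma isDevelopment_frame [CompactSpace U] (hinv : AdInvariant E U) {a : E} {γ : ℝ → E}
    (hγ : IsCurve U a γ) : IsDevelopment a γ (frame U a γ) (Φ U a γ) := by
  have h := exists_isDevelopment hinv hγ
  rw [frame, Φ, dif_pos h, dif_pos h]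
  exact h.choose_spec

lemma IsDevelopment.isCurve (hinv : AdInvariant E U) {a : E} {γ : ℝ → E} {g : ℝ → U} {u : 𝓢(ℝ, E)}
    (h : IsDevelopment a γ g u) : IsCurve U a γ := by
  have hF := h.isFrame
  have e : γ = fun x => AdL (g x) a := funext h.curve
  have hd : ∀ x, HasDerivAt γ (AdL (g x) (br U (u x) a)) x := fun x => by
    rw [e]; exact (hF.log x).hasDerivAt_AdL a
  refine ⟨?_, fun x => ⟨g x, (h.curve x).symm⟩, fun x => ?_, ?_, ?_⟩
  · rw [e]; exact hF.contDiff_AdL hinv contDiff_const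
  · rw [(hd x).deriv, h.curve x, AdL_br]
    exact ⟨_, rfl⟩
  · rw [e]; exact hF.tendsto_AdL_apply tendsto_const_nhds
  · have h1 : deriv γ = fun x => AdL (g x) (br U (u x) a) := funext fun x => (hd x).deriv
    rw [h1]
    exact (hF.decaying_AdL hinv (hF.decaying.br_left (IsBddSmooth.const a))).exists_schwartz

end Frames

/-! ### Primitives and limits of Schwartz functions -/

section Primitives

variable {F : Type*} [NormedAddCommGroup F] [NormedSpace ℝ F] [CompleteSpace F] {f : ℝ → F}

namespace IsDecaying

lemma hasDerivAt_primitive (hf : IsDecaying (Iic 0) f) (x : ℝ) :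
    HasDerivAt (fun x => ∫ s in Iic x, f s) (f x) x :=
  hasDerivAt_integral_Iic hf.1.continuous hf.integrableOn_Iic x

lemma contDiff_primitive (hf : IsDecaying (Iic 0) f) :
    ContDiff ℝ ∞ (fun x => ∫ s in Iic x, f s) := by
  refine contDiff_infty_iff_deriv.2 ⟨fun x => (hf.hasDerivAt_primitive x).differentiableAt, ?_⟩
  rw [funext fun x => (hf.hasDerivAt_primitive x).deriv]
  exact hf.1

lemma tendsto_primitive (_hf : IsDecaying (Iic 0) f) :
    Tendsto (fun x => ∫ s in Iic x, f s) atBot (𝓝 0) :=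
  tendsto_integral_Iic_zero tendsto_id

lemma primitive (hf : IsDecaying (Iic 0) f) : IsDecaying (Iic 0) (fun x => ∫ s in Iic x, f s) := by
  refine of_tendsto hf.contDiff_primitive ?_ hf.tendsto_primitive
  rw [funext fun x => (hf.hasDerivAt_primitive x).deriv]
  exact hf

lemma bddSmooth_primitive (hf : IsDecaying univ f) :
    IsBddSmooth univ (fun x => ∫ s in Iic x, f s) := by
  refine IsBddSmooth.of_tendsto hf.mono.contDiff_primitive ?_ hf.mono.tendsto_primitive
  rw [funext fun x => (hf.mono.hasDerivAt_primitive x).deriv]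
  exact hf

end IsDecaying

lemma tendsto_schwartz_apply {ι : Type*} {l : Filter ι} {δ : ι → 𝓢(ℝ, F)} {v : 𝓢(ℝ, F)}
    (h : Tendsto δ l (𝓝 v)) (x : ℝ) : Tendsto (fun s => δ s x) l (𝓝 (v x)) := by
  have h1 : Continuous (SchwartzMap.seminorm ℝ 0 0 : Seminorm ℝ 𝓢(ℝ, F)) :=
    (schwartz_withSeminorms ℝ ℝ F).continuous_seminorm (0, 0)
  have h2 : Tendsto (fun s => SchwartzMap.seminorm ℝ 0 0 (δ s - v)) l (𝓝 0) := by
    have := (h1.tendsto (v - v)).comp (h.sub_const v)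
    simpa [Function.comp_def] using this
  rw [tendsto_iff_norm_sub_tendsto_zero]
  exact squeeze_zero (fun _ => norm_nonneg _)
    (fun s => (δ s - v).norm_le_seminorm ℝ x) h2

lemma eventually_norm_schwartz_le {ι : Type*} {l : Filter ι} {δ : ι → 𝓢(ℝ, F)} {v : 𝓢(ℝ, F)}
    (h : Tendsto δ l (𝓝 v)) :
    ∃ C : ℝ, 0 ≤ C ∧ ∀ᶠ s in l, ∀ x, ‖δ s x‖ ≤ C * (1 + x ^ 2)⁻¹ := by
  have h1 : ∀ k, ∀ᶠ s in l, SchwartzMap.seminorm ℝ k 0 (δ s) < SchwartzMap.seminorm ℝ k 0 v + 1 := by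
    intro k
    have hc : Continuous (SchwartzMap.seminorm ℝ k 0 : Seminorm ℝ 𝓢(ℝ, F)) :=
      (schwartz_withSeminorms ℝ ℝ F).continuous_seminorm (k, 0)
    exact ((hc.tendsto v).comp h).eventually (gt_mem_nhds (lt_add_one _))
  refine ⟨(SchwartzMap.seminorm ℝ 0 0 v + 1) + (SchwartzMap.seminorm ℝ 2 0 v + 1), by positivity, ?_⟩
  filter_upwards [h1 0, h1 2] with s h0 h2 x
  have a := (δ s).norm_le_seminorm ℝ x
  have b := (δ s).norm_pow_mul_le_seminorm ℝ 2 x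
  rw [Real.norm_eq_abs, sq_abs] at b
  rw [← div_eq_mul_inv, le_div_iff₀ (by positivity)]
  linarith

end Primitives

/-! ### The differential of the development map -/

section DerivativeOfDevelopment

variable {E U : Type*} [NormedAddCommGroup E] [InnerProductSpace ℝ E] [FiniteDimensional ℝ E]
  [TopologicalSpace U] [ChartedSpace E U] [Group U] [LieGroup 𝓘(ℝ, E) ∞ U]

lemma tendsto_br {ι : Type*} {l : Filter ι} {f f' : ι → E} {y y' : E} (hf : Tendsto f l (𝓝 y))
    (hf' : Tendsto f' l (𝓝 y')) : Tendsto (fun i => br U (f i) (f' i)) l (𝓝 (br U y y')) := by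
  have h1 : Continuous fun p : E × E => br U p.1 p.2 := by
    have h2 : Continuous fun p : E × E => adL U p.1 p.2 := by fun_prop
    exact h2
  have h2 : Tendsto (fun p : E × E => br U p.1 p.2) (𝓝 (y, y')) (𝓝 (br U y y')) :=
    h1.continuousAt
  exact Tendsto.comp (g := fun p : E × E => br U p.1 p.2) (f := fun i => (f i, f' i)) h2
    (hf.prodMk_nhds hf')

/-- Variation of constants: the difference of two frames in terms of their developments. -/
lemma IsFrame.AdL_sub (hinv : AdInvariant E U) {g g' : ℝ → U} {u u' : 𝓢(ℝ, E)} (h : IsFrame g u)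
    (h' : IsFrame g' u') (w : E) (x : ℝ) :
    AdL (g' x) (AdL (g x)⁻¹ w) - w =
      ∫ y in Iic x, AdL (g' y) (br U ((u' - u) y) (AdL (g y)⁻¹ w)) := by
  have hd : ∀ y, HasDerivAt (fun y => AdL (g' y) (AdL (g y)⁻¹ w))
      (AdL (g' y) (br U ((u' - u) y) (AdL (g y)⁻¹ w))) y := by
    intro y
    have h1 := h'.hasDerivAt_AdL (h.hasDerivAt_AdL_inv (hasDerivAt_const y w))
    rw [map_zero, zero_sub, neg_add_eq_sub, ← br_sub_left] at h1
    exact h1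
  have hdec : IsDecaying univ fun y => AdL (g' y) (br U ((u' - u) y) (AdL (g y)⁻¹ w)) :=
    h'.decaying_AdL hinv ((isDecaying_schwartz (u' - u)).br_left
      ((h.bddSmooth_AdL_inv hinv).bilin (ContinuousLinearMap.id ℝ (E →L[ℝ] E))
        (IsBddSmooth.const w)))
  exact (integral_Iic_of_hasDerivAt_of_tendsto (hd x).continuousAt.continuousWithinAt
    (fun y _ => hd y) (hdec.mono.integrableOn_Iic x)
    (h'.tendsto_AdL_apply (h.tendsto_AdL_inv_apply tendsto_const_nhds))).symm

/-- The derivative of a family of frames in terms of the derivative `v` of the developments. -/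
lemma hasDerivAt_AdL_family (hinv : AdInvariant E U) {g : ℝ → ℝ → U} {u : ℝ → 𝓢(ℝ, E)}
    {v : 𝓢(ℝ, E)} (h : ∀ s, IsFrame (g s) (u s))
    (hv : Tendsto (fun s : ℝ => s⁻¹ • (u s - u 0)) (𝓝[≠] 0) (𝓝 v)) (a : E) (x : ℝ) :
    HasDerivAt (fun s => AdL (g s x) a)
      (br U (∫ y in Iic x, AdL (g 0 y) (v y)) (AdL (g 0 x) a)) 0 := by
  set δ : ℝ → 𝓢(ℝ, E) := fun s => s⁻¹ • (u s - u 0) with hδ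
  obtain ⟨C, hC0, hC⟩ := eventually_norm_schwartz_le hv
  set c : ℝ := ‖(adL U : E →L[ℝ] E →L[ℝ] E)‖
  have hnorm : ∀ (k : U) (z : E), ‖AdL k z‖ = ‖z‖ := norm_AdL hinv
  have hbr : ∀ y z : E, ‖br U y z‖ ≤ c * ‖y‖ * ‖z‖ := fun y z => (adL U).le_opNorm₂ y z
  have hint : Integrable (fun y : ℝ => (1 + y ^ 2)⁻¹) := integrable_inv_one_add_sq
  have key : ∀ s ≠ 0, ∀ (w : E) (x : ℝ), AdL (g s x) (AdL (g 0 x)⁻¹ w) - w =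
      s • ∫ y in Iic x, AdL (g s y) (br U (δ s y) (AdL (g 0 y)⁻¹ w)) := by
    intro s hs w x
    rw [(h 0).AdL_sub hinv (h s), ← integral_smul]
    refine integral_congr_ae (Eventually.of_forall fun y => ?_)
    simp only [hδ, smul_apply]
    rw [← map_smul, ← br_smul_left, smul_inv_smul₀ hs]
  have hbound : ∀ w : E, ∀ᶠ s in 𝓝[≠] (0 : ℝ), ∀ y,
      ‖AdL (g s y) (br U (δ s y) (AdL (g 0 y)⁻¹ w))‖ ≤ c * C * ‖w‖ * (1 + y ^ 2)⁻¹ := by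
    intro w
    filter_upwards [hC] with s hs y
    rw [hnorm]
    refine (hbr _ _).trans ?_
    rw [hnorm]
    calc _ ≤ c * (C * (1 + y ^ 2)⁻¹) * ‖w‖ := by gcongr; exact hs y
      _ = _ := by ring
  -- the frames converge pointwise
  have hpt : ∀ (x : ℝ) (w : E), Tendsto (fun s => AdL (g s x) (AdL (g 0 x)⁻¹ w)) (𝓝[≠] 0) (𝓝 w) := by
    intro x w
    rw [tendsto_iff_norm_sub_tendsto_zero]
    have h0 : Tendsto (fun s : ℝ => ‖s‖ * ∫ y in Iic x, c * C * ‖w‖ * (1 + y ^ 2)⁻¹)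
        (𝓝[≠] 0) (𝓝 0) := by
      have : Tendsto (fun s : ℝ => ‖s‖) (𝓝[≠] 0) (𝓝 0) :=
        tendsto_norm_zero.mono_left nhdsWithin_le_nhds
      simpa using this.mul_const (∫ y in Iic x, c * C * ‖w‖ * (1 + y ^ 2)⁻¹)
    refine squeeze_zero' (Eventually.of_forall fun _ => norm_nonneg _) ?_ h0
    filter_upwards [hbound w, self_mem_nhdsWithin] with s hs hs0
    rw [key s hs0, norm_smul]
    gcongr
    exact norm_integral_le_of_norm_le (hint.const_mul _).integrableOn (Eventually.of_forall hs)
  have hpt' : ∀ x, ∀ {z : ℝ → E} {z₀ : E}, Tendsto z (𝓝[≠] 0) (𝓝 z₀) →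
      Tendsto (fun s => AdL (g s x) (z s)) (𝓝[≠] 0) (𝓝 (AdL (g 0 x) z₀)) := by
    intro x z z₀ hz
    have h1 := hpt x (AdL (g 0 x) z₀)
    simp only [AdL_inv_apply] at h1
    rw [tendsto_iff_norm_sub_tendsto_zero] at h1 hz ⊢
    refine squeeze_zero (fun _ => norm_nonneg _) (fun s => ?_) (by simpa using hz.add h1)
    calc ‖AdL (g s x) (z s) - AdL (g 0 x) z₀‖
        = ‖AdL (g s x) (z s - z₀) + (AdL (g s x) z₀ - AdL (g 0 x) z₀)‖ := by
          rw [map_sub]; congr 1; abel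
      _ ≤ _ := (norm_add_le _ _).trans_eq (by rw [hnorm])
  rw [hasDerivAt_iff_tendsto_slope_zero]
  set w : E := AdL (g 0 x) a with hw
  have hlim : Tendsto (fun s => ∫ y in Iic x, AdL (g s y) (br U (δ s y) (AdL (g 0 y)⁻¹ w)))
      (𝓝[≠] 0) (𝓝 (∫ y in Iic x, AdL (g 0 y) (br U (v y) (AdL (g 0 y)⁻¹ w)))) := by
    refine tendsto_integral_filter_of_dominated_convergence
      (fun y => c * C * ‖w‖ * (1 + y ^ 2)⁻¹) ?_
      ((hbound w).mono fun s hs => Eventually.of_forall hs) (hint.const_mul _).integrableOn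
      (Eventually.of_forall fun y => ?_)
    · refine Eventually.of_forall fun s => Continuous.aestronglyMeasurable ?_
      exact ((h s).contDiff_AdL hinv (contDiff_br ((δ s).smooth ⊤)
        ((h 0).contDiff_AdL_inv hinv contDiff_const))).continuous
    · refine hpt' y ?_
      exact ((adL U).flip (AdL (g 0 y)⁻¹ w)).continuous.tendsto _ |>.comp
        (tendsto_schwartz_apply hv y)
  have e : br U (∫ y in Iic x, AdL (g 0 y) (v y)) w =
      ∫ y in Iic x, AdL (g 0 y) (br U (v y) (AdL (g 0 y)⁻¹ w)) := by
    have h1 := ((adL U).flip w).integral_comp_comm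
      (((h 0).decaying_AdL hinv (isDecaying_schwartz v)).mono.integrableOn_Iic x)
    refine h1.symm.trans (integral_congr_ae (Eventually.of_forall fun y => ?_))
    simp only [ContinuousLinearMap.flip_apply, adL_apply]
    rw [AdL_br, AdL_apply_inv]
  rw [e]
  refine hlim.congr' ?_
  filter_upwards [self_mem_nhdsWithin] with s hs
  have h1 := key s hs w x
  rw [hw, AdL_inv_apply, ← hw] at h1
  rw [zero_add, h1, inv_smul_smul₀ hs]

/-- The differential of the development map, inverted: `dΦ_γ(X) = v` gives
`X = [∫_{-∞}^x g v g⁻¹, γ]`. -/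
lemma HasDevDeriv.eq_br [CompactSpace U] (hinv : AdInvariant E U) {a : E} {γ X : ℝ → E}
    {v : 𝓢(ℝ, E)} (h : HasDevDeriv U a γ X v) (x : ℝ) :
    X x = br U (∫ y in Iic x, AdL (frame U a γ y) (v y)) (γ x) := by
  obtain ⟨-, Γ, rfl, hΓ, hX, hv⟩ := h
  have hD := fun s => isDevelopment_frame hinv (hΓ s)
  have h1 := hasDerivAt_AdL_family hinv (g := fun s => frame U a (Γ s))
    (u := fun s => Φ U a (Γ s)) (fun s => (hD s).isFrame) hv a x
  have h2 : (fun s => AdL (frame U a (Γ s) x) a) = fun s => Γ s x :=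
    funext fun s => ((hD s).curve x).symm
  have h3 : AdL (frame U a (Γ 0) x) a = Γ 0 x := ((hD 0).curve x).symm
  rw [h2, h3] at h1
  exact (hX x).unique h1

lemma HasDevDeriv.mem [CompactSpace U] (hinv : AdInvariant E U) {a : E} {γ X : ℝ → E}
    {v : 𝓢(ℝ, E)} (h : HasDevDeriv U a γ X v) (x : ℝ) : v x ∈ (isotropy U a)ᗮ := by
  obtain ⟨-, Γ, rfl, hΓ, -, hv⟩ := h
  refine (isotropy U a).isClosed_orthogonal.mem_of_tendsto (tendsto_schwartz_apply hv x)
    (Eventually.of_forall fun s => ?_)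
  exact Submodule.smul_mem _ _ (Submodule.sub_mem _ ((isDevelopment_frame hinv (hΓ s)).mem x)
    ((isDevelopment_frame hinv (hΓ 0)).mem x))

/-- Every rapidly decreasing curve in `𝒰_a^⊥` is in the image of `dΦ_γ`. -/
lemma hasDevDeriv_of_mem [CompactSpace U] (hinv : AdInvariant E U) {a : E} {γ : ℝ → E}
    (hγ : IsCurve U a γ) {v : 𝓢(ℝ, E)} (hv : ∀ x, v x ∈ (isotropy U a)ᗮ) :
    HasDevDeriv U a γ (fun x => br U (∫ y in Iic x, AdL (frame U a γ y) (v y)) (γ x)) v := by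
  have hD := isDevelopment_frame hinv hγ
  have hA := hD.isFrame.decaying_AdL hinv (isDecaying_schwartz v)
  have hζ := hA.bddSmooth_primitive
  have hγb := hγ.bddSmooth
  refine ⟨⟨contDiff_br hζ.1 hγ.smooth, fun x => ⟨_, rfl⟩, ?_, ?_⟩, ?_⟩
  · simpa only [br_zero_left] using tendsto_br (U := U) hA.mono.tendsto_primitive hγ.lim
  · refine IsDecaying.exists_schwartz ?_
    rw [funext fun x => (hasDerivAt_br (U := U) (hA.mono.hasDerivAt_primitive x)
      (hγ.smooth.differentiable (by simp) x).hasDerivAt).deriv]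
    exact (IsDecaying.br_right hζ (isDecaying_of_schwartz hγ.schwartz)).add (hA.br_left hγb)
  have hex : ∀ s : ℝ, ∃ g : ℝ → U, (s = 0 → g = frame U a γ) ∧
      ContMDiff 𝓘(ℝ, ℝ) 𝓘(ℝ, E) ∞ g ∧ Tendsto g atBot (𝓝 1) ∧
      ∀ x, HasLogDeriv g ((Φ U a γ + s • v) x) x := by
    intro s
    rcases eq_or_ne s 0 with rfl | hs
    · refine ⟨_, fun _ => rfl, hD.smooth, hD.lim, ?_⟩
      simpa using hD.isFrame.log
    · obtain ⟨g, hg⟩ := exists_frame_of_schwartz hinv (Φ U a γ + s • v)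
      exact ⟨g, fun h => absurd h hs, hg⟩
  choose g hg0 hgs hgl hgd using hex
  set Γ : ℝ → ℝ → E := fun s x => AdL (g s x) a with hΓ
  have hdev : ∀ s, IsDevelopment a (Γ s) (g s) (Φ U a γ + s • v) := fun s =>
    ⟨hgs s, hgl s, fun x => rfl, fun x => (hgd s x).leftLogDeriv_eq.symm,
      fun x => Submodule.add_mem _ (hD.mem x) (Submodule.smul_mem _ _ (hv x))⟩
  have hΓ0 : Γ 0 = γ := by
    funext x
    simp only [hΓ, hg0 0 rfl]
    exact (hD.curve x).symm
  have hcurve := fun s => (hdev s).isCurve hinv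
  have hΦ : ∀ s, Φ U a (Γ s) = Φ U a γ + s • v := fun s =>
    ((isDevelopment_frame hinv (hcurve s)).unique hinv (hdev s)).1
  have hlim : Tendsto (fun s : ℝ => s⁻¹ • ((Φ U a γ + s • v) - (Φ U a γ + (0 : ℝ) • v)))
      (𝓝[≠] 0) (𝓝 v) := by
    refine tendsto_const_nhds.congr' ?_
    filter_upwards [self_mem_nhdsWithin] with s hs
    rw [zero_smul, add_zero, add_sub_cancel_left, inv_smul_smul₀ hs]
  refine ⟨Γ, hΓ0, hcurve, fun x => ?_, ?_⟩
  · have h1 := hasDerivAt_AdL_family hinv (fun s => (hdev s).isFrame) hlim a x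
    rw [hg0 0 rfl] at h1
    have h2 : γ x = AdL (frame U a γ x) a := hD.curve x
    simpa only [h2] using h1
  · refine hlim.congr fun s => ?_
    rw [hΦ s, zero_smul, add_zero]

end DerivativeOfDevelopment

/-! ### The operators `J_a⁻¹` and `P_u` -/

section PoissonOperator

variable {E U : Type*} [NormedAddCommGroup E] [InnerProductSpace ℝ E] [FiniteDimensional ℝ E]
  [TopologicalSpace U] [ChartedSpace E U] [Group U] [LieGroup 𝓘(ℝ, E) ∞ U]

lemma proj₀_mem (a x : E) : proj₀ U a x ∈ isotropy U a :=
  (isotropy U a).starProjection_apply_mem x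

lemma proj₁_mem (a x : E) : proj₁ U a x ∈ (isotropy U a)ᗮ :=
  (isotropy U a)ᗮ.starProjection_apply_mem x

lemma proj₀_add_proj₁ (a x : E) : proj₀ U a x + proj₁ U a x = x :=
  (isotropy U a).starProjection_add_starProjection_orthogonal x

lemma proj₁_add (a x y : E) : proj₁ U a (x + y) = proj₁ U a x + proj₁ U a y := map_add _ x y

lemma proj₀_add (a x y : E) : proj₀ U a (x + y) = proj₀ U a x + proj₀ U a y := map_add _ x y

lemma proj₁_neg (a x : E) : proj₁ U a (-x) = -proj₁ U a x := map_neg _ x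

lemma proj₀_neg (a x : E) : proj₀ U a (-x) = -proj₀ U a x := map_neg _ x

lemma proj₁_of_mem {a x : E} (h : x ∈ (isotropy U a)ᗮ) : proj₁ U a x = x :=
  Submodule.starProjection_eq_self_iff.2 h

lemma proj₀_of_mem {a x : E} (h : x ∈ isotropy U a) : proj₀ U a x = x :=
  Submodule.starProjection_eq_self_iff.2 h

lemma proj₁_of_mem_isotropy {a x : E} (h : x ∈ isotropy U a) : proj₁ U a x = 0 := by
  simpa [proj₀_of_mem h] using proj₀_add_proj₁ (U := U) a x

lemma proj₀_of_mem_orthogonal {a x : E} (h : x ∈ (isotropy U a)ᗮ) : proj₀ U a x = 0 := by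
  simpa [proj₁_of_mem h] using proj₀_add_proj₁ (U := U) a x

lemma br_proj₁ (a x : E) : br U (proj₁ U a x) a = br U x a := by
  conv_rhs => rw [← proj₀_add_proj₁ (U := U) a x, br_add_left, mem_isotropy.1 (proj₀_mem a x), zero_add]

lemma inner_proj₁_left {a x y : E} (hy : y ∈ (isotropy U a)ᗮ) : ⟪proj₁ U a x, y⟫ = ⟪x, y⟫ := by
  conv_rhs => rw [← proj₀_add_proj₁ (U := U) a x, inner_add_left,
    Submodule.inner_right_of_mem_orthogonal (proj₀_mem a x) hy, zero_add]

lemma JInv_br {a z : E} (hz : z ∈ (isotropy U a)ᗮ) : JInv U a (br U z a) = z := by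
  have h : ∃ z' ∈ (isotropy U a)ᗮ, J U a z' = br U z a := ⟨z, hz, rfl⟩
  rw [JInv, dif_pos h]
  exact eq_of_br_eq h.choose_spec.1 hz h.choose_spec.2

/-- On `𝒰_a^⊥`, the inverse of `J_a` is a linear map. -/
lemma exists_clm_JInv (hinv : AdInvariant E U) (a : E) :
    ∃ R : E →L[ℝ] E, ∀ y ∈ (isotropy U a)ᗮ,
      R y = JInv U a y ∧ R y ∈ (isotropy U a)ᗮ ∧ br U (R y) a = y := by
  obtain ⟨q, hq⟩ := exists_polynomial_inverse_orbit (U := U) hinv a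
  have ha : a ∈ orbit U a := ⟨1, by rw [← AdL_apply, AdL_one]; rfl⟩
  refine ⟨LinearMap.toContinuousLinearMap (Polynomial.aeval (J U a : Module.End ℝ E) q),
    fun y hy => ?_⟩
  rw [← orbitTangent_eq hinv] at hy ⊢
  obtain ⟨h1, h2⟩ := hq a ha y hy
  refine ⟨?_, h2, h1⟩
  rw [orbitTangent_eq hinv] at h2
  have h3 := JInv_br h2
  rw [← J_apply, h1] at h3
  exact h3.symm

lemma integral_proj₀_mem {a : E} {f : ℝ → E} (hf : IsDecaying (Iic 0) f) (x : ℝ) :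
    ∫ s in Iic x, proj₀ U a (f s) ∈ isotropy U a := by
  have h : ∫ s in Iic x, proj₀ U a (f s) = proj₀ U a (∫ s in Iic x, f s) :=
    (isotropy U a).starProjection.integral_comp_comm (hf.integrableOn_Iic x)
  rw [h]
  exact proj₀_mem _ _

/-- If `W_x + [u, W] = z` with `z` in `𝒰_a^⊥` and `W → l` at `-∞`, then
`P_u(π₁ W) = z - [u, π₀ l]`: the nonlocal term of `P_u` recovers `π₀ W` up to its limit. -/
lemma P_proj₁ (hinv : AdInvariant E U) {a l : E} {u W z : ℝ → E} (hu : IsDecaying (Iic 0) u)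
    (huN : ∀ x, u x ∈ (isotropy U a)ᗮ) (hW : IsBddSmooth (Iic 0) W)
    (hd : ∀ x, HasDerivAt W (z x - br U (u x) (W x)) x) (hz : ∀ x, z x ∈ (isotropy U a)ᗮ)
    (hl : Tendsto W atBot (𝓝 l)) (x : ℝ) :
    P U a u (fun x => proj₁ U a (W x)) x = z x - br U (u x) (proj₀ U a l) := by
  have hmem : ∀ x, br U (u x) (proj₀ U a (W x)) ∈ (isotropy U a)ᗮ := fun x => by
    rw [br_skew]
    exact neg_mem (br_mem_isotropy_orthogonal hinv (proj₀_mem _ _) (huN x))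
  have hsplit : ∀ x, br U (u x) (W x) =
      br U (u x) (proj₀ U a (W x)) + br U (u x) (proj₁ U a (W x)) := fun x => by
    rw [← br_add_right, proj₀_add_proj₁]
  have h0 : ∀ x, HasDerivAt (fun x => proj₀ U a (W x))
      (-proj₀ U a (br U (u x) (proj₁ U a (W x)))) x := fun x => by
    have h := (isotropy U a).starProjection.hasFDerivAt.comp_hasDerivAt x (hd x)
    have e : (isotropy U a).starProjection (z x - br U (u x) (W x)) =
        -proj₀ U a (br U (u x) (proj₁ U a (W x))) := by
      change proj₀ U a (z x - br U (u x) (W x)) = _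
      rw [sub_eq_add_neg, proj₀_add, proj₀_of_mem_orthogonal (hz x), zero_add, proj₀_neg, hsplit,
        proj₀_add, proj₀_of_mem_orthogonal (hmem x), zero_add]
    rw [e] at h
    exact h
  have h1 : HasDerivAt (fun x => proj₁ U a (W x))
      (z x - br U (u x) (proj₀ U a (W x)) - proj₁ U a (br U (u x) (proj₁ U a (W x)))) x := by
    have h := (isotropy U a)ᗮ.starProjection.hasFDerivAt.comp_hasDerivAt x (hd x)
    have e : (isotropy U a)ᗮ.starProjection (z x - br U (u x) (W x)) =
        z x - br U (u x) (proj₀ U a (W x)) - proj₁ U a (br U (u x) (proj₁ U a (W x))) := by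
      change proj₁ U a (z x - br U (u x) (W x)) = _
      rw [sub_eq_add_neg, proj₁_add, proj₁_of_mem (hz x), proj₁_neg, hsplit, proj₁_add,
        proj₁_of_mem (hmem x)]
      abel
    rw [e] at h
    exact h
  have hdec : IsDecaying (Iic 0) fun x => proj₀ U a (br U (u x) (proj₁ U a (W x))) :=
    (hu.br_left (hW.clm (isotropy U a)ᗮ.starProjection)).clm (isotropy U a).starProjection
  have hint : -∫ s in Iic x, proj₀ U a (br U (u s) (proj₁ U a (W s))) =
      proj₀ U a (W x) - proj₀ U a l := by
    rw [← integral_neg]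
    exact integral_Iic_of_hasDerivAt_of_tendsto (h0 x).continuousAt.continuousWithinAt
      (fun y _ => h0 y) (hdec.neg.integrableOn_Iic x)
      (((isotropy U a).starProjection.continuous.tendsto l).comp hl)
  rw [P, hint, h1.deriv, br_sub_right]
  abel

/-- If `Z₁` lies in `𝒰_a^⊥`, then `Z = Z₁ + h`, with `h` the nonlocal term of `P_u(Z₁)`, solves
`Z_x + [u, Z] = P_u(Z₁)`. In the moving frame, `g Z g⁻¹` is the antiderivative of `g P_u(Z₁) g⁻¹`. -/
lemma AdL_eq_integral_P (hinv : AdInvariant E U) {a : E} {g : ℝ → U} {u Z₁ : ℝ → E}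
    (hF : IsFrame g u) (hZ : IsDecaying univ Z₁) :
    IsDecaying univ (P U a u Z₁) ∧ ∀ x, ∫ y in Iic x, AdL (g y) (P U a u Z₁ y) =
      AdL (g x) (Z₁ x + -∫ s in Iic x, proj₀ U a (br U (u s) (Z₁ s))) := by
  have hbr : IsDecaying univ fun x => br U (u x) (Z₁ x) := hF.decaying.br_left hZ.isBddSmooth
  have h0 : IsDecaying univ fun x => proj₀ U a (br U (u x) (Z₁ x)) :=
    hbr.clm (isotropy U a).starProjection
  have hh : IsBddSmooth univ fun x => -∫ s in Iic x, proj₀ U a (br U (u s) (Z₁ s)) :=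
    h0.bddSmooth_primitive.clm (-ContinuousLinearMap.id ℝ E)
  have hP : IsDecaying univ (P U a u Z₁) :=
    (hZ.deriv.add (hbr.clm (isotropy U a)ᗮ.starProjection)).add (hF.decaying.br_left hh)
  refine ⟨hP, fun x => ?_⟩
  have hd : ∀ x, HasDerivAt
      (fun x => AdL (g x) (Z₁ x + -∫ s in Iic x, proj₀ U a (br U (u s) (Z₁ s))))
      (AdL (g x) (P U a u Z₁ x)) x := by
    intro x
    have h1 := hF.hasDerivAt_AdL (((hZ.1.differentiable (by simp) x).hasDerivAt).add
      (h0.mono.hasDerivAt_primitive x).neg)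
    have e : deriv Z₁ x + -proj₀ U a (br U (u x) (Z₁ x)) +
        br U (u x) (Z₁ x + -∫ s in Iic x, proj₀ U a (br U (u s) (Z₁ s))) = P U a u Z₁ x := by
      rw [P, br_add_right]
      have := proj₀_add_proj₁ (U := U) a (br U (u x) (Z₁ x))
      nth_rw 2 [← this]
      abel
    rw [← e]
    exact h1
  have hlim : Tendsto (fun x => Z₁ x + -∫ s in Iic x, proj₀ U a (br U (u s) (Z₁ s))) atBot
      (𝓝 0) := by
    simpa using hZ.mono.tendsto_atBot.add h0.mono.tendsto_primitive.neg
  have h2 := integral_Iic_of_hasDerivAt_of_tendsto (hd x).continuousAt.continuousWithinAt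
    (fun y _ => hd y) ((hF.decaying_AdL hinv hP).mono.integrableOn_Iic x)
    (hF.tendsto_AdL_apply hlim)
  rw [h2, sub_zero]

end PoissonOperator

/-! ### Variations and gradients -/

section Gradient

variable {E U : Type*} [NormedAddCommGroup E] [InnerProductSpace ℝ E] [FiniteDimensional ℝ E]
  [TopologicalSpace U] [ChartedSpace E U] [Group U] [LieGroup 𝓘(ℝ, E) ∞ U]

/-- Every `c` in the Lie algebra is the velocity at `0` of a curve in `U` on all of `ℝ`, along
which the Adjoint action is smooth. -/
lemma exists_smooth_curve (hinv : AdInvariant E U) (c : E) :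
    ∃ k : ℝ → U, k 0 = 1 ∧ HasLogDeriv k c 0 ∧ ContDiff ℝ ∞ fun s => (AdL (k s) : E →L[ℝ] E) := by
  obtain ⟨β⟩ : Nonempty (ContDiffBump (0 : ℝ)) := inferInstance
  have h1 : HasCompactSupport fun x => β x • c := β.hasCompactSupport.smul_right
  have h2 : ContDiff ℝ ∞ fun x => β x • c := β.contDiff.smul contDiff_const
  obtain ⟨g, -, hgl, hgd⟩ := exists_frame_of_schwartz hinv (h1.toSchwartzMap h2)
  have hF : IsFrame g (h1.toSchwartzMap h2) := ⟨isDecaying_schwartz _, hgd, hgl⟩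
  refine ⟨fun s => (g 0)⁻¹ * g s, inv_mul_cancel _, ?_, ?_⟩
  · have h3 := (hgd 0).const_mul (g 0)⁻¹
    have e : (h1.toSchwartzMap h2) 0 = c := by
      change β 0 • c = c
      rw [β.one_of_mem_closedBall (by simp [β.rIn_pos.le]), one_smul]
    rwa [e] at h3
  · simp only [AdL_mul]
    exact contDiff_const.clm_comp (hF.bddSmooth_AdL hinv).1

/-- The variation of `γ` by the Adjoint action of a curve `k` in `U`, localized by `ψ`. -/
lemma isVariation_AdL {a : E} {γ : ℝ → E} (hγ : IsCurve U a γ) {k : ℝ → U} {c : E}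
    (hk0 : k 0 = 1) (hk : HasLogDeriv k c 0) (hs : ContDiff ℝ ∞ fun s => (AdL (k s) : E →L[ℝ] E))
    {ψ : ℝ → ℝ} (hψ : ContDiff ℝ ∞ ψ) (hψc : HasCompactSupport ψ) :
    IsVariation U a γ (fun s x => AdL (k (s * ψ x)) (γ x)) ∧
      ∀ x, deriv (fun s => AdL (k (s * ψ x)) (γ x)) 0 = ψ x • br U c (γ x) := by
  have hd : ∀ x, deriv (fun s => AdL (k (s * ψ x)) (γ x)) 0 = ψ x • br U c (γ x) := by
    intro x
    have h1 : HasDerivAt (fun r => AdL (k r) (γ x)) (br U c (γ x)) ((0 : ℝ) * ψ x) := by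
      have := hk.hasDerivAt_AdL (γ x)
      rw [hk0, AdL_one] at this
      rw [zero_mul]
      exact this
    have h2 : HasDerivAt (fun s : ℝ => s * ψ x) (ψ x) 0 := by
      simpa using (hasDerivAt_id (0 : ℝ)).mul_const (ψ x)
    exact (h1.scomp (0 : ℝ) h2).deriv
  refine ⟨⟨?_, ?_, ?_, ?_, ?_⟩, hd⟩
  · have h3 : ContDiff ℝ ∞ fun p : ℝ × ℝ => p.1 * ψ p.2 :=
      contDiff_fst.mul (hψ.comp contDiff_snd)
    exact (hs.comp h3).clm_apply (hγ.smooth.comp contDiff_snd)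
  · funext x
    rw [zero_mul, hk0, AdL_one]; rfl
  · intro s x
    obtain ⟨h, hh⟩ := hγ.mem x
    refine ⟨k (s * ψ x) * h, ?_⟩
    rw [← hh, ← AdL_apply, ← AdL_apply, AdL_mul]; rfl
  · intro x
    rw [hd x]
    exact Submodule.smul_mem _ _ ⟨c, rfl⟩
  · obtain ⟨R, hR⟩ := hψc.isBounded.subset_closedBall 0
    refine ⟨R + 1, fun s x hx => ?_⟩
    have h4 : ψ x = 0 := by
      by_contra h5
      have h6 := hR (subset_tsupport ψ h5)
      rw [mem_closedBall_zero_iff, Real.norm_eq_abs] at h6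
      linarith
    rw [h4, mul_zero, hk0, AdL_one]; rfl

/-- A continuous field tangent to the orbit is determined by its `L²` pairing with variations. -/
lemma eq_of_integral_variation (hinv : AdInvariant E U) {a : E} {γ ξ ξ' : ℝ → E}
    (hγ : IsCurve U a γ) (hξ : IsTangentField U γ ξ) (hξ' : IsTangentField U γ ξ')
    (h : ∀ Γ, IsVariation U a γ Γ → ∫ x, ⟪ξ x, deriv (fun s => Γ s x) 0⟫ =
      ∫ x, ⟪ξ' x, deriv (fun s => Γ s x) 0⟫) : ξ = ξ' := by
  have hc : Continuous fun x => ξ x - ξ' x := hξ.smooth.continuous.sub hξ'.smooth.continuous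
  have key : ∀ (c : E) (x : ℝ), ⟪ξ x - ξ' x, br U c (γ x)⟫ = 0 := by
    intro c
    obtain ⟨k, hk0, hk, hs⟩ := exists_smooth_curve (U := U) hinv c
    have hbr : Continuous fun x => br U c (γ x) :=
      (contDiff_br contDiff_const hγ.smooth).continuous
    have hf : Continuous fun x => ⟪ξ x - ξ' x, br U c (γ x)⟫ := hc.inner hbr
    have hae : ∀ᵐ x : ℝ, ⟪ξ x - ξ' x, br U c (γ x)⟫ = 0 := by
      refine ae_eq_zero_of_integral_contDiff_smul_eq_zero hf.locallyIntegrable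
        fun ψ hψ hψc => ?_
      obtain ⟨hv, hd⟩ := isVariation_AdL hγ hk0 hk hs hψ hψc
      have h1 := h _ hv
      simp only [hd, inner_smul_right] at h1
      have hi : ∀ η : ℝ → E, Continuous η → Integrable fun x => ψ x * ⟪η x, br U c (γ x)⟫ :=
        fun η hη => (hψ.continuous.mul (hη.inner hbr)).integrable_of_hasCompactSupport
          hψc.mul_right
      simp only [smul_eq_mul, inner_sub_left, mul_sub]
      rw [integral_sub (hi ξ hξ.smooth.continuous) (hi ξ' hξ'.smooth.continuous), h1, sub_self]
    exact fun x => congrFun ((hf.ae_eq_iff_eq volume continuous_const).1 hae) x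
  funext x
  obtain ⟨c, hc⟩ := Submodule.sub_mem _ (hξ.mem x) (hξ'.mem x)
  have h1 := key c x
  rw [J_apply] at hc
  rw [hc, inner_self_eq_zero] at h1
  exact sub_eq_zero.1 h1

/-- The derivative of `∫ ⟨γ, b⟩ dx` along a compactly supported variation. -/
lemma IsVariation.hasDerivAt_integral {a : E} {γ : ℝ → E} {Γ : ℝ → ℝ → E}
    (hΓ : IsVariation U a γ Γ) (b : E) :
    HasDerivAt (fun s => ∫ x, (⟪Γ s x, b⟫ - ⟪γ x, b⟫))
      (∫ x, ⟪deriv (fun s => Γ s x) 0, b⟫) 0 := by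
  obtain ⟨R, hR⟩ := hΓ.support
  have hs := hΓ.smooth
  set G : ℝ × ℝ → E := fun p => fderiv ℝ (fun p : ℝ × ℝ => Γ p.1 p.2) p (1, 0) with hG
  have hGc : Continuous G := (hs.continuous_fderiv (by simp)).clm_apply continuous_const
  have hd : ∀ s x, HasDerivAt (fun s => Γ s x) (G (s, x)) s := by
    intro s x
    have h1 := (hs.differentiable (by simp) (s, x)).hasFDerivAt
    exact h1.comp_hasDerivAt s ((hasDerivAt_id s).prodMk (hasDerivAt_const s x))
  have hγ : ∀ x, γ x = Γ 0 x := fun x => by rw [hΓ.zero]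
  have hG0 : ∀ s x, R ≤ |x| → G (s, x) = 0 := by
    intro s x hx
    have h1 : (fun s => Γ s x) = fun _ => γ x := funext fun s => hR s x hx
    have h2 := hd s x
    rw [h1] at h2
    exact h2.unique (hasDerivAt_const _ _)
  obtain ⟨C, hC⟩ := ((isCompact_Icc (a := (-1 : ℝ)) (b := 1)).prod
    (isCompact_Icc (a := -R) (b := R))).exists_bound_of_continuousOn hGc.continuousOn
  have hcont : ∀ s, Continuous fun x => Γ s x := fun s =>
    hs.continuous.comp (continuous_const.prodMk continuous_id)
  have hFc : ∀ s, Continuous fun x => ⟪Γ s x, b⟫ - ⟪γ x, b⟫ := fun s => by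
    simp only [hγ]
    exact ((hcont s).inner continuous_const).sub ((hcont 0).inner continuous_const)
  have hres := hasDerivAt_integral_of_dominated_loc_of_deriv_le (μ := volume) (𝕜 := ℝ)
    (F := fun s x => ⟪Γ s x, b⟫ - ⟪γ x, b⟫) (F' := fun s x => ⟪G (s, x), b⟫) (x₀ := 0)
    (s := Ioo (-1) 1) (bound := (Icc (-R) R).indicator fun _ => |C| * ‖b‖)
    (Ioo_mem_nhds (by norm_num) (by norm_num))
    (Eventually.of_forall fun s => (hFc s).aestronglyMeasurable)
    (by simp [hγ])
    ((hGc.comp (continuous_const.prodMk continuous_id)).inner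
      continuous_const).aestronglyMeasurable
    (Eventually.of_forall fun x s hsI => ?_)
    ((integrable_indicator_iff measurableSet_Icc).2 continuous_const.integrableOn_Icc)
    (Eventually.of_forall fun x s _ => ?_)
  · have h3 : ∀ x, deriv (fun s => Γ s x) 0 = G (0, x) := fun x => (hd 0 x).deriv
    simp only [h3]
    exact hres.2
  · by_cases hx : x ∈ Icc (-R) R
    · rw [indicator_of_mem hx]
      refine (norm_inner_le_norm _ _).trans ?_
      gcongr
      exact (hC (s, x) ⟨Ioo_subset_Icc_self hsI, hx⟩).trans (le_abs_self C)
    · rw [indicator_of_notMem hx]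
      have : R ≤ |x| := by
        by_contra h4
        exact hx ⟨(abs_lt.1 (not_le.1 h4)).1.le, (abs_lt.1 (not_le.1 h4)).2.le⟩
      simp [hG0 s x this]
  · simpa using ((hd s x).inner ℝ (hasDerivAt_const s b)).sub_const ⟪γ x, b⟫

end Gradient

/-! ### The Hamiltonian vector -/

section Hamiltonian

variable {E U : Type*} [NormedAddCommGroup E] [InnerProductSpace ℝ E] [FiniteDimensional ℝ E]
  [TopologicalSpace U] [ChartedSpace E U] [Group U] [LieGroup 𝓘(ℝ, E) ∞ U] [CompactSpace U]

section Curve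

variable {a b : E} {γ : ℝ → E} {g : ℝ → U} {u : 𝓢(ℝ, E)}

lemma hasDerivAt_AdL_inv_const (hF : IsFrame g u) (b : E) (x : ℝ) :
    HasDerivAt (fun x => AdL (g x)⁻¹ b) (-br U (u x) (AdL (g x)⁻¹ b)) x := by
  have h := hF.hasDerivAt_AdL_inv (hasDerivAt_const x b)
  rwa [map_zero, zero_sub] at h

lemma bddSmooth_AdL_inv_const (hinv : AdInvariant E U) (hF : IsFrame g u) (b : E) :
    IsBddSmooth univ (fun x => AdL (g x)⁻¹ b) :=
  (hF.bddSmooth_AdL_inv hinv).bilin (ContinuousLinearMap.id ℝ (E →L[ℝ] E)) (IsBddSmooth.const b)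

/-- The gradient of `∫ ⟨γ, b⟩ dx` is the projection of `b` to the tangent spaces of the orbit, which
in the moving frame is `π₁(g⁻¹ b g)`. -/
lemma isGradient_inner (hinv : AdInvariant E U) (hγ : IsCurve U a γ) (hb : b ∈ isotropy U a) :
    IsGradient U a (fun y => ⟪y, b⟫) γ
      (fun x => AdL (frame U a γ x) (proj₁ U a (AdL (frame U a γ x)⁻¹ b))) := by
  have hD := isDevelopment_frame hinv hγ
  have hF := hD.isFrame
  have hγA : ∀ x, γ x = AdL (frame U a γ x) a := hD.curve
  have hB := bddSmooth_AdL_inv_const hinv hF b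
  have hB₁ : IsBddSmooth univ fun x => proj₁ U a (AdL (frame U a γ x)⁻¹ b) :=
    hB.clm (isotropy U a)ᗮ.starProjection
  have hmem : ∀ x, AdL (frame U a γ x) (proj₁ U a (AdL (frame U a γ x)⁻¹ b)) ∈
      (isotropy U (γ x))ᗮ := fun x => by
    rw [hγA x]
    exact AdL_mem_isotropy_orthogonal hinv _ (proj₁_mem _ _)
  refine ⟨⟨hF.contDiff_AdL hinv hB₁.1, fun x => ?_, ?_, ?_⟩, fun Γ hΓ => ?_⟩
  · rw [orbitTangent_eq hinv]
    exact hmem x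
  · refine hF.tendsto_AdL_apply ?_
    have h1 := ((isotropy U a)ᗮ.starProjection.continuous.tendsto b).comp
      (hF.tendsto_AdL_inv_apply (tendsto_const_nhds (x := b)))
    have h2 : (isotropy U a)ᗮ.starProjection b = 0 := proj₁_of_mem_isotropy hb
    rw [h2] at h1
    exact h1
  · refine IsDecaying.exists_schwartz ?_
    have h1 : IsDecaying univ fun x => AdL (frame U a γ x)
        (proj₁ U a (-br U (Φ U a γ x) (AdL (frame U a γ x)⁻¹ b)) +
          br U (Φ U a γ x) (proj₁ U a (AdL (frame U a γ x)⁻¹ b))) :=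
      hF.decaying_AdL hinv (((hF.decaying.br_left hB).neg.clm (isotropy U a)ᗮ.starProjection).add
        (hF.decaying.br_left hB₁))
    convert h1 using 1
    funext x
    exact (hF.hasDerivAt_AdL ((isotropy U a)ᗮ.starProjection.hasFDerivAt.comp_hasDerivAt x
      (hasDerivAt_AdL_inv_const hF b x))).deriv
  · convert hΓ.hasDerivAt_integral b using 1
    refine integral_congr_ae (Eventually.of_forall fun x => ?_)
    set η := deriv (fun s => Γ s x) 0 with hη
    have h1 : AdL (frame U a γ x)⁻¹ η ∈ (isotropy U a)ᗮ := by
      have h2 := hΓ.deriv_mem x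
      rw [orbitTangent_eq hinv] at h2
      have h3 := AdL_mem_isotropy_orthogonal hinv (frame U a γ x)⁻¹ h2
      rwa [hγA x, AdL_inv_apply] at h3
    change ⟪AdL (frame U a γ x) (proj₁ U a (AdL (frame U a γ x)⁻¹ b)), η⟫ = ⟪η, b⟫
    rw [← inner_AdL hinv (frame U a γ x)⁻¹, AdL_inv_apply, inner_proj₁_left h1, inner_AdL hinv,
      real_inner_comm]

/-- The covector of the gradient: `P_u(w) = [g⁻¹ b g, a]` for `w = π₁(W)`, with
`W_x + [u, W] = [g⁻¹ b g, a]` and `W → 0` at `-∞`. -/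
lemma exists_covector (hinv : AdInvariant E U) (hγ : IsCurve U a γ) (hb : b ∈ isotropy U a) :
    ∃ w : ℝ → E, IsCovector U a w ∧ HasAdjoint U a γ w
      (fun x => AdL (frame U a γ x) (proj₁ U a (AdL (frame U a γ x)⁻¹ b))) := by
  have hD := isDevelopment_frame hinv hγ
  have hF := hD.isFrame
  set g := frame U a γ with hg
  set u := Φ U a γ with hu
  set B : ℝ → E := fun x => AdL (g x)⁻¹ b with hBdef
  have hB := bddSmooth_AdL_inv_const hinv hF b
  have hBd := hasDerivAt_AdL_inv_const hF b
  have hz : IsDecaying (Iic 0) fun x => br U (B x) a := by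
    refine IsDecaying.of_tendsto (contDiff_br hB.1 contDiff_const) ?_ ?_
    · have h1 : deriv (fun x => br U (B x) a) = fun x => br U (-br U (u x) (B x)) a := by
        funext x
        have h2 := hasDerivAt_br (U := U) (hBd x) (hasDerivAt_const x a)
        rw [br_zero_right, zero_add] at h2
        exact h2.deriv
      rw [h1]
      exact ((hF.decaying.br_left hB).neg.br_left (IsBddSmooth.const a)).mono
    · have h1 := tendsto_br (U := U) (hF.tendsto_AdL_inv_apply (tendsto_const_nhds (x := b)))
        (tendsto_const_nhds (x := a))
      rwa [mem_isotropy.1 hb] at h1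
  have hAz := hF.decaying_AdL hinv hz
  set V : ℝ → E := fun x => ∫ y in Iic x, AdL (g y) (br U (B y) a) with hV
  set W : ℝ → E := fun x => AdL (g x)⁻¹ (V x) with hW
  have hWdec : IsDecaying (Iic 0) W := hF.decaying_AdL_inv hinv hAz.primitive
  have hVd : ∀ x, HasDerivAt V (AdL (g x) (br U (B x) a)) x := hAz.hasDerivAt_primitive
  have hWd : ∀ x, HasDerivAt W (br U (B x) a - br U (u x) (W x)) x := fun x => by
    have h := hF.hasDerivAt_AdL_inv (hVd x)
    rwa [AdL_inv_apply] at h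
  have hw : IsDecaying (Iic 0) fun x => proj₁ U a (W x) :=
    hWdec.clm (isotropy U a)ᗮ.starProjection
  have hPw : ∀ x, P U a u (fun x => proj₁ U a (W x)) x = br U (B x) a := fun x => by
    rw [P_proj₁ hinv hF.decaying.mono hD.mem hWdec.isBddSmooth hWd
      (fun x => br_mem_isotropy_orthogonal_right hinv a _) hWdec.tendsto_atBot,
      proj₀_of_mem (zero_mem _), br_zero_right, sub_zero]
  refine ⟨fun x => proj₁ U a (W x), ⟨hw.1, fun x => proj₁_mem _ _, fun k n => hw.2 k n⟩, ?_, ?_⟩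
  · intro η Y v hηv hYs hYc hη hv
    have hη' : ∀ x, η x = AdL (g x) (br U (Y x) a) := hη
    have hAYd : ∀ x, HasDerivAt (fun x => AdL (g x) (Y x)) (AdL (g x) (v x)) x := fun x => by
      rw [hv x]
      exact hF.hasDerivAt_AdL (hYs.differentiable (by simp) x).hasDerivAt
    -- `⟪w, v⟫ - ⟪ξ, η⟫` is the derivative of a function of compact support
    have hpair : ∀ x, HasDerivAt (fun x => ⟪V x, AdL (g x) (Y x)⟫)
        (⟪proj₁ U a (W x), v x⟫ - ⟪AdL (g x) (proj₁ U a (B x)), η x⟫) x := fun x => by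
      have h1 := (hVd x).inner ℝ (hAYd x)
      have h2 : ⟪V x, AdL (g x) (v x)⟫ = ⟪proj₁ U a (W x), v x⟫ := by
        have hgW : AdL (g x) (W x) = V x := AdL_apply_inv _ _
        rw [inner_proj₁_left (hηv.mem hinv x), ← hgW, inner_AdL hinv]
      have h3 : ⟪AdL (g x) (br U (B x) a), AdL (g x) (Y x)⟫ =
          -⟪AdL (g x) (proj₁ U a (B x)), η x⟫ := by
        rw [hη' x, inner_AdL hinv, inner_AdL hinv, ← br_proj₁, br_skew, inner_neg_left,
          inner_br hinv, neg_neg, br_skew a (Y x), inner_neg_right]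
      rw [h2, h3, ← sub_eq_add_neg] at h1
      exact h1
    have hcV : Continuous V := hAz.contDiff_primitive.continuous
    have hcAY : Continuous fun x => AdL (g x) (Y x) := (hF.contDiff_AdL hinv hYs).continuous
    have hsAY : HasCompactSupport fun x => AdL (g x) (Y x) := by
      refine hYc.mono fun x hx hY => hx ?_
      simp only [hY, map_zero]
    have hsη : HasCompactSupport η := by
      refine hYc.mono fun x hx hY => hx ?_
      rw [hη' x, hY, br_zero_left, map_zero]
    have hsv : HasCompactSupport v := by
      have h1 : HasCompactSupport fun x => AdL (g x) (v x) := by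
        have h2 := hsAY.deriv
        rwa [funext fun x => (hAYd x).deriv] at h2
      refine h1.mono fun x hx h0 => hx ?_
      have h2 : AdL (g x) (v x) = 0 := h0
      rw [← AdL_inv_apply (g x) (v x), h2, map_zero]
    have hcξ : Continuous fun x => AdL (g x) (proj₁ U a (B x)) :=
      (hF.contDiff_AdL hinv (hB.clm (isotropy U a)ᗮ.starProjection).1).continuous
    have hcη : Continuous η := hηv.1.smooth.continuous
    have hi1 : Integrable fun x => ⟪proj₁ U a (W x), v x⟫ :=
      (hw.1.continuous.inner v.continuous).integrable_of_hasCompactSupport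
        (hsv.mono fun x hx h0 => hx (by simp only [h0, inner_zero_right]))
    have hi2 : Integrable fun x => ⟪AdL (g x) (proj₁ U a (B x)), η x⟫ :=
      (hcξ.inner hcη).integrable_of_hasCompactSupport
        (hsη.mono fun x hx h0 => hx (by simp only [h0, inner_zero_right]))
    have hi3 : Integrable fun x => ⟪V x, AdL (g x) (Y x)⟫ :=
      (hcV.inner hcAY).integrable_of_hasCompactSupport
        (hsAY.mono fun x hx h0 => hx (by simp only [h0, inner_zero_right]))
    have h4 := integral_eq_zero_of_hasDerivAt_of_integrable hpair (hi1.sub hi2) hi3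
    rw [integral_sub hi1 hi2] at h4
    exact sub_eq_zero.1 h4
  · intro x
    change AdL (g x) (proj₁ U a (B x)) = AdL (g x) (JInv U a (P U a u _ x))
    rw [hPw x, ← br_proj₁, JInv_br (proj₁_mem _ _)]

/-- `(J₃)_u(w) = P_u(Z₁)` with `[Z₁, a] = -[u, b]`, whenever `ξ = ∇H_b` is the image of `w`. -/
lemma J₃_eq (hinv : AdInvariant E U) (hγ : IsCurve U a γ) (hb : b ∈ isotropy U a) {w : ℝ → E}
    (hw : IsCovector U a w) (h : HasAdjoint U a γ w
      (fun x => AdL (frame U a γ x) (proj₁ U a (AdL (frame U a γ x)⁻¹ b)))) :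
    J₃ U a (Φ U a γ) w = P U a (Φ U a γ) (fun x => JInv U a (-br U (Φ U a γ x) b)) := by
  have hD := isDevelopment_frame hinv hγ
  have hF := hD.isFrame
  have h1 : ∀ x, JInv U a (P U a (Φ U a γ) w x) = proj₁ U a (AdL (frame U a γ x)⁻¹ b) := by
    intro x
    have h2 := h.2 x
    have h3 := congrArg (AdL (frame U a γ x)⁻¹) h2.symm
    rw [AdL_inv_apply] at h3
    rw [← h3, ← AdL_apply, AdL_inv_apply]
  have h4 : PJInv U a (Φ U a γ) (fun x => J U a (w x)) = P U a (Φ U a γ) w := by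
    have : (fun x => JInv U a (J U a (w x))) = w := funext fun x => JInv_br (hw.mem x)
    rw [PJInv, this]
  have h5 : PJInv U a (Φ U a γ) (P U a (Φ U a γ) w) = fun x => -br U (Φ U a γ x) b := by
    rw [PJInv, funext h1]
    funext x
    rw [P_proj₁ hinv (z := fun _ => 0) hF.decaying.mono hD.mem
      (bddSmooth_AdL_inv_const hinv hF b).mono
      (fun x => by simpa using hasDerivAt_AdL_inv_const hF b x) (fun _ => zero_mem _)
      (hF.tendsto_AdL_inv_apply tendsto_const_nhds), proj₀_of_mem hb, zero_sub]
  rw [J₃, h4, h5, PJInv]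

/-- The vector field that `dΦ_γ` maps to `P_u(Z₁)`, `[Z₁, a] = -[u, b]`, is `-(b̂(γ))_x`. -/
lemma br_integral_eq (hinv : AdInvariant E U) (ha : IsPrincipal U a) (hγ : IsCurve U a γ)
    (hb : b ∈ isotropy U a) {Z₁ : ℝ → E} (hZ : IsDecaying univ Z₁)
    (hZb : ∀ x, br U (Z₁ x) a = -br U (Φ U a γ x) b) (x : ℝ) :
    br U (∫ y in Iic x, AdL (frame U a γ y) (P U a (Φ U a γ) Z₁ y)) (γ x) =
      -deriv (fun y => hat U a b (γ y)) x := by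
  have hD := isDevelopment_frame hinv hγ
  have hF := hD.isFrame
  have hγA : ∀ x, γ x = AdL (frame U a γ x) a := hD.curve
  have h1 : (fun y => hat U a b (γ y)) = fun y => AdL (frame U a γ y) b := by
    funext y
    rw [hγA y, hat_AdL hinv ha hb]
  have hh : -∫ s in Iic x, proj₀ U a (br U (Φ U a γ s) (Z₁ s)) ∈ isotropy U a :=
    neg_mem (integral_proj₀_mem (hF.decaying.br_left hZ.isBddSmooth).mono x)
  rw [(AdL_eq_integral_P hinv hF hZ).2 x, h1, ((hF.log x).hasDerivAt_AdL b).deriv]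
  rw [hγA x, ← AdL_br, br_add_left, mem_isotropy.1 hh, add_zero, hZb, map_neg]

lemma contDiff_hat (hinv : AdInvariant E U) (ha : IsPrincipal U a) (hγ : IsCurve U a γ)
    (hb : b ∈ isotropy U a) : ContDiff ℝ ∞ (fun x => hat U a b (γ x)) := by
  have hD := isDevelopment_frame hinv hγ
  have hγA : ∀ x, γ x = AdL (frame U a γ x) a := hD.curve
  have h1 : (fun y => hat U a b (γ y)) = fun y => AdL (frame U a γ y) b := by
    funext y
    rw [hγA y, hat_AdL hinv ha hb]
  rw [h1]
  exact hD.isFrame.contDiff_AdL hinv contDiff_const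

/-- The Hamiltonian vector of `∫ ⟨γ, b⟩ dx` exists, is unique and is `-(b̂(γ))_x`. -/
theorem isHamiltonianVector_iff (hinv : AdInvariant E U) (ha : IsPrincipal U a)
    (hγ : IsCurve U a γ) (hb : b ∈ isotropy U a) (X : ℝ → E) :
    IsHamiltonianVector U a (fun y => ⟪y, b⟫) γ X ↔
      X = fun x => -deriv (fun y => hat U a b (γ y)) x := by
  have hD := isDevelopment_frame hinv hγ
  have hF := hD.isFrame
  obtain ⟨R, hR⟩ := exists_clm_JInv (U := U) hinv a
  have hub : ∀ x, -br U (Φ U a γ x) b ∈ (isotropy U a)ᗮ := fun x => by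
    rw [br_skew, neg_neg]
    exact br_mem_isotropy_orthogonal hinv hb (hD.mem x)
  set Z₁ : ℝ → E := fun x => JInv U a (-br U (Φ U a γ x) b) with hZ₁
  have hZR : ∀ x, R (-br U (Φ U a γ x) b) = Z₁ x := fun x => (hR _ (hub x)).1
  have hZb : ∀ x, br U (Z₁ x) a = -br U (Φ U a γ x) b := fun x => by
    rw [← hZR x]
    exact (hR _ (hub x)).2.2
  have hZmem : ∀ x, Z₁ x ∈ (isotropy U a)ᗮ := fun x => by
    rw [← hZR x]
    exact (hR _ (hub x)).2.1
  have hZ : IsDecaying univ Z₁ := by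
    have h1 := ((hF.decaying.br_left (U := U) (IsBddSmooth.const b)).neg).clm R
    convert h1 using 1
    funext x
    exact (hZR x).symm
  constructor
  · rintro ⟨ξ, hξ, w, hw, hwξ, v, hv, hX⟩
    have hG := isGradient_inner hinv hγ hb
    have e : ξ = fun x => AdL (frame U a γ x) (proj₁ U a (AdL (frame U a γ x)⁻¹ b)) :=
      eq_of_integral_variation hinv hγ hξ.1 hG.1 fun Γ hΓ => (hξ.2 Γ hΓ).unique (hG.2 Γ hΓ)
    subst e
    funext x
    rw [hX.eq_br hinv x, ← br_integral_eq hinv ha hγ hb hZ hZb]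
    simp only [hv, J₃_eq hinv hγ hb hw hwξ, hZ₁]
  · rintro rfl
    obtain ⟨w, hw, hwξ⟩ := exists_covector hinv hγ hb
    obtain ⟨v, hv⟩ := (AdL_eq_integral_P hinv hF hZ).1.exists_schwartz
    have hvmem : ∀ x, v x ∈ (isotropy U a)ᗮ := fun x => by
      have h0 : HasDerivAt Z₁ (proj₁ U a (deriv Z₁ x)) x := by
        have h1 := (isotropy U a)ᗮ.starProjection.hasFDerivAt.comp_hasDerivAt x
          (hZ.1.differentiable (by simp) x).hasDerivAt
        have h2 : (isotropy U a)ᗮ.starProjection ∘ Z₁ = Z₁ :=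
          funext fun x => proj₁_of_mem (hZmem x)
        rwa [h2] at h1
      have hh : -∫ s in Iic x, proj₀ U a (br U (Φ U a γ s) (Z₁ s)) ∈ isotropy U a :=
        neg_mem (integral_proj₀_mem (hF.decaying.br_left hZ.isBddSmooth).mono x)
      rw [hv x, P, h0.deriv]
      refine add_mem (add_mem (proj₁_mem _ _) (proj₁_mem _ _)) ?_
      rw [br_skew]
      exact neg_mem (br_mem_isotropy_orthogonal hinv hh (hD.mem x))
    refine ⟨_, isGradient_inner hinv hγ hb, w, hw, hwξ, v, fun x => ?_, ?_⟩
    · rw [hv x, J₃_eq hinv hγ hb hw hwξ]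
    · have h1 := hasDevDeriv_of_mem hinv hγ hvmem
      convert h1 using 1
      funext x
      simp only [hv]
      exact (br_integral_eq hinv ha hγ hb hZ hZb x).symm

end Curve

lemma hat_neg {a : E} (b y : E) : hat U a (-b) y = -hat U a b y := by
  unfold hat
  split_ifs with h
  · rw [← AdL_apply, ← AdL_apply, map_neg]
  · rw [neg_zero]

end Hamiltonian

end AdjointCurves

end

theorem proposition2p19 {E U : Type*} [NormedAddCommGroup E] [InnerProductSpace ℝ E]
    [FiniteDimensional ℝ E] [TopologicalSpace U] [ChartedSpace E U] [Group U]
    [LieGroup 𝓘(ℝ, E) ∞ U] [T2Space U] [CompactSpace U]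
    (hinv : AdjointCurves.AdInvariant E U)
    (a b : E) (ha : AdjointCurves.IsPrincipal U a) (hb : b ∈ AdjointCurves.orbitNormal U a) :
    -- `b̂` is well defined on `M_a`
    (∀ g : U, AdjointCurves.hat U a b (AdjointCurves.Ad g a) = AdjointCurves.Ad g b) ∧
    -- at every curve, the Hamiltonian vector of `H_b` exists, is unique, and equals `-(b̂(γ))_x`
    (∀ γ : ℝ → E, AdjointCurves.IsCurve U a γ →
      ContDiff ℝ ∞ (fun x => AdjointCurves.hat U a b (γ x)) ∧
      ∀ X : ℝ → E, AdjointCurves.IsHamiltonianVector U a (fun y => ⟪y, b⟫) γ X ↔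
        X = fun x => -deriv (fun y => AdjointCurves.hat U a b (γ y)) x) ∧
    -- the Hamiltonian flow of `-H_b` is the Ferapontov flow
    (∀ (T : Set ℝ) (Γ : ℝ → ℝ → E), IsOpen T → (∀ t ∈ T, AdjointCurves.IsCurve U a (Γ t)) →
      (AdjointCurves.IsHamiltonianFlow U a (fun y => -⟪y, b⟫) T Γ ↔
        AdjointCurves.IsFerapontovFlow U a b T Γ)) := by
  rw [AdjointCurves.orbitNormal_eq hinv] at hb
  refine ⟨fun g => AdjointCurves.hat_AdL hinv ha hb g,
    fun γ hγ => ⟨AdjointCurves.contDiff_hat hinv ha hγ hb,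
      AdjointCurves.isHamiltonianVector_iff hinv ha hγ hb⟩, fun T Γ _ hΓ => ?_⟩
  -- `-⟪y, b⟫ = ⟪y, -b⟫`, and `b̂` is linear in `b`
  have key : ∀ t ∈ T, ∀ X : ℝ → E,
      AdjointCurves.IsHamiltonianVector U a (fun y => -⟪y, b⟫) (Γ t) X ↔
        X = deriv (fun y => AdjointCurves.hat U a b (Γ t y)) := by
    intro t ht X
    have h := AdjointCurves.isHamiltonianVector_iff hinv ha (hΓ t ht) (neg_mem hb) X
    have e : (fun y => AdjointCurves.hat U a (-b) (Γ t y)) =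
        -fun y => AdjointCurves.hat U a b (Γ t y) :=
      funext fun y => AdjointCurves.hat_neg b _
    simpa only [inner_neg_right, e, deriv.neg, neg_neg] using h
  constructor
  · intro h t ht x
    obtain ⟨X, hX, hH⟩ := h t ht
    rw [(key t ht X).1 hH] at hX
    exact hX x
  · intro h t ht
    exact ⟨_, h t ht, (key t ht _).2 rfl⟩
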